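/- **Setting.** There are $M\ge 1$ clients; client $i$ has a data distribution $\mathcal D_i$ and a sample loss $f_i(x,y;\xi)$, measurable and $\mathcal D_i$-integrable in $\xi$ and differentiable in $(x,y)\in\mathbb R^{d_1}\times\mathbb R^{d_2}$. Put $f_i(x,y)=\mathbb E_{\xi\sim\mathcal D_i}[f_i(x,y;\xi)]$, $f=\frac1M\sum_{i=1}^M f_i$ and $\Phi(x)=\max_{y\in\mathbb R^{d_2}} f(x,y)$. Assume, with constants $l\ge\mu>0$, $\sigma\ge 0$, $\sigma_G\ge 0$ and $\kappa=l/\mu$: (i) each $f_i$ is differentiable and $\|\nabla f_i(x_1,y_1)-\nabla f_i(x_2,y_2)\|\le l(\|x_1-x_2\|+\|y_1-y_2\|)$; (ii) $\mathbb E[\nabla f_i(x,y;\xi_i)]=\nabla f_i(x,y)$ and $\mathbb E\|\nabla f_i(x,y;\xi_i)-\nabla f_i(x,y)\|^2\le\sigma^2$; (iii) $\|\nabla f_i(x,y)-\nabla f(x,y)\|^2\le\sigma_G^2$ for all $x,y,i$; (iv) $\Phi$ is bounded below; (v) for every $x$ the function $f(x,\cdot)$ has a maximizer, and $\|\nabla_y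 f(x,y)\|^2\ge 2\mu\,[\max_{y'}f(x,y')-f(x,y)]$ for all $x,y$. **Algorithm.** FESS-GDA with parameters $\eta_{x,l},\eta_{y,l},\eta_{x,g},\eta_{y,g},\beta,p,K,T$ and $1\le m\le M$ participating clients runs, for $t=0,\dots,T-1$: draw a uniformly random set $S_t$ of $m$ clients; each $i\in S_t$ starts from $(x^1_{t,i},y^1_{t,i})=(x_t,y_t)$ and performs, for $k=1,\dots,K$, with fresh independent samples $\xi^k_{t,i}\sim\mathcal D_i$, $$x^{k+1}_{t,i}=x^k_{t,i}-\eta_{x,l}\nabla_x f_i(x^k_{t,i},y^k_{t,i};\xi^k_{t,i}),\qquad y^{k+1}_{t,i}=y^k_{t,i}+\eta_{y,l}\nabla_y f_i(x^k_{t,i},y^k_{t,i};\xi^k_{t,i});$$ then $x_{t+1}=x_t+\eta_{x,g}\big(\frac1m\sum_{i\in S_t}x^{K+1}_{t,i}-x_t\big)-\eta_{x,l}\eta_{x,g}Kp(x_t-z_t)$, $y_{t+1}=y_t+\eta_{y,g}\big(\frac1m\sum_{i\in S_t}y^{K+1}_{t,i}-y_t\big)$, $z_{t+1}=z_t+\beta(x_{t+1}-z_t)$.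 Its per-client sample complexity is $KT$ and its communication complexity is $T$. **Proposition 1 (Translation).** There are an absolute constant $A>0$ and a constant $C>0$ depending only on $\sigma,\sigma_G$ such that for all $M,m,l,\mu$ as above and all $\epsilon>0$ one can choose the parameters of FESS-GDA, as functions of $\sigma,\sigma_G,M,m,l,\mu,\epsilon$ only and with $p=0$, so that the following holds for every problem satisfying (i)–(v). The function $\Phi$ is differentiable, and if $(\tilde x,\tilde y)$ is an $(\epsilon,\epsilon/\sqrt\kappa)$-stationary point of $f$, i.e. $\|\nabla_x f(\tilde x,\tilde y)\|\le\epsilon$ and $\|\nabla_y f(\tilde x,\tilde y)\|\le\epsilon/\sqrt\kappa$, then the output $\hat x=x_T$ of FESS-GDA, applied to $\min_x\max_y\{f(x,y)+l\|x-\tilde x\|^2\}$ (the term $l\|x-\tilde x\|^2$ being added to every sample loss) from the initial point $(x_0,y_0)=(\tilde x,\tilde y)$, with arbitrary $z_0$, is an $O(\epsilon)$-stationary point of $\Phi$ in expectation: $\mathbb E\|\nabla\Phi(\hat x)\|\le A\epsilon$. The cost satisfies - $KT\le C\max\{\kappa^5m^{-1}\epsilon^{-2}\log\kappa,\ \kappa\log\kappa\}$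 always; - $T\le C\,\kappa\log\kappa$ if $m=M$ or $\sigma_G=0$; - $T\le C\max\{\kappa^5m^{-1}\epsilon^{-2}\log\kappa,\ \kappa\log\kappa\}$ if $m<M$ and $\sigma_G>0$. In particular, as soon as $m\epsilon^2\le\kappa^4$, both maxima are $\kappa^5m^{-1}\epsilon^{-2}\log\kappa$. -/

import Mathlib

open MeasureTheory ProbabilityTheory

noncomputable section

namespace FedMinimax

universe u v

/-- The Euclidean space `ℝ^d` with the `l₂` norm. -/
abbrev Vec (d : ℕ) : Type := EuclideanSpace ℝ (Fin d)

/-- `∇ₓ g (x, y)`. -/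
def gradX {d₁ d₂ : ℕ} (g : Vec d₁ → Vec d₂ → ℝ) (x : Vec d₁) (y : Vec d₂) : Vec d₁ :=
  gradient (fun x' => g x' y) x

/-- `∇_y g (x, y)`. -/
def gradY {d₁ d₂ : ℕ} (g : Vec d₁ → Vec d₂ → ℝ) (x : Vec d₁) (y : Vec d₂) : Vec d₂ :=
  gradient (fun y' => g x y') y

open Classical in
/-- `P_Y(y) = argmin_{y' ∈ Y} ‖y - y'‖² / 2` (for `Y` nonempty closed convex the minimizer exists
and is unique; if there is no minimizer the value is `y`, which is never used). -/
def projOnto {d : ℕ} (Y : Set (Vec d)) (y : Vec d) : Vec d :=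
  if h : ∃ y' ∈ Y, ∀ y'' ∈ Y, ‖y - y'‖ ^ 2 / 2 ≤ ‖y - y''‖ ^ 2 / 2 then h.choose else y

/-- On the whole space the projection is the identity. -/
theorem projOnto_univ {d : ℕ} (y : Vec d) : projOnto Set.univ y = y := by
  unfold projOnto
  split_ifs with h
  · have h2 := h.choose_spec.2 y (Set.mem_univ y)
    have h3 : ‖y - h.choose‖ ^ 2 ≤ 0 := by
      have h4 : ‖y - y‖ ^ 2 / 2 = 0 := by simp
      linarith
    have h5 : ‖y - h.choose‖ = 0 := by
      have := sq_nonneg ‖y - h.choose‖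
      exact pow_eq_zero_iff (two_ne_zero) |>.1 (le_antisymm h3 this)
    exact (sub_eq_zero.1 (norm_eq_zero.1 h5)).symm
  · rfl

/-- `Φ(x) = max_y f(x, y)` over `y ∈ ℝ^{d₂}`. -/
def Phi {d₁ d₂ : ℕ} (f : Vec d₁ → Vec d₂ → ℝ) (x : Vec d₁) : ℝ :=
  ⨆ y : Vec d₂, f x y

/-- `(x, y)` is an `(ε₁, ε₂)`-stationary point of `f` (for the constraint set `Y` and the
smoothness constant `l`). -/
def IsStationaryPoint {d₁ d₂ : ℕ} (Y : Set (Vec d₂)) (l : ℝ) (f : Vec d₁ → Vec d₂ → ℝ)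
    (ε₁ ε₂ : ℝ) (x : Vec d₁) (y : Vec d₂) : Prop :=
  ‖gradX f x y‖ ≤ ε₁ ∧ l * ‖projOnto Y (y + (1 / l) • gradY f x y) - y‖ ≤ ε₂

/-- A federated minimax problem with `M` clients: client `i` has a data distribution `D i` on the
sample space `Ξ` and a sample loss `loss i x y ξ`. -/
structure FedProblem (M d₁ d₂ : ℕ) (Ξ : Type u) [MeasurableSpace Ξ] where
  /-- data distribution of client `i` -/
  D : Fin M → Measure Ξ
  /-- it is a probability distribution -/
  prob : ∀ i, IsProbabilityMeasure (D i)
  /-- loss of client `i` at `(x, y)` for the data point `ξ` -/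
  loss : Fin M → Vec d₁ → Vec d₂ → Ξ → ℝ

namespace FedProblem

variable {M d₁ d₂ : ℕ} {Ξ : Type u} [MeasurableSpace Ξ]

/-- `f_i(x, y) = 𝔼_{ξ ∼ D_i} [loss_i(x, y; ξ)]`. -/
def localFun (P : FedProblem M d₁ d₂ Ξ) (i : Fin M) (x : Vec d₁) (y : Vec d₂) : ℝ :=
  ∫ ξ, P.loss i x y ξ ∂(P.D i)

/-- `f(x, y) = (1 / M) ∑ i, f_i(x, y)`. -/
def globalFun (P : FedProblem M d₁ d₂ Ξ) (x : Vec d₁) (y : Vec d₂) : ℝ :=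
  (1 / (M : ℝ)) * ∑ i, P.localFun i x y

/-- The problem with `f(x, y)` replaced by `f(x, y) + l ‖x - x₀‖²`: the (deterministic) term
`l ‖x - x₀‖²` is added to every sample loss. -/
def regularize (P : FedProblem M d₁ d₂ Ξ) (l : ℝ) (x₀ : Vec d₁) : FedProblem M d₁ d₂ Ξ where
  D := P.D
  prob := P.prob
  loss := fun i x y ξ => P.loss i x y ξ + l * ‖x - x₀‖ ^ 2

/-- The sample losses are measurable and integrable in the data point and differentiable in
`(x, y)`, so that `f_i` and the stochastic gradients are meaningful. -/
structure Regular (P : FedProblem M d₁ d₂ Ξ) : Prop where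
  measurable_loss : ∀ i x y, Measurable (P.loss i x y)
  integrable_loss : ∀ i x y, Integrable (P.loss i x y) (P.D i)
  differentiable_loss : ∀ i ξ,
    Differentiable ℝ (fun w : Vec d₁ × Vec d₂ => P.loss i w.1 w.2 ξ)

/-- Lipschitz smoothness: each `f_i` is differentiable and
`‖∇f_i(x₁, y₁) - ∇f_i(x₂, y₂)‖ ≤ l (‖x₁ - x₂‖ + ‖y₁ - y₂‖)`, where
`‖∇g‖² = ‖∇ₓ g‖² + ‖∇_y g‖²`. -/
structure Smooth (P : FedProblem M d₁ d₂ Ξ) (l : ℝ) : Prop where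
  differentiable : ∀ i, Differentiable ℝ (fun w : Vec d₁ × Vec d₂ => P.localFun i w.1 w.2)
  lipschitz : ∀ i x₁ x₂ y₁ y₂,
    Real.sqrt (‖gradX (P.localFun i) x₁ y₁ - gradX (P.localFun i) x₂ y₂‖ ^ 2
      + ‖gradY (P.localFun i) x₁ y₁ - gradY (P.localFun i) x₂ y₂‖ ^ 2)
      ≤ l * (‖x₁ - x₂‖ + ‖y₁ - y₂‖)

/-- The stochastic gradients are unbiased with variance at most `σ²`. -/
structure BoundedVariance (P : FedProblem M d₁ d₂ Ξ) (σ : ℝ) : Prop where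
  integrable_gradX : ∀ i x y,
    Integrable (fun ξ => gradX (fun x' y' => P.loss i x' y' ξ) x y) (P.D i)
  integrable_gradY : ∀ i x y,
    Integrable (fun ξ => gradY (fun x' y' => P.loss i x' y' ξ) x y) (P.D i)
  unbiased_gradX : ∀ i x y,
    ∫ ξ, gradX (fun x' y' => P.loss i x' y' ξ) x y ∂(P.D i) = gradX (P.localFun i) x y
  unbiased_gradY : ∀ i x y,
    ∫ ξ, gradY (fun x' y' => P.loss i x' y' ξ) x y ∂(P.D i) = gradY (P.localFun i) x y
  integrable_sq : ∀ i x y, Integrable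
    (fun ξ => ‖gradX (fun x' y' => P.loss i x' y' ξ) x y - gradX (P.localFun i) x y‖ ^ 2
      + ‖gradY (fun x' y' => P.loss i x' y' ξ) x y - gradY (P.localFun i) x y‖ ^ 2) (P.D i)
  variance_le : ∀ i x y,
    ∫ ξ, (‖gradX (fun x' y' => P.loss i x' y' ξ) x y - gradX (P.localFun i) x y‖ ^ 2
      + ‖gradY (fun x' y' => P.loss i x' y' ξ) x y - gradY (P.localFun i) x y‖ ^ 2) ∂(P.D i)
      ≤ σ ^ 2

/-- Bounded heterogeneity: `‖∇f_i(x, y) - ∇f(x, y)‖² ≤ σ_G²` for all `x`, `y`, `i`. -/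
def BoundedHeterogeneity (P : FedProblem M d₁ d₂ Ξ) (σG : ℝ) : Prop :=
  ∀ i x y, ‖gradX (P.localFun i) x y - gradX P.globalFun x y‖ ^ 2
    + ‖gradY (P.localFun i) x y - gradY P.globalFun x y‖ ^ 2 ≤ σG ^ 2

/-- `Φ` is bounded below. -/
def PhiBoundedBelow (P : FedProblem M d₁ d₂ Ξ) : Prop :=
  ∃ Φstar : ℝ, ∀ x, Φstar ≤ Phi P.globalFun x

/-- PL condition in `y` with constant `μ`: for every `x` the function `f(x, ·)` has a maximizer on
`ℝ^{d₂}`, and `‖∇_y f(x, y)‖² ≥ 2 μ (max_y f(x, y) - f(x, y))`. -/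
structure PLInY (P : FedProblem M d₁ d₂ Ξ) (μ : ℝ) : Prop where
  exists_max : ∀ x, ∃ yStar, ∀ y, P.globalFun x y ≤ P.globalFun x yStar
  pl : ∀ x y, 2 * μ * (Phi P.globalFun x - P.globalFun x y) ≤ ‖gradY P.globalFun x y‖ ^ 2

end FedProblem

/-- Parameters of FESS-GDA (apart from the number `T` of communication rounds): local and global
learning rates, smoothing parameters `β`, `p`, and the number `K` of local updates per round. -/
structure Params where
  /-- local learning rate for `x` -/
  ηxl : ℝ
  /-- local learning rate for `y` -/
  ηyl : ℝ
  /-- global learning rate for `x` -/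
  ηxg : ℝ
  /-- global learning rate for `y` -/
  ηyg : ℝ
  /-- step of the `z`-update -/
  β : ℝ
  /-- smoothing weight -/
  p : ℝ
  /-- number of local updates in a round -/
  K : ℕ

/-- Server state `(x_t, y_t, z_t)`. -/
structure State (d₁ d₂ : ℕ) where
  /-- min variable -/
  x : Vec d₁
  /-- max variable -/
  y : Vec d₂
  /-- smoothing variable -/
  z : Vec d₁

section Algorithm

variable {M d₁ d₂ : ℕ} {Ξ : Type u} [MeasurableSpace Ξ]

/-- The iterates of one client `i` during one round, started at `w`, with data points
`ξs 0, ξs 1, …`: `localIter … k` is the local model after `k` local updates. -/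
def localIter (P : FedProblem M d₁ d₂ Ξ) (Y : Set (Vec d₂)) (c : Params) (i : Fin M)
    (ξs : ℕ → Ξ) (w : Vec d₁ × Vec d₂) : ℕ → Vec d₁ × Vec d₂
  | 0 => w
  | k + 1 =>
    let v := localIter P Y c i ξs w k
    (v.1 - c.ηxl • gradX (fun x' y' => P.loss i x' y' (ξs k)) v.1 v.2,
      projOnto Y (v.2 + c.ηyl • gradY (fun x' y' => P.loss i x' y' (ξs k)) v.1 v.2))

/-- One communication round with the set `S` of `m` participating clients, where client `i` uses
the data points `ξs i 0, …, ξs i (K - 1)`. -/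
def fessRound (P : FedProblem M d₁ d₂ Ξ) (Y : Set (Vec d₂)) (c : Params) (m : ℕ)
    (S : Finset (Fin M)) (ξs : Fin M → ℕ → Ξ) (s : State d₁ d₂) : State d₁ d₂ :=
  let xNew := s.x
    + c.ηxg • ((1 / (m : ℝ)) • ∑ i ∈ S, (localIter P Y c i (ξs i) (s.x, s.y) c.K).1 - s.x)
    - (c.ηxl * c.ηxg * c.K * c.p) • (s.x - s.z)
  { x := xNew
    y := projOnto Y (s.y
      + c.ηyg • ((1 / (m : ℝ)) • ∑ i ∈ S, (localIter P Y c i (ξs i) (s.x, s.y) c.K).2 - s.y))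
    z := s.z + c.β • (xNew - s.z) }

/-- FESS-GDA: the server state after `t` communication rounds from `s₀`, when `S t` is the set of
participating clients in round `t` and `ξ t i k` is the data point of client `i` in its `k`-th local
update of round `t`. -/
def fessGDA (P : FedProblem M d₁ d₂ Ξ) (Y : Set (Vec d₂)) (c : Params) (m : ℕ)
    (S : ℕ → Finset (Fin M)) (ξ : ℕ → Fin M → ℕ → Ξ) (s₀ : State d₁ d₂) : ℕ → State d₁ d₂
  | 0 => s₀
  | t + 1 => fessRound P Y c m (S t) (ξ t) (fessGDA P Y c m S ξ s₀ t)

/-- The randomness of the algorithm: `S t` is uniformly distributed on the sets of `m` clients,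
`ξ t i k` has law `D i`, and all these random variables are mutually independent. -/
structure IsSampling {Ω : Type v} [MeasurableSpace Ω] (Pr : Measure Ω) (P : FedProblem M d₁ d₂ Ξ)
    (m : ℕ) (S : ℕ → Ω → Finset (Fin M)) (ξ : ℕ → Fin M → ℕ → Ω → Ξ) : Prop where
  measurable_S : ∀ t, Measurable[_, ⊤] (S t)
  uniform_S : ∀ t, ∀ A : Finset (Fin M), A.card = m →
    Pr.real {ω | S t ω = A} = 1 / (M.choose m : ℝ)
  measurable_sample : ∀ t i k, Measurable (ξ t i k)
  law_sample : ∀ t i k, Pr.map (ξ t i k) = P.D i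
  indep : iIndep (Sum.elim (fun t : ℕ => MeasurableSpace.comap (S t) ⊤)
    (fun q : ℕ × Fin M × ℕ => MeasurableSpace.comap (ξ q.1 q.2.1 q.2.2) inferInstance)) Pr

end Algorithm

end FedMinimax

end

/-! Put g(x,y) = f(x,y) + l‖x - xt‖², Ψ(y) = min_x g(x,y), attained at xs y, and H = inf_x (Φ(x) +
l‖x - xt‖²). Since f is l-smooth, g is l-strongly convex in x, and Ψ inherits a quadratic lower
model with slope ∇_y f(xs y, y) (`RegSaddle.le_regFun_xs`). It also inherits the PL inequality, with
the same μ and with H in place of its maximum (`RegSaddle.le_norm_gy_xs_sq`). Thus both summands of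
the Lyapunov function V = (H - Ψ(y)) + (g(x,y) - Ψ(y)) are controlled by squared gradients.
Descent-ascent with the x-step twice the y-step decreases V: using ∇_y g(x,y) instead of ∇Ψ(y) costs
at most ‖∇ₓ g‖², and the doubled x-step pays for it (`RegSaddle.inner_field_le`). So a step of
effective length η contracts V by 1 - ημ, as long as η is at most of order 1/l.

One round of the algorithm is a step of length η = γ γg K along the mean field, up to three errors
(`server_step_eq`): gradient noise, centred, with variance of order σ²/(mK); the error of sampling
clients, centred, with variance of order σ_G²/m and zero for m = M; and the drift of the local
models, a bias that tends to zero with the local rate γ. Only the product γ γg K enters η, so γ may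
be tiny while γg compensates, and the drift can be bounded crudely.
`LocalOracle.integral_lyapunov_le` sums this up as a geometric term plus a noise floor.

At a stationary starting point V ≤ 3ε²/(2l) (`RegSaddle.saddleLyap_start_le`). Danskin's theorem and
the PL error bound give ‖∇Φ(x)‖ ≤ 10ε + 108 κ² l V/ε (`RegSaddle.norm_gradient_max_le`). Hence V has
to fall only by a factor of order κ²: about 2 log κ / (ημ) rounds, that is κ log κ rounds for η of
order 1/l. The noise floor must be of order ε²/(κ² l), which asks for a variance reduction by R = 1
+ κ³(σ² + σ_G²)/(mε²). Without client sampling error this is bought by about R local steps per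
round; otherwise η is divided by R (`exists_stepSizes`). The work obtained is of order κ⁴ log κ
/(mε²) + κ log κ, within the stated bound. -/

noncomputable section

namespace FedMinimax

universe u v

/-! ### Smooth functions of two variables -/

section Smooth

variable {X Y : Type*} [NormedAddCommGroup X] [InnerProductSpace ℝ X]
  [NormedAddCommGroup Y] [InnerProductSpace ℝ Y]

/-- A first order Taylor estimate on `[0, 1]` with a Lipschitz derivative. -/
theorem abs_sub_sub_le_of_deriv {φ φ' : ℝ → ℝ} {C : ℝ} (h : ∀ t, HasDerivAt φ (φ' t) t)
    (hC : ∀ t ∈ Set.Icc (0 : ℝ) 1, |φ' t - φ' 0| ≤ C * t) :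
    |φ 1 - φ 0 - φ' 0| ≤ C / 2 := by
  have hd : ∀ t, HasDerivAt (fun t => φ t - φ 0 - t * φ' 0) (φ' t - φ' 0) t := fun t => by
    have := ((h t).sub_const (φ 0)).fun_sub ((hasDerivAt_id' t).mul_const (φ' 0))
    rwa [one_mul] at this
  have hB : ∀ t : ℝ, HasDerivAt (fun t => C * t ^ 2 / 2) (C * t) t := fun t => by
    have := (((hasDerivAt_id t).pow 2).const_mul C).div_const 2
    refine this.congr_deriv ?_
    simp
    ring
  have := image_norm_le_of_norm_deriv_right_le_deriv_boundary (a := 0) (b := 1)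
    (fun t _ => (hd t).continuousAt.continuousWithinAt)
    (fun t _ => (hd t).hasDerivWithinAt) (B := fun t => C * t ^ 2 / 2) (by simp) hB
    (fun t ht => hC t ⟨ht.1, ht.2.le⟩) (Set.right_mem_Icc.2 zero_le_one)
  simpa using this

/-- `f` is differentiable with partial gradients `gx` and `gy`, and the full gradient is
`l`-Lipschitz in the sense used for federated minimax problems. -/
structure SmoothPair (f : X → Y → ℝ) (gx : X → Y → X) (gy : X → Y → Y) (l : ℝ) : Prop where
  hasFDerivAt : ∀ x y, HasFDerivAt (fun w : X × Y => f w.1 w.2)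
    ((innerSL ℝ (gx x y)).comp (ContinuousLinearMap.fst ℝ X Y)
      + (innerSL ℝ (gy x y)).comp (ContinuousLinearMap.snd ℝ X Y)) (x, y)
  lipschitz : ∀ x₁ x₂ y₁ y₂,
    Real.sqrt (‖gx x₁ y₁ - gx x₂ y₂‖ ^ 2 + ‖gy x₁ y₁ - gy x₂ y₂‖ ^ 2)
      ≤ l * (‖x₁ - x₂‖ + ‖y₁ - y₂‖)

namespace SmoothPair

variable {f : X → Y → ℝ} {gx : X → Y → X} {gy : X → Y → Y} {l : ℝ}

theorem norm_gx_sub_le (h : SmoothPair f gx gy l) (x₁ x₂ : X) (y₁ y₂ : Y) :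
    ‖gx x₁ y₁ - gx x₂ y₂‖ ≤ l * (‖x₁ - x₂‖ + ‖y₁ - y₂‖) :=
  (Real.le_sqrt_of_sq_le (by nlinarith [sq_nonneg ‖gy x₁ y₁ - gy x₂ y₂‖])).trans
    (h.lipschitz x₁ x₂ y₁ y₂)

theorem norm_gy_sub_le (h : SmoothPair f gx gy l) (x₁ x₂ : X) (y₁ y₂ : Y) :
    ‖gy x₁ y₁ - gy x₂ y₂‖ ≤ l * (‖x₁ - x₂‖ + ‖y₁ - y₂‖) :=
  (Real.le_sqrt_of_sq_le (by nlinarith [sq_nonneg ‖gx x₁ y₁ - gx x₂ y₂‖])).trans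
    (h.lipschitz x₁ x₂ y₁ y₂)

theorem hasDerivAt_line (h : SmoothPair f gx gy l) (x dx : X) (y dy : Y) (t : ℝ) :
    HasDerivAt (fun t : ℝ => f (x + t • dx) (y + t • dy))
      (inner ℝ (gx (x + t • dx) (y + t • dy)) dx + inner ℝ (gy (x + t • dx) (y + t • dy)) dy) t := by
  have h1 : HasDerivAt (fun t : ℝ => (x + t • dx, y + t • dy)) (dx, dy) t := by
    have hx : HasDerivAt (fun t : ℝ => x + t • dx) dx t := by
      simpa using ((hasDerivAt_id t).smul_const dx).const_add x
    have hy : HasDerivAt (fun t : ℝ => y + t • dy) dy t := by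
      simpa using ((hasDerivAt_id t).smul_const dy).const_add y
    exact hx.prodMk hy
  have := (h.hasFDerivAt (x + t • dx) (y + t • dy)).comp_hasDerivAt t h1
  simpa [Function.comp_def] using this

/-- Integration along the segment and Cauchy–Schwarz for the pair of gradients. The free constant
`C` lets one proof serve the joint estimate, where the sum of norms in the Lipschitz condition costs
a factor 2, and the one-variable estimates, which keep the sharp l/2 needed for strong convexity. -/
theorem abs_taylor_le (h : SmoothPair f gx gy l) (x dx : X) (y dy : Y) {C : ℝ}
    (hC : (‖dx‖ + ‖dy‖) * Real.sqrt (‖dx‖ ^ 2 + ‖dy‖ ^ 2) * l ≤ C) :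
    |f (x + dx) (y + dy) - f x y - (inner ℝ (gx x y) dx + inner ℝ (gy x y) dy)| ≤ C / 2 := by
  have := abs_sub_sub_le_of_deriv (C := C) (h.hasDerivAt_line x dx y dy) ?_
  · simpa using this
  · rintro t ⟨ht, -⟩
    have key := h.lipschitz (x + t • dx) x (y + t • dy) y
    simp only [zero_smul, add_zero]
    simp only [add_sub_cancel_left, norm_smul, Real.norm_of_nonneg ht] at key
    set p := gx (x + t • dx) (y + t • dy) - gx x y with hp
    set q := gy (x + t • dx) (y + t • dy) - gy x y with hq
    have e : (inner ℝ (gx (x + t • dx) (y + t • dy)) dx + inner ℝ (gy (x + t • dx) (y + t • dy)) dy)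
        - (inner ℝ (gx x y) dx + inner ℝ (gy x y) dy) = inner ℝ p dx + inner ℝ q dy := by
      rw [hp, hq, inner_sub_left, inner_sub_left]; ring
    rw [e]
    have h1 : |inner ℝ p dx + inner ℝ q dy| ≤ ‖p‖ * ‖dx‖ + ‖q‖ * ‖dy‖ :=
      (abs_add_le _ _).trans (add_le_add (abs_real_inner_le_norm _ _) (abs_real_inner_le_norm _ _))
    have h2 : ‖p‖ * ‖dx‖ + ‖q‖ * ‖dy‖
        ≤ Real.sqrt (‖p‖ ^ 2 + ‖q‖ ^ 2) * Real.sqrt (‖dx‖ ^ 2 + ‖dy‖ ^ 2) := by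
      rw [← Real.sqrt_mul (by positivity)]
      apply Real.le_sqrt_of_sq_le
      nlinarith [sq_nonneg (‖p‖ * ‖dy‖ - ‖q‖ * ‖dx‖)]
    calc |inner ℝ p dx + inner ℝ q dy| ≤ _ := h1.trans h2
      _ ≤ (l * (t * ‖dx‖ + t * ‖dy‖)) * Real.sqrt (‖dx‖ ^ 2 + ‖dy‖ ^ 2) := by gcongr
      _ = ((‖dx‖ + ‖dy‖) * Real.sqrt (‖dx‖ ^ 2 + ‖dy‖ ^ 2) * l) * t := by ring
      _ ≤ C * t := by gcongr

theorem abs_taylor_joint (h : SmoothPair f gx gy l) (hl : 0 ≤ l) (x dx : X) (y dy : Y) :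
    |f (x + dx) (y + dy) - f x y - (inner ℝ (gx x y) dx + inner ℝ (gy x y) dy)|
      ≤ l * (‖dx‖ ^ 2 + ‖dy‖ ^ 2) := by
  have := h.abs_taylor_le x dx y dy (C := 2 * (l * (‖dx‖ ^ 2 + ‖dy‖ ^ 2))) ?_
  · linarith
  · set r := Real.sqrt (‖dx‖ ^ 2 + ‖dy‖ ^ 2) with hr
    have hr2 : r ^ 2 = ‖dx‖ ^ 2 + ‖dy‖ ^ 2 := Real.sq_sqrt (by positivity)
    have hr0 : 0 ≤ r := Real.sqrt_nonneg _
    have h1 : ‖dx‖ + ‖dy‖ ≤ 2 * r := by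
      nlinarith [sq_nonneg (‖dx‖ - ‖dy‖), norm_nonneg dx, norm_nonneg dy]
    have h2 : (‖dx‖ + ‖dy‖) * r ≤ 2 * r ^ 2 := by nlinarith
    rw [hr2] at h2
    nlinarith

theorem abs_taylor_left (h : SmoothPair f gx gy l) (x dx : X) (y : Y) :
    |f (x + dx) y - f x y - inner ℝ (gx x y) dx| ≤ l * ‖dx‖ ^ 2 / 2 := by
  have := h.abs_taylor_le x dx y 0 (C := l * ‖dx‖ ^ 2) ?_
  · simpa using this
  · simp only [norm_zero, add_zero, ne_eq, OfNat.ofNat_ne_zero, not_false_eq_true, zero_pow,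
      Real.sqrt_sq (norm_nonneg dx)]
    exact le_of_eq (by ring)

theorem abs_taylor_right (h : SmoothPair f gx gy l) (x : X) (y dy : Y) :
    |f x (y + dy) - f x y - inner ℝ (gy x y) dy| ≤ l * ‖dy‖ ^ 2 / 2 := by
  have := h.abs_taylor_le x 0 y dy (C := l * ‖dy‖ ^ 2) ?_
  · simpa using this
  · simp only [norm_zero, zero_add, ne_eq, OfNat.ofNat_ne_zero, not_false_eq_true, zero_pow,
      Real.sqrt_sq (norm_nonneg dy)]
    exact le_of_eq (by ring)

theorem continuous_uncurry (h : SmoothPair f gx gy l) : Continuous fun w : X × Y => f w.1 w.2 :=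
  continuous_iff_continuousAt.2 fun w => (h.hasFDerivAt w.1 w.2).continuousAt

theorem continuous_gx (h : SmoothPair f gx gy l) (hl : 0 ≤ l) :
    Continuous fun w : X × Y => gx w.1 w.2 := by
  refine (LipschitzWith.of_dist_le_mul (K := ⟨2 * l, by positivity⟩) fun w w' => ?_).continuous
  rw [dist_eq_norm, dist_eq_norm]
  have := h.norm_gx_sub_le w.1 w'.1 w.2 w'.2
  have h1 : ‖w.1 - w'.1‖ ≤ ‖w - w'‖ := norm_fst_le (w - w')
  have h2 : ‖w.2 - w'.2‖ ≤ ‖w - w'‖ := norm_snd_le (w - w')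
  change _ ≤ 2 * l * _
  nlinarith

theorem continuous_gy (h : SmoothPair f gx gy l) (hl : 0 ≤ l) :
    Continuous fun w : X × Y => gy w.1 w.2 := by
  refine (LipschitzWith.of_dist_le_mul (K := ⟨2 * l, by positivity⟩) fun w w' => ?_).continuous
  rw [dist_eq_norm, dist_eq_norm]
  have := h.norm_gy_sub_le w.1 w'.1 w.2 w'.2
  have h1 : ‖w.1 - w'.1‖ ≤ ‖w - w'‖ := norm_fst_le (w - w')
  have h2 : ‖w.2 - w'.2‖ ≤ ‖w - w'‖ := norm_snd_le (w - w')
  change _ ≤ 2 * l * _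
  nlinarith

/-- The gradient vanishes at a maximizer. -/
theorem gy_eq_zero_of_isMax (h : SmoothPair f gx gy l) (hl : 0 < l) {x : X} {y : Y}
    (hy : ∀ y', f x y' ≤ f x y) : gy x y = 0 := by
  have h1 := h.abs_taylor_right x y ((1 / l) • gy x y)
  have h2 := hy (y + (1 / l) • gy x y)
  rw [inner_smul_right, real_inner_self_eq_norm_sq, norm_smul, mul_pow, Real.norm_eq_abs, sq_abs,
    abs_le] at h1
  have h3 : l * ((1 / l) ^ 2 * ‖gy x y‖ ^ 2) / 2 = (1 / l * ‖gy x y‖ ^ 2) / 2 := by field_simp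
  rw [h3] at h1
  have h4 : 1 / l * ‖gy x y‖ ^ 2 ≤ 0 := by linarith [h1.1]
  have h5 : 0 < 1 / l := by positivity
  have h6 : ‖gy x y‖ ^ 2 ≤ 0 := by nlinarith
  have h7 : ‖gy x y‖ = 0 := by nlinarith [norm_nonneg (gy x y)]
  exact norm_eq_zero.1 h7

/-- Error bound: under the PL condition there is a maximizer of `f x` at distance at most
`2 ‖∇_y f‖ / μ`. -/
theorem exists_isMax_near [FiniteDimensional ℝ Y] (h : SmoothPair f gx gy l) (hl : 0 < l) {μ : ℝ}
    (hμ : 0 < μ) {x : X} {y₀ : Y} (hy₀ : ∀ y', f x y' ≤ f x y₀)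
    (hpl : ∀ y, 2 * μ * (f x y₀ - f x y) ≤ ‖gy x y‖ ^ 2) (y : Y) :
    ∃ yb, (∀ y', f x y' ≤ f x yb) ∧ μ * ‖yb - y‖ ≤ 2 * ‖gy x y‖ := by
  -- Ekeland-type argument: minimize √gap + c‖· - y‖. By PL, √gap has slope at least √(μ/2) wherever
  -- it is positive, which exceeds c = √μ/2, so the minimizer must have zero gap.
  set c := Real.sqrt μ / 2 with hc
  have hc0 : 0 < c := by positivity
  have hc2 : 4 * c ^ 2 = μ := by rw [hc, div_pow, Real.sq_sqrt hμ.le]; ring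
  set gap : Y → ℝ := fun y' => f x y₀ - f x y' with hgap
  have hgap0 : ∀ y', 0 ≤ gap y' := fun y' => sub_nonneg.2 (hy₀ y')
  have hcf : Continuous gap := by
    have : Continuous fun y' : Y => f x y' :=
      h.continuous_uncurry.comp (f := fun y' : Y => (x, y')) (by fun_prop)
    exact continuous_const.sub this
  set J : Y → ℝ := fun y' => Real.sqrt (gap y') + c * ‖y' - y‖ with hJ
  have hJc : Continuous J := by
    have := Real.continuous_sqrt.comp hcf
    exact this.add (by fun_prop)
  have : ProperSpace Y := FiniteDimensional.proper_real Y
  have hJt : Filter.Tendsto J (Filter.cocompact Y) Filter.atTop := by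
    have h1 : Filter.Tendsto (fun y' : Y => c * ‖y' - y‖) (Filter.cocompact Y) Filter.atTop := by
      refine Filter.Tendsto.const_mul_atTop hc0 ?_
      exact (tendsto_dist_left_cocompact_atTop y).congr fun y' => by rw [dist_eq_norm, norm_sub_rev]
    exact Filter.tendsto_atTop_mono (fun y' => le_add_of_nonneg_left (Real.sqrt_nonneg _)) h1
  obtain ⟨yb, hyb⟩ := hJc.exists_forall_le hJt
  have hzero : gap yb = 0 := by
    by_contra hne
    have hpos : 0 < gap yb := lt_of_le_of_ne (hgap0 yb) (Ne.symm hne)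
    set R := Real.sqrt (gap yb) with hR
    have hR0 : 0 < R := Real.sqrt_pos.2 hpos
    have hR2 : R ^ 2 = gap yb := Real.sq_sqrt hpos.le
    set G := ‖gy x yb‖ with hG
    have hGl : 2 * μ * R ^ 2 ≤ G ^ 2 := by rw [hR2]; exact hpl yb
    have hG0 : 0 < G := by
      have : 0 < G ^ 2 := lt_of_lt_of_le (by positivity) hGl
      exact lt_of_le_of_ne (norm_nonneg _) fun h0 => by rw [← h0] at this; simp at this
    -- The first bound keeps the second order Taylor term below a quarter of sG²; the second keeps R
    -- - csG nonnegative, so that the inequality between square roots can be squared.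
    set s := min (1 / (2 * l)) (R / (c * G)) with hs
    have hs0 : 0 < s := by positivity
    have hs1 : s * l ≤ 1 / 2 := by
      have := min_le_left (1 / (2 * l)) (R / (c * G))
      calc s * l ≤ 1 / (2 * l) * l := by gcongr
        _ = 1 / 2 := by field_simp
    have hs2 : c * (s * G) ≤ R := by
      have := min_le_right (1 / (2 * l)) (R / (c * G))
      calc c * (s * G) ≤ c * (R / (c * G) * G) := by gcongr
        _ = R := by field_simp
    have h1 := hyb (yb + s • gy x yb)
    have hnorm : ‖yb + s • gy x yb - y‖ ≤ ‖yb - y‖ + s * G := by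
      have : yb + s • gy x yb - y = (yb - y) + s • gy x yb := by abel
      rw [this]
      refine (norm_add_le _ _).trans ?_
      rw [norm_smul, Real.norm_of_nonneg hs0.le]
    have h2 : R - c * (s * G) ≤ Real.sqrt (gap (yb + s • gy x yb)) := by
      have : c * ‖yb + s • gy x yb - y‖ ≤ c * (‖yb - y‖ + s * G) := by gcongr
      simp only [hJ] at h1
      linarith
    have h3 : (R - c * (s * G)) ^ 2 ≤ gap (yb + s • gy x yb) := by
      rw [← Real.sq_sqrt (hgap0 (yb + s • gy x yb))]
      exact pow_le_pow_left₀ (by linarith) h2 2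
    have h4 := (abs_le.1 (h.abs_taylor_right x yb (s • gy x yb))).1
    rw [inner_smul_right, real_inner_self_eq_norm_sq, norm_smul, Real.norm_of_nonneg hs0.le,
      ← hG] at h4
    have h5 : gap (yb + s • gy x yb) ≤ R ^ 2 - s * G ^ 2 + l * (s * G) ^ 2 / 2 := by
      rw [hR2]; simp only [hgap]; linarith
    -- Compare `h3` with `h5`, cancel R² and drop the square (csG)².
    have h6 : s * G ^ 2 - l * (s * G) ^ 2 / 2 ≤ 2 * c * R * (s * G) := by
      nlinarith [sq_nonneg (c * (s * G))]
    have h7 : (s * G) * (G * (3 / 4)) ≤ (s * G) * (2 * c * R) := by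
      have : l * (s * G) ^ 2 / 2 = (s * l) * (s * G ^ 2) / 2 := by ring
      nlinarith [mul_le_mul_of_nonneg_right hs1 (show 0 ≤ s * G ^ 2 by positivity)]
    have h8 : G * (3 / 4) ≤ 2 * c * R := le_of_mul_le_mul_left h7 (by positivity)
    have h9 : (G * (3 / 4)) ^ 2 ≤ (2 * c * R) ^ 2 := pow_le_pow_left₀ (by positivity) h8 2
    have h10 : (2 * c * R) ^ 2 = μ * R ^ 2 := by rw [← hc2]; ring
    have h11 : 0 < μ * R ^ 2 := by positivity
    -- Contradiction: `h9` gives (9/16)G² ≤ μR², while PL gives G² ≥ 2μR².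
    nlinarith
  refine ⟨yb, fun y' => ?_, ?_⟩
  · have := hy₀ y'
    simp only [hgap] at hzero
    linarith
  -- Comparing the minimal value with the value at y itself gives c‖yb - y‖ ≤ √gap(y), and PL bounds
  -- the gap by the gradient.
  · have h1 := hyb y
    simp only [hJ, hzero, Real.sqrt_zero, zero_add, sub_self, norm_zero, mul_zero, add_zero] at h1
    have h2 : (c * ‖yb - y‖) ^ 2 ≤ gap y := by
      rw [← Real.sq_sqrt (hgap0 y)]
      exact pow_le_pow_left₀ (by positivity) h1 2
    have h3 := hpl y
    have h4 : (μ * ‖yb - y‖) ^ 2 ≤ (2 * ‖gy x y‖) ^ 2 := by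
      have : (μ * ‖yb - y‖) ^ 2 = 4 * μ * (c * ‖yb - y‖) ^ 2 := by
        rw [mul_pow, mul_pow, ← hc2]; ring
      rw [this]
      have : 4 * μ * (c * ‖yb - y‖) ^ 2 ≤ 4 * μ * gap y := by gcongr
      simp only [hgap] at this
      nlinarith [sq_nonneg ‖gy x y‖]
    exact le_of_sq_le_sq h4 (by positivity)

/-- Danskin's theorem under the PL condition. -/
theorem hasGradientAt_max [CompleteSpace X] [FiniteDimensional ℝ Y] (h : SmoothPair f gx gy l)
    (hl : 0 < l) {μ : ℝ} (hμ : 0 < μ) {φ : X → ℝ} (hle : ∀ x y, f x y ≤ φ x)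
    (hex : ∀ x, ∃ y, f x y = φ x) (hpl : ∀ x y, 2 * μ * (φ x - f x y) ≤ ‖gy x y‖ ^ 2)
    {x : X} {y : Y} (hy : f x y = φ x) : HasGradientAt φ (gx x y) x := by
  rw [hasGradientAt_iff_hasFDerivAt, hasFDerivAt_iff_isLittleO]
  have hgy : gy x y = 0 := h.gy_eq_zero_of_isMax hl fun y' => by rw [hy]; exact hle x y'
  set C := l * (1 + (2 * l / μ) ^ 2) with hC
  -- The lower estimate keeps y fixed. The upper one moves to a maximizer for x' near y: the error
  -- bound makes its displacement O(‖x' - x‖), and the linear term in y vanishes because ∇_y f(x,y)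
  -- = 0.
  have hquad : ∀ x', |φ x' - φ x - inner ℝ (gx x y) (x' - x)| ≤ C * ‖x' - x‖ ^ 2 := by
    intro x'
    rw [abs_le]
    constructor
    · have h1 := (abs_le.1 (h.abs_taylor_left x (x' - x) y)).1
      rw [add_sub_cancel] at h1
      have h2 := hle x' y
      have h3 : l * ‖x' - x‖ ^ 2 / 2 ≤ C * ‖x' - x‖ ^ 2 := by
        rw [hC]
        have : 0 ≤ l * ‖x' - x‖ ^ 2 := by positivity
        have : 0 ≤ l * (2 * l / μ) ^ 2 * ‖x' - x‖ ^ 2 := by positivity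
        nlinarith
      linarith
    · obtain ⟨y₀, hy₀⟩ := hex x'
      obtain ⟨yb, hyb, hd⟩ := h.exists_isMax_near hl hμ (x := x') (y₀ := y₀)
        (fun y' => by rw [hy₀]; exact hle x' y') (fun y' => by rw [hy₀]; exact hpl x' y') y
      have hyb' : f x' yb = φ x' := le_antisymm (hle _ _) (by rw [← hy₀]; exact hyb y₀)
      have h1 := (abs_le.1 (h.abs_taylor_joint hl.le x (x' - x) y (yb - y))).2
      rw [add_sub_cancel, add_sub_cancel, hgy, inner_zero_left, hyb', hy] at h1
      have h2 := h.norm_gy_sub_le x' x y y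
      rw [hgy, sub_zero, sub_self, norm_zero, add_zero] at h2
      have h3 : ‖yb - y‖ ≤ 2 * l / μ * ‖x' - x‖ := by
        rw [div_mul_eq_mul_div, le_div_iff₀ hμ]
        nlinarith
      have h4 : ‖yb - y‖ ^ 2 ≤ (2 * l / μ) ^ 2 * ‖x' - x‖ ^ 2 := by
        rw [← mul_pow]; exact pow_le_pow_left₀ (norm_nonneg _) h3 2
      rw [hC]
      nlinarith
  have hO : (fun x' => φ x' - φ x - (InnerProductSpace.toDual ℝ X) (gx x y) (x' - x))
      =O[nhds x] fun x' => ‖x' - x‖ ^ 2 := by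
    refine Asymptotics.IsBigO.of_bound C (Filter.Eventually.of_forall fun x' => ?_)
    simpa [InnerProductSpace.toDual_apply_apply] using hquad x'
  refine hO.trans_isLittleO ?_
  exact (Asymptotics.isLittleO_pow_sub_sub x one_lt_two).congr_left (fun _ => rfl)

end SmoothPair

end Smooth

/-! ### The regularized saddle function and its Lyapunov function -/

section Saddle

variable {X Y : Type*} [NormedAddCommGroup X] [InnerProductSpace ℝ X]
  [NormedAddCommGroup Y] [InnerProductSpace ℝ Y]

/-- The regularized function `f (x, y) + l ‖x - xt‖²`. -/
def regFun (f : X → Y → ℝ) (l : ℝ) (xt : X) (x : X) (y : Y) : ℝ := f x y + l * ‖x - xt‖ ^ 2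

/-- The partial gradient in `x` of the regularized function. -/
def regGx (gx : X → Y → X) (l : ℝ) (xt : X) (x : X) (y : Y) : X := gx x y + (2 * l) • (x - xt)

namespace SmoothPair

variable {f : X → Y → ℝ} {gx : X → Y → X} {gy : X → Y → Y} {l : ℝ}

theorem regFun_expand (xt x dx : X) : l * ‖x + dx - xt‖ ^ 2
    = l * ‖x - xt‖ ^ 2 + inner ℝ ((2 * l) • (x - xt)) dx + l * ‖dx‖ ^ 2 := by
  have : x + dx - xt = (x - xt) + dx := by abel
  rw [this, norm_add_sq_real, real_inner_smul_left]
  ring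

theorem regFun_le (h : SmoothPair f gx gy l) (hl : 0 ≤ l) (xt x dx : X) (y dy : Y) :
    regFun f l xt (x + dx) (y + dy) ≤ regFun f l xt x y
      + (inner ℝ (regGx gx l xt x y) dx + inner ℝ (gy x y) dy)
      + (2 * l * ‖dx‖ ^ 2 + l * ‖dy‖ ^ 2) := by
  have := (abs_le.1 (h.abs_taylor_joint hl x dx y dy)).2
  have h2 := regFun_expand (l := l) xt x dx
  simp only [regFun, regGx, inner_add_left]
  linarith

/-- l-strong convexity in x: the regularizer contributes l‖dx‖², and the nonconvexity of f takes
away at most half of it. -/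
theorem le_regFun (h : SmoothPair f gx gy l) (xt x dx : X) (y : Y) :
    regFun f l xt x y + inner ℝ (regGx gx l xt x y) dx + l / 2 * ‖dx‖ ^ 2
      ≤ regFun f l xt (x + dx) y := by
  have := (abs_le.1 (h.abs_taylor_left x dx y)).1
  have h2 := regFun_expand (l := l) xt x dx
  simp only [regFun, regGx, inner_add_left]
  linarith

theorem exists_regFun_min [FiniteDimensional ℝ X] (h : SmoothPair f gx gy l) (hl : 0 < l)
    (xt : X) (y : Y) : ∃ xs, ∀ x, regFun f l xt xs y ≤ regFun f l xt x y := by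
  have hc : Continuous fun x : X => regFun f l xt x y := by
    have h1 : Continuous fun x : X => f x y :=
      h.continuous_uncurry.comp (f := fun x : X => (x, y)) (by fun_prop)
    exact h1.add (by fun_prop)
  refine hc.exists_forall_le ?_
  set G := ‖regGx gx l xt 0 y‖
  -- Strong convexity at 0 and Young's inequality give a quadratic minorant, hence coercivity.
  have hlow : ∀ x : X, regFun f l xt 0 y - G ^ 2 / l + l / 4 * ‖x‖ ^ 2 ≤ regFun f l xt x y := by
    intro x
    have h1 := h.le_regFun xt 0 x y
    rw [zero_add] at h1
    have h2 := neg_le_of_abs_le (abs_real_inner_le_norm (regGx gx l xt 0 y) x)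
    have h3 : G * ‖x‖ ≤ G ^ 2 / l + l / 4 * ‖x‖ ^ 2 := by
      have : G ^ 2 / l + l / 4 * ‖x‖ ^ 2 - G * ‖x‖ = (G - l / 2 * ‖x‖) ^ 2 / l := by
        field_simp; ring
      have : 0 ≤ (G - l / 2 * ‖x‖) ^ 2 / l := by positivity
      linarith
    linarith
  refine Filter.tendsto_atTop_mono hlow (Filter.tendsto_atTop_add_const_left _ _ ?_)
  have h1 : ProperSpace X := FiniteDimensional.proper_real X
  have := (tendsto_norm_cocompact_atTop (E := X))
  exact Filter.Tendsto.const_mul_atTop (by positivity)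
    ((Filter.tendsto_pow_atTop two_ne_zero).comp this)

end SmoothPair

/-- The data of the regularized problem `min_x max_y f (x, y) + l ‖x - xt‖²`: `φ` is the primal
function `max_y f`, `H` is the infimum of the regularized primal function and `xs y` minimizes the
regularized function in `x`. -/
structure RegSaddle (f : X → Y → ℝ) (gx : X → Y → X) (gy : X → Y → Y) (φ : X → ℝ) (l μ : ℝ)
    (xt : X) (H : ℝ) (xs : Y → X) : Prop where
  smooth : SmoothPair f gx gy l
  μ_pos : 0 < μ
  μ_le : μ ≤ l
  le_max : ∀ x y, f x y ≤ φ x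
  exists_max : ∀ x, ∃ y, f x y = φ x
  pl : ∀ x y, 2 * μ * (φ x - f x y) ≤ ‖gy x y‖ ^ 2
  isGLB : IsGLB (Set.range fun x => φ x + l * ‖x - xt‖ ^ 2) H
  xs_min : ∀ x y, regFun f l xt (xs y) y ≤ regFun f l xt x y

/-- The Lyapunov function `H + g (x, y) - 2 min_x g (x, y)`. -/
def saddleLyap (f : X → Y → ℝ) (l : ℝ) (xt : X) (H : ℝ) (xs : Y → X) (x : X) (y : Y) : ℝ :=
  H + regFun f l xt x y - 2 * regFun f l xt (xs y) y

namespace RegSaddle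

variable {f : X → Y → ℝ} {gx : X → Y → X} {gy : X → Y → Y} {φ : X → ℝ} {l μ : ℝ} {xt : X} {H : ℝ}
  {xs : Y → X}

theorem l_pos (h : RegSaddle f gx gy φ l μ xt H xs) : 0 < l := h.μ_pos.trans_le h.μ_le

/-- A gradient step of length 1/(4l) gains ‖∇ₓ g‖²/(8l) and cannot fall below the minimum in x. -/
theorem norm_regGx_sq_le (h : RegSaddle f gx gy φ l μ xt H xs) (x : X) (y : Y) :
    ‖regGx gx l xt x y‖ ^ 2 ≤ 8 * l * (regFun f l xt x y - regFun f l xt (xs y) y) := by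
  have hl := h.l_pos
  have h1 := h.smooth.regFun_le hl.le xt x (-(1 / (4 * l)) • regGx gx l xt x y) y 0
  have h2 := h.xs_min (x + -(1 / (4 * l)) • regGx gx l xt x y) y
  rw [inner_smul_right, real_inner_self_eq_norm_sq, norm_smul, mul_pow, Real.norm_eq_abs, sq_abs,
    inner_zero_right, norm_zero, add_zero] at h1
  have e : -(1 / (4 * l)) * ‖regGx gx l xt x y‖ ^ 2
      + 2 * l * ((-(1 / (4 * l))) ^ 2 * ‖regGx gx l xt x y‖ ^ 2)
      = - (‖regGx gx l xt x y‖ ^ 2 / (8 * l)) := by field_simp; ring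
  have h3 : ‖regGx gx l xt x y‖ ^ 2 / (8 * l) ≤ regFun f l xt x y - regFun f l xt (xs y) y := by
    linarith
  rw [div_le_iff₀ (by positivity)] at h3
  linarith

theorem regGx_xs (h : RegSaddle f gx gy φ l μ xt H xs) (y : Y) : regGx gx l xt (xs y) y = 0 := by
  have := h.norm_regGx_sq_le (xs y) y
  rw [sub_self, mul_zero] at this
  exact norm_eq_zero.1 (by nlinarith [norm_nonneg (regGx gx l xt (xs y) y)])

theorem add_sq_le_regFun (h : RegSaddle f gx gy φ l μ xt H xs) (x : X) (y : Y) :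
    regFun f l xt (xs y) y + l / 2 * ‖x - xs y‖ ^ 2 ≤ regFun f l xt x y := by
  have := h.smooth.le_regFun xt (xs y) (x - xs y) y
  rwa [h.regGx_xs, inner_zero_left, add_zero, add_sub_cancel] at this

/-- Strong convexity written from the minimizer and from x; adding the two inequalities leaves l‖x -
xs y‖² ≤ ‖∇ₓ g‖‖x - xs y‖. -/
theorem mul_norm_sub_xs_le (h : RegSaddle f gx gy φ l μ xt H xs) (x : X) (y : Y) :
    l * ‖x - xs y‖ ≤ ‖regGx gx l xt x y‖ := by
  have h1 := h.add_sq_le_regFun x y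
  have h2 := h.smooth.le_regFun xt x (xs y - x) y
  rw [add_sub_cancel, norm_sub_rev] at h2
  have h3 := neg_le_of_abs_le (abs_real_inner_le_norm (regGx gx l xt x y) (xs y - x))
  rw [norm_sub_rev] at h3
  by_cases h0 : ‖x - xs y‖ = 0
  · rw [h0, mul_zero]; exact norm_nonneg _
  · have hp : 0 < ‖x - xs y‖ := lt_of_le_of_ne (norm_nonneg _) (Ne.symm h0)
    refine le_of_mul_le_mul_right (a := ‖x - xs y‖) ?_ hp
    nlinarith

/-- The PL inequality of a strongly convex function: minimize its quadratic minorant at x. -/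
theorem regFun_sub_xs_le (h : RegSaddle f gx gy φ l μ xt H xs) (x : X) (y : Y) :
    2 * l * (regFun f l xt x y - regFun f l xt (xs y) y) ≤ ‖regGx gx l xt x y‖ ^ 2 := by
  have hl := h.l_pos
  have h2 := h.smooth.le_regFun xt x (xs y - x) y
  rw [add_sub_cancel] at h2
  have h3 := neg_le_of_abs_le (abs_real_inner_le_norm (regGx gx l xt x y) (xs y - x))
  nlinarith [sq_nonneg (‖regGx gx l xt x y‖ - l * ‖xs y - x‖)]

/-- At xs y' the gradient for y differs from zero only by the change of ∇ₓ f in y, at most l‖y' -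
y‖; the regularizer cancels. Strong convexity with the same constant l gives Lipschitz constant 1.
-/
theorem norm_xs_sub_le (h : RegSaddle f gx gy φ l μ xt H xs) (y y' : Y) :
    ‖xs y' - xs y‖ ≤ ‖y' - y‖ := by
  have h1 := h.mul_norm_sub_xs_le (xs y') y
  have h2 : regGx gx l xt (xs y') y = gx (xs y') y - gx (xs y') y' := by
    have := h.regGx_xs y'
    rw [← sub_zero (regGx gx l xt (xs y') y), ← this]
    simp [regGx]
  have h3 := h.smooth.norm_gx_sub_le (xs y') (xs y') y y'
  rw [sub_self, norm_zero, zero_add, norm_sub_rev y y'] at h3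
  rw [h2] at h1
  exact le_of_mul_le_mul_left (h1.trans h3) h.l_pos

theorem continuous_xs (h : RegSaddle f gx gy φ l μ xt H xs) : Continuous xs :=
  (LipschitzWith.of_dist_le_mul (K := 1) fun y' y => by
    rw [dist_eq_norm, dist_eq_norm, NNReal.coe_one, one_mul]
    exact h.norm_xs_sub_le y y').continuous

/-- Weak duality: min_x g(x,y) never exceeds the infimum over x of the maximum over y. -/
theorem le_H (h : RegSaddle f gx gy φ l μ xt H xs) (y : Y) : regFun f l xt (xs y) y ≤ H := by
  refine h.isGLB.2 ?_
  rintro _ ⟨x, rfl⟩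
  have h1 := h.xs_min x y
  have h2 := h.le_max x y
  have h3 : regFun f l xt x y = f x y + l * ‖x - xt‖ ^ 2 := rfl
  change _ ≤ φ x + l * ‖x - xt‖ ^ 2
  linarith

theorem H_le (h : RegSaddle f gx gy φ l μ xt H xs) (x : X) : H ≤ φ x + l * ‖x - xt‖ ^ 2 :=
  h.isGLB.1 ⟨x, rfl⟩

/-- Descent-type lower bound for `min_x g (x, y)`. -/
theorem le_regFun_xs (h : RegSaddle f gx gy φ l μ xt H xs) (y dy : Y) :
    regFun f l xt (xs y) y + inner ℝ (gy (xs y) y) dy - l * ‖dy‖ ^ 2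
      ≤ regFun f l xt (xs (y + dy)) (y + dy) := by
  have hl := h.l_pos
  -- Ψ is never differentiated. The change of ∇_y f between xs y and the new minimizer produces a
  -- cross term l‖x - xs y‖‖dy‖, which the strong convexity gain (l/2)‖x - xs y‖² absorbs.
  set x := xs (y + dy) with hx
  have h1 := h.add_sq_le_regFun x y
  have h2 := (abs_le.1 (h.smooth.abs_taylor_right x y dy)).1
  have h3 := h.smooth.norm_gy_sub_le x (xs y) y y
  rw [sub_self, norm_zero, add_zero] at h3
  have h4 := neg_le_of_abs_le (abs_real_inner_le_norm (gy x y - gy (xs y) y) dy)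
  rw [inner_sub_left] at h4
  have h5 : ‖gy x y - gy (xs y) y‖ * ‖dy‖ ≤ l * ‖x - xs y‖ * ‖dy‖ := by gcongr
  have h6 : regFun f l xt x (y + dy) - regFun f l xt x y = f x (y + dy) - f x y := by
    simp [regFun]
  nlinarith [mul_nonneg hl.le (sq_nonneg (‖x - xs y‖ - ‖dy‖))]

/-- An ascent step of length 1/(2l) for y ↦ min_x g(x,y) cannot pass its upper bound H. -/
theorem norm_gy_xs_sq_le (h : RegSaddle f gx gy φ l μ xt H xs) (y : Y) :
    ‖gy (xs y) y‖ ^ 2 ≤ 4 * l * (H - regFun f l xt (xs y) y) := by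
  have hl := h.l_pos
  have h1 := h.le_regFun_xs y ((1 / (2 * l)) • gy (xs y) y)
  have h2 := h.le_H (y + (1 / (2 * l)) • gy (xs y) y)
  rw [inner_smul_right, real_inner_self_eq_norm_sq, norm_smul, mul_pow, Real.norm_eq_abs,
    sq_abs] at h1
  have e : 1 / (2 * l) * ‖gy (xs y) y‖ ^ 2 - l * ((1 / (2 * l)) ^ 2 * ‖gy (xs y) y‖ ^ 2)
      = ‖gy (xs y) y‖ ^ 2 / (4 * l) := by field_simp; ring
  have h3 : ‖gy (xs y) y‖ ^ 2 / (4 * l) ≤ H - regFun f l xt (xs y) y := by linarith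
  rw [div_le_iff₀ (by positivity)] at h3
  linarith

/-- PL passes to y ↦ min_x g(x,y) without loss: H is at most the regularized primal value at xs y,
so the dual gap is at most Φ - f at (xs y, y), where PL of f applies. -/
theorem le_norm_gy_xs_sq (h : RegSaddle f gx gy φ l μ xt H xs) (y : Y) :
    2 * μ * (H - regFun f l xt (xs y) y) ≤ ‖gy (xs y) y‖ ^ 2 := by
  refine le_trans ?_ (h.pl (xs y) y)
  have h1 := h.H_le (xs y)
  have := h.μ_pos
  have h2 : H - regFun f l xt (xs y) y ≤ φ (xs y) - f (xs y) y := by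
    simp only [regFun]; linarith
  gcongr

theorem norm_gy_sub_xs_le (h : RegSaddle f gx gy φ l μ xt H xs) (x : X) (y : Y) :
    ‖gy x y - gy (xs y) y‖ ≤ ‖regGx gx l xt x y‖ := by
  have h3 := h.smooth.norm_gy_sub_le x (xs y) y y
  rw [sub_self, norm_zero, add_zero] at h3
  exact h3.trans (h.mul_norm_sub_xs_le x y)

theorem saddleLyap_nonneg (h : RegSaddle f gx gy φ l μ xt H xs) (x : X) (y : Y) :
    0 ≤ saddleLyap f l xt H xs x y := by
  have h1 := h.le_H y
  have h2 := h.xs_min x y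
  simp only [saddleLyap]
  linarith

/-- The upper model of g (joint smoothness) minus twice the lower model of min_x g. The vector
paired with the step acts as the gradient of the Lyapunov function, by the envelope principle. -/
theorem saddleLyap_descent (h : RegSaddle f gx gy φ l μ xt H xs) (x dx : X) (y dy : Y) :
    saddleLyap f l xt H xs (x + dx) (y + dy) ≤ saddleLyap f l xt H xs x y
      + (inner ℝ (regGx gx l xt x y) dx + inner ℝ (gy x y - (2 : ℝ) • gy (xs y) y) dy)
      + 3 * l * (‖dx‖ ^ 2 + ‖dy‖ ^ 2) := by
  have hl := h.l_pos
  have h1 := h.smooth.regFun_le hl.le xt x dx y dy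
  have h2 := h.le_regFun_xs y dy
  rw [inner_sub_left, real_inner_smul_left]
  simp only [saddleLyap]
  nlinarith [mul_nonneg hl.le (sq_nonneg ‖dx‖)]

/-- Sum of two PL inequalities: constant l for g - min_x g, weakened to μ, and constant μ for H -
min_x g. -/
theorem two_mul_saddleLyap_le (h : RegSaddle f gx gy φ l μ xt H xs) (x : X) (y : Y) :
    2 * μ * saddleLyap f l xt H xs x y
      ≤ ‖regGx gx l xt x y‖ ^ 2 + ‖gy (xs y) y‖ ^ 2 := by
  have h1 := h.regFun_sub_xs_le x y
  have h2 := h.le_norm_gy_xs_sq y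
  have h3 := mul_le_mul_of_nonneg_right h.μ_le (sub_nonneg.2 (h.xs_min x y))
  simp only [saddleLyap]
  linarith

/-- With a = ∇ₓ g, u = ∇_y f(x,y), v = ∇_y f(xs y, y), the left side is -2‖a‖² + ‖u - v‖² - ‖v‖²,
and ‖u - v‖ ≤ ‖a‖. This is the reason for the factor 2 in the x-direction. -/
theorem inner_field_le (h : RegSaddle f gx gy φ l μ xt H xs) (x : X) (y : Y) :
    inner ℝ (regGx gx l xt x y) (-(2 : ℝ) • regGx gx l xt x y)
      + inner ℝ (gy x y - (2 : ℝ) • gy (xs y) y) (gy x y)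
      ≤ -(‖regGx gx l xt x y‖ ^ 2 + ‖gy (xs y) y‖ ^ 2) := by
  have h1 := pow_le_pow_left₀ (norm_nonneg _) (h.norm_gy_sub_xs_le x y) 2
  rw [norm_sub_sq_real] at h1
  rw [inner_smul_right, real_inner_self_eq_norm_sq, inner_sub_left, real_inner_self_eq_norm_sq,
    real_inner_smul_left, real_inner_comm (gy x y)]
  rw [real_inner_comm (gy (xs y) y)] at h1 ⊢
  linarith

theorem norm_gy_sq_le (h : RegSaddle f gx gy φ l μ xt H xs) (x : X) (y : Y) :
    ‖gy x y‖ ^ 2 ≤ 2 * ‖regGx gx l xt x y‖ ^ 2 + 2 * ‖gy (xs y) y‖ ^ 2 := by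
  have h1 := h.norm_gy_sub_xs_le x y
  have h2 : ‖gy x y‖ ≤ ‖gy x y - gy (xs y) y‖ + ‖gy (xs y) y‖ := by
    simpa using norm_add_le (gy x y - gy (xs y) y) (gy (xs y) y)
  have h3 : ‖gy x y‖ ^ 2 ≤ (‖regGx gx l xt x y‖ + ‖gy (xs y) y‖) ^ 2 :=
    pow_le_pow_left₀ (norm_nonneg _) (by linarith) 2
  nlinarith [sq_nonneg (‖regGx gx l xt x y‖ - ‖gy (xs y) y‖)]

theorem norm_lyapGrad_sq_le (h : RegSaddle f gx gy φ l μ xt H xs) (x : X) (y : Y) :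
    ‖regGx gx l xt x y‖ ^ 2 + ‖gy x y - (2 : ℝ) • gy (xs y) y‖ ^ 2
      ≤ 3 * (‖regGx gx l xt x y‖ ^ 2 + ‖gy (xs y) y‖ ^ 2) := by
  have h1 := h.norm_gy_sub_xs_le x y
  have h2 : ‖gy x y - (2 : ℝ) • gy (xs y) y‖ ≤ ‖gy x y - gy (xs y) y‖ + ‖gy (xs y) y‖ := by
    have : gy x y - (2 : ℝ) • gy (xs y) y = gy x y - gy (xs y) y - gy (xs y) y := by
      rw [two_smul]; abel
    rw [this]
    exact norm_sub_le _ _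
  have h3 : ‖gy x y - (2 : ℝ) • gy (xs y) y‖ ^ 2 ≤ (‖regGx gx l xt x y‖ + ‖gy (xs y) y‖) ^ 2 :=
    pow_le_pow_left₀ (norm_nonneg _) (by linarith) 2
  nlinarith [sq_nonneg (‖regGx gx l xt x y‖ - ‖gy (xs y) y‖), sq_nonneg ‖gy (xs y) y‖]

/-- The primal gap splits into Φ - f, bounded by PL, and g - H, bounded through weak duality. -/
theorem max_sub_H_le (h : RegSaddle f gx gy φ l μ xt H xs) (x : X) (y : Y) :
    φ x + l * ‖x - xt‖ ^ 2 - H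
      ≤ ‖gy x y‖ ^ 2 / (2 * μ) + (regFun f l xt x y - regFun f l xt (xs y) y) := by
  have h1 := h.pl x y
  have h2 := h.le_H y
  have hμ := h.μ_pos
  have h3 : φ x - f x y ≤ ‖gy x y‖ ^ 2 / (2 * μ) := by
    rw [le_div_iff₀ (by positivity)]; linarith
  have h4 : regFun f l xt x y = f x y + l * ‖x - xt‖ ^ 2 := rfl
  linarith

/-- The Lyapunov function at a nearly stationary point. -/
theorem saddleLyap_start_le (h : RegSaddle f gx gy φ l μ xt H xs) {ε : ℝ} (hε : 0 < ε) {yt : Y}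
    (h1 : ‖gx xt yt‖ ≤ ε) (h2 : ‖gy xt yt‖ ≤ ε / Real.sqrt (l / μ)) :
    saddleLyap f l xt H xs xt yt ≤ 3 / 2 * (ε ^ 2 / l) ∧ φ xt - H ≤ ε ^ 2 / l := by
  have hl := h.l_pos
  have hμ := h.μ_pos
  have e1 : regGx gx l xt xt yt = gx xt yt := by simp [regGx]
  have h3 := h.regFun_sub_xs_le xt yt
  rw [e1] at h3
  have h4 : ‖gx xt yt‖ ^ 2 ≤ ε ^ 2 := pow_le_pow_left₀ (norm_nonneg _) h1 2
  -- The accuracy ε/√κ in y is exactly what turns the PL bound 1/(2μ) into ε²/(2l), the same size as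
  -- the x-contribution.
  have h5 : ‖gy xt yt‖ ^ 2 / (2 * μ) ≤ ε ^ 2 / (2 * l) := by
    have h6 : ‖gy xt yt‖ ^ 2 ≤ ε ^ 2 * μ / l := by
      refine (pow_le_pow_left₀ (norm_nonneg _) h2 2).trans_eq ?_
      rw [div_pow, Real.sq_sqrt (by positivity)]
      field_simp
    rw [div_le_div_iff₀ (by positivity) (by positivity)]
    rw [le_div_iff₀ hl] at h6
    linarith
  have h7 : regFun f l xt xt yt - regFun f l xt (xs yt) yt ≤ ε ^ 2 / (2 * l) := by
    rw [le_div_iff₀ (by positivity)]; linarith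
  have h8 := h.max_sub_H_le xt yt
  simp only [sub_self, norm_zero, ne_eq, OfNat.ofNat_ne_zero, not_false_eq_true, zero_pow,
    mul_zero, add_zero] at h8
  have h9 : ε ^ 2 / (2 * l) = ε ^ 2 / l / 2 := by field_simp
  have h10 := h.H_le xt
  have h11 := h.le_max xt yt
  have h12 : regFun f l xt xt yt = f xt yt := by simp [regFun]
  have h13 : φ xt - f xt yt ≤ ‖gy xt yt‖ ^ 2 / (2 * μ) := by
    have := h.pl xt yt
    rw [le_div_iff₀ (by positivity)]; linarith
  simp only [sub_self, norm_zero, ne_eq, OfNat.ofNat_ne_zero, not_false_eq_true, zero_pow,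
    mul_zero, add_zero] at h10
  rw [h9] at h5 h7
  constructor
  · simp only [saddleLyap]
    linarith
  · linarith

/-- The regularized primal function is `l`-strongly convex. -/
theorem mul_norm_sub_sq_le (h : RegSaddle f gx gy φ l μ xt H xs) (x : X) :
    l / 4 * ‖x - xt‖ ^ 2 ≤ (φ x + l * ‖x - xt‖ ^ 2 - H) + (φ xt - H) := by
  -- Midpoint argument: for y maximizing at the midpoint, g(·, y) is strongly convex, equals the
  -- regularized primal function there and lies below it at both ends.
  set d : X := (1 / 2 : ℝ) • (x - xt) with hd
  obtain ⟨y, hy⟩ := h.exists_max (xt + d)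
  have h1 := h.smooth.le_regFun xt (xt + d) d y
  have h2 := h.smooth.le_regFun xt (xt + d) (-d) y
  have e1 : xt + d + d = x := by
    rw [hd, add_assoc, ← add_smul]; norm_num
  have e2 : xt + d + -d = xt := by abel
  have e3 : ‖d‖ ^ 2 = ‖x - xt‖ ^ 2 / 4 := by
    rw [hd, norm_smul, mul_pow]; norm_num; ring
  rw [e1, e3] at h1
  rw [e2, norm_neg, inner_neg_right, e3] at h2
  have h3 := h.H_le (xt + d)
  have h4 : regFun f l xt (xt + d) y = φ (xt + d) + l * ‖xt + d - xt‖ ^ 2 := by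
    rw [regFun, hy]
  have h5 := h.le_max x y
  have h6 := h.le_max xt y
  have h7 : regFun f l xt x y = f x y + l * ‖x - xt‖ ^ 2 := rfl
  have h8 : regFun f l xt xt y = f xt y := by simp [regFun]
  linarith

/-- The gradient of the primal function is controlled by the Lyapunov function. -/
theorem norm_gradient_max_le [CompleteSpace X] [FiniteDimensional ℝ Y]
    (h : RegSaddle f gx gy φ l μ xt H xs) {ε : ℝ} (hε : 0 < ε) {yt : Y}
    (h1 : ‖gx xt yt‖ ≤ ε) (h2 : ‖gy xt yt‖ ≤ ε / Real.sqrt (l / μ)) (x : X) (y : Y) :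
    ‖gradient φ x‖
      ≤ 10 * ε + 108 * ((l / μ) ^ 2 * l / ε) * saddleLyap f l xt H xs x y := by
  have hl := h.l_pos
  have hμ := h.μ_pos
  set V := saddleLyap f l xt H xs x y with hV
  have hV0 : 0 ≤ V := h.saddleLyap_nonneg x y
  set κ := l / μ with hκ
  have hκ1 : 1 ≤ κ := (one_le_div hμ).2 h.μ_le
  have hP : regFun f l xt x y - regFun f l xt (xs y) y ≤ V := by
    have := h.le_H y
    simp only [hV, saddleLyap]; linarith
  have ha : ‖regGx gx l xt x y‖ ^ 2 ≤ 8 * l * V :=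
    (h.norm_regGx_sq_le x y).trans (by gcongr)
  have hu : ‖gy x y‖ ^ 2 ≤ 16 * l * V := by
    have e1 := h.norm_gy_sq_le x y
    have e2 := h.norm_regGx_sq_le x y
    have e3 := h.norm_gy_xs_sq_le y
    have e4 := mul_nonneg hl.le (sub_nonneg.2 (h.le_H y))
    simp only [hV, saddleLyap]
    nlinarith
  obtain ⟨y₀, hy₀⟩ := h.exists_max x
  obtain ⟨yb, hyb, hd⟩ := h.smooth.exists_isMax_near hl hμ (x := x) (y₀ := y₀)
    (fun y' => by rw [hy₀]; exact h.le_max x y') (fun y' => by rw [hy₀]; exact h.pl x y') y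
  have hyb' : f x yb = φ x := le_antisymm (h.le_max _ _) (by rw [← hy₀]; exact hyb y₀)
  rw [(h.smooth.hasGradientAt_max hl hμ h.le_max h.exists_max h.pl hyb').gradient]
  -- This error bound brings in κ; squared, it is the source of the factor κ² in the conclusion.
  have hdist : l * ‖yb - y‖ ≤ 2 * κ * ‖gy x y‖ := by
    have : l * ‖yb - y‖ = κ * (μ * ‖yb - y‖) := by rw [hκ]; field_simp
    rw [this]
    nlinarith
  have hx : (l * ‖x - xt‖) ^ 2 ≤ 4 * ε ^ 2 + 36 * κ * (l * V) := by
    have e1 := h.mul_norm_sub_sq_le x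
    have e2 := h.max_sub_H_le x y
    have e3 := (h.saddleLyap_start_le hε h1 h2).2
    have e4 : ‖gy x y‖ ^ 2 / (2 * μ) ≤ 8 * κ * V := by
      rw [div_le_iff₀ (by positivity)]
      have : 8 * κ * V * (2 * μ) = 16 * l * V := by rw [hκ]; field_simp; ring
      rwa [this]
    have e5 : l / 4 * ‖x - xt‖ ^ 2 ≤ 8 * κ * V + V + ε ^ 2 / l := by linarith
    have e6 : V ≤ κ * V := le_mul_of_one_le_left hV0 hκ1
    have e7 : (l * ‖x - xt‖) ^ 2 = 4 * l * (l / 4 * ‖x - xt‖ ^ 2) := by ring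
    have e8 : 4 * l * (8 * κ * V + V + ε ^ 2 / l) = 32 * κ * (l * V) + 4 * l * V + 4 * ε ^ 2 := by
      field_simp
      ring
    rw [e7]
    have : 4 * l * (l / 4 * ‖x - xt‖ ^ 2) ≤ 4 * l * (8 * κ * V + V + ε ^ 2 / l) := by gcongr
    rw [e8] at this
    nlinarith
  -- ∇Φ(x) = ∇ₓ f(x, yb) is split into the regularized gradient at y, the gradient of the
  -- regularizer, and the change of ∇ₓ f from y to yb.
  have htri : ‖gx x yb‖ ≤ ‖regGx gx l xt x y‖ + 2 * (l * ‖x - xt‖) + 2 * κ * ‖gy x y‖ := by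
    have e1 : gx x yb = regGx gx l xt x y - (2 * l) • (x - xt) + (gx x yb - gx x y) := by
      simp only [regGx]; abel
    have e2 := h.smooth.norm_gx_sub_le x x yb y
    rw [sub_self, norm_zero, zero_add] at e2
    rw [e1]
    refine (norm_add_le _ _).trans (add_le_add ((norm_sub_le _ _).trans (le_of_eq ?_)) ?_)
    · rw [norm_smul, Real.norm_of_nonneg (by positivity)]; ring
    · exact e2.trans hdist
  -- Linearizing at scale ε makes the bound linear in V, so that only the expectation of V is needed
  -- later.
  have amgm : ∀ t : ℝ, t ≤ t ^ 2 / (2 * ε) + ε / 2 := fun t => by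
    have : t ^ 2 / (2 * ε) + ε / 2 - t = (t - ε) ^ 2 / (2 * ε) := by field_simp; ring
    have : 0 ≤ (t - ε) ^ 2 / (2 * ε) := by positivity
    linarith
  have hW : l * V ≤ κ ^ 2 * (l * V) := le_mul_of_one_le_left (by positivity) (by nlinarith)
  have hW' : κ * (l * V) ≤ κ ^ 2 * (l * V) := by
    have : κ ≤ κ ^ 2 := by nlinarith
    gcongr
  have t1 := amgm ‖regGx gx l xt x y‖
  have t2 := amgm (2 * (l * ‖x - xt‖))
  have t3 := amgm (2 * κ * ‖gy x y‖)
  have b1 : ‖regGx gx l xt x y‖ ^ 2 + (2 * (l * ‖x - xt‖)) ^ 2 + (2 * κ * ‖gy x y‖) ^ 2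
      ≤ 216 * (κ ^ 2 * (l * V)) + 16 * ε ^ 2 := by
    have : (2 * κ * ‖gy x y‖) ^ 2 ≤ 64 * (κ ^ 2 * (l * V)) := by
      have e : (2 * κ * ‖gy x y‖) ^ 2 = 4 * κ ^ 2 * ‖gy x y‖ ^ 2 := by ring
      rw [e]
      have : 4 * κ ^ 2 * ‖gy x y‖ ^ 2 ≤ 4 * κ ^ 2 * (16 * l * V) := by gcongr
      linarith
    nlinarith
  have b2 : (‖regGx gx l xt x y‖ ^ 2 + (2 * (l * ‖x - xt‖)) ^ 2 + (2 * κ * ‖gy x y‖) ^ 2) / (2 * ε)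
      ≤ (216 * (κ ^ 2 * (l * V)) + 16 * ε ^ 2) / (2 * ε) := by gcongr
  have b3 : (216 * (κ ^ 2 * (l * V)) + 16 * ε ^ 2) / (2 * ε)
      = 108 * (κ ^ 2 * l / ε) * V + 8 * ε := by field_simp; ring
  rw [b3, add_div, add_div] at b2
  linarith

end RegSaddle

end Saddle

/-! ### Uniformly random subsets of fixed size -/

section Subsets

open Finset

variable {M m : ℕ}

theorem mul_card_filter_mem_powersetCard (hm : 1 ≤ m) (i : Fin M) :
    M * #{A ∈ (univ : Finset (Fin M)).powersetCard m | i ∈ A} = m * M.choose m := by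
  have h := card_filter_powersetCard_subset {i} (univ : Finset (Fin M)) m (subset_univ _)
    (by simpa using hm)
  simp only [singleton_subset_iff, card_univ, Fintype.card_fin, card_singleton] at h
  rw [h]
  obtain ⟨k, rfl⟩ := Nat.exists_eq_add_of_le' hm
  obtain ⟨N, rfl⟩ : ∃ N, M = N + 1 := ⟨M - 1, by have := i.2; omega⟩
  have := Nat.add_one_mul_choose_eq N k
  simp only [Nat.add_sub_cancel]
  rw [this]; ring

/-- What matters is that the count is the same for all pairs. The case distinction is needed because
m - 2 truncates to 0 for m = 1. -/
theorem card_filter_pair_mem_powersetCard {i j : Fin M} (hij : i ≠ j) :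
    #{A ∈ (univ : Finset (Fin M)).powersetCard m | i ∈ A ∧ j ∈ A}
      = if 2 ≤ m then (M - 2).choose (m - 2) else 0 := by
  split_ifs with h2
  · have h := card_filter_powersetCard_subset {i, j} (univ : Finset (Fin M)) m (subset_univ _)
      (by rwa [card_pair hij])
    simpa only [insert_subset_iff, singleton_subset_iff, card_univ, Fintype.card_fin,
      card_pair hij] using h
  · rw [card_eq_zero, filter_eq_empty_iff]
    rintro A hA ⟨hi, hj⟩
    have h1 : ({i, j} : Finset (Fin M)) ⊆ A := by
      simp [insert_subset_iff, hi, hj]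
    have h3 := card_le_card h1
    rw [card_pair hij, (mem_powersetCard.1 hA).2] at h3
    exact h2 h3

theorem sum_powersetCard_sum {V : Type*} [AddCommMonoid V] (u : Fin M → V) :
    ∑ A ∈ (univ : Finset (Fin M)).powersetCard m, ∑ i ∈ A, u i
      = ∑ i, #{A ∈ (univ : Finset (Fin M)).powersetCard m | i ∈ A} • u i := by
  have : ∀ A : Finset (Fin M), ∑ i ∈ A, u i = ∑ i, if i ∈ A then u i else 0 := fun A => by
    rw [sum_ite_mem, univ_inter]
  simp_rw [this]
  rw [sum_comm]
  refine sum_congr rfl fun i _ => ?_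
  rw [← sum_filter, sum_const]

variable {E : Type*} [NormedAddCommGroup E] [InnerProductSpace ℝ E]

theorem sum_powersetCard_eq_zero (hm : 1 ≤ m) {u : Fin M → E} (hu : ∑ i, u i = 0) :
    ∑ A ∈ (univ : Finset (Fin M)).powersetCard m, ∑ i ∈ A, u i = 0 := by
  rw [sum_powersetCard_sum]
  have : ∀ i : Fin M, (#{A ∈ (univ : Finset (Fin M)).powersetCard m | i ∈ A} : ℕ) • u i
      = ((m * M.choose m : ℝ) / M) • u i := fun i => by
    rw [← Nat.cast_smul_eq_nsmul ℝ]
    congr 1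
    have h := mul_card_filter_mem_powersetCard hm i
    have hM : (M : ℝ) ≠ 0 := by have := i.2; exact_mod_cast (by omega : M ≠ 0)
    rw [eq_div_iff hM, mul_comm]
    exact_mod_cast h
  rw [sum_congr rfl fun i _ => this i, ← smul_sum, hu, smul_zero]

/-- Sampling without replacement is negatively correlated: every pair i ≠ j occurs equally often,
and since the u i sum to zero, the off-diagonal part equals minus that multiplicity times the sum of
the ‖u i‖². Dropping it leaves the bound for independent draws. -/
theorem sum_powersetCard_norm_sq_le (hm : 1 ≤ m) {u : Fin M → E} (hu : ∑ i, u i = 0) {G : ℝ}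
    (hG : ∀ i, ‖u i‖ ^ 2 ≤ G) :
    ∑ A ∈ (univ : Finset (Fin M)).powersetCard m, ‖∑ i ∈ A, u i‖ ^ 2
      ≤ m * M.choose m * G := by
  set N₂ : ℕ := if 2 ≤ m then (M - 2).choose (m - 2) else 0
  have h1 : ∀ A : Finset (Fin M), ‖∑ i ∈ A, u i‖ ^ 2
      = ∑ i, ∑ j, if i ∈ A ∧ j ∈ A then inner ℝ (u i) (u j) else 0 := fun A => by
    have e : ∑ i ∈ A, u i = ∑ i, if i ∈ A then u i else 0 := by rw [sum_ite_mem, univ_inter]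
    rw [← real_inner_self_eq_norm_sq, e, sum_inner]
    refine sum_congr rfl fun i _ => ?_
    rw [inner_sum]
    refine sum_congr rfl fun j _ => ?_
    by_cases hi : i ∈ A <;> by_cases hj : j ∈ A <;> simp [hi, hj]
  have h2 : ∀ i : Fin M, ∑ j,
      ∑ A ∈ (univ : Finset (Fin M)).powersetCard m, (if i ∈ A ∧ j ∈ A then inner ℝ (u i) (u j) else 0)
      = (#{A ∈ (univ : Finset (Fin M)).powersetCard m | i ∈ A} - N₂ : ℝ) * ‖u i‖ ^ 2 := by
    intro i
    have e1 : ∀ j : Fin M, ∑ A ∈ (univ : Finset (Fin M)).powersetCard m,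
        (if i ∈ A ∧ j ∈ A then inner ℝ (u i) (u j) else 0)
        = N₂ * inner ℝ (u i) (u j) + if i = j then
          (#{A ∈ (univ : Finset (Fin M)).powersetCard m | i ∈ A} - N₂ : ℝ) * ‖u i‖ ^ 2 else 0 := by
      intro j
      rw [← sum_filter, sum_const, nsmul_eq_mul]
      split_ifs with hij
      · subst hij
        rw [real_inner_self_eq_norm_sq]
        simp only [and_self]
        ring
      · rw [card_filter_pair_mem_powersetCard hij, add_zero]
    rw [sum_congr rfl fun j _ => e1 j, sum_add_distrib, ← mul_sum, ← inner_sum, hu, inner_zero_right,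
      mul_zero, zero_add, sum_ite_eq, if_pos (mem_univ i)]
  have h3 : ∑ A ∈ (univ : Finset (Fin M)).powersetCard m, ‖∑ i ∈ A, u i‖ ^ 2
      = ∑ i, (#{A ∈ (univ : Finset (Fin M)).powersetCard m | i ∈ A} - N₂ : ℝ) * ‖u i‖ ^ 2 := by
    rw [sum_congr rfl fun A _ => h1 A, sum_comm]
    refine sum_congr rfl fun i _ => ?_
    rw [sum_comm]
    exact h2 i
  rw [h3]
  have h4 : ∀ i ∈ (univ : Finset (Fin M)),
      (#{A ∈ (univ : Finset (Fin M)).powersetCard m | i ∈ A} - N₂ : ℝ) * ‖u i‖ ^ 2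
      ≤ m * M.choose m / M * G := by
    intro i _
    have hM : (0 : ℝ) < M := by have := i.2; exact_mod_cast (by omega : 0 < M)
    have h := mul_card_filter_mem_powersetCard hm i
    have h5 : (#{A ∈ (univ : Finset (Fin M)).powersetCard m | i ∈ A} : ℝ)
        = m * M.choose m / M := by
      rw [eq_div_iff hM.ne', mul_comm]
      exact_mod_cast h
    rw [h5]
    have h6 : (m * M.choose m / M - N₂ : ℝ) * ‖u i‖ ^ 2 ≤ m * M.choose m / M * ‖u i‖ ^ 2 := by
      have : (0 : ℝ) ≤ N₂ := Nat.cast_nonneg _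
      gcongr
      linarith
    refine h6.trans ?_
    have := hG i
    gcongr
  refine (sum_le_sum h4).trans ?_
  rw [sum_const, card_univ, Fintype.card_fin, nsmul_eq_mul]
  rcases Nat.eq_zero_or_pos M with rfl | hM
  · have : Nat.choose 0 m = 0 := Nat.choose_eq_zero_of_lt (by omega)
    simp [this]
  · have : (0 : ℝ) < M := by exact_mod_cast hM
    apply le_of_eq
    field_simp

end Subsets

/-! ### Integrals of functions of two independent variables -/

section Independence

variable {Ω Z W E : Type*} {𝓖 mΩ : MeasurableSpace Ω} {Pr : Measure Ω} [IsProbabilityMeasure Pr]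
  {mZ : MeasurableSpace Z} {mW : MeasurableSpace W}
  [NormedAddCommGroup E] [InnerProductSpace ℝ E] [MeasurableSpace E] [BorelSpace E]
  [SecondCountableTopology E]

theorem map_pair_eq_prod_of_indep (h𝓖 : 𝓖 ≤ mΩ) {ζ : Ω → Z}
    (hζ : Measurable ζ) (hind : Indep 𝓖 (MeasurableSpace.comap ζ mZ) Pr) {w : Ω → W}
    (hw : Measurable[𝓖] w) :
    Pr.map (fun ω => (w ω, ζ ω)) = (Pr.map w).prod (Pr.map ζ) := by
  refine (indepFun_iff_map_prod_eq_prod_map_map (hw.mono h𝓖 le_rfl).aemeasurable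
    hζ.aemeasurable).1 ?_
  rw [IndepFun_iff_Indep]
  exact indep_of_indep_of_le_left hind hw.comap_le

/-- A centred function of an independent variable is orthogonal to everything else. -/
theorem integral_inner_eq_zero_of_indep [CompleteSpace E] (h𝓖 : 𝓖 ≤ mΩ) {ζ : Ω → Z}
    (hζ : Measurable ζ) (hind : Indep 𝓖 (MeasurableSpace.comap ζ mZ) Pr) {N : W → Z → E}
    (hN : Measurable (Function.uncurry N)) (hint : ∀ v, Integrable (N v) (Pr.map ζ))
    (hzero : ∀ v, ∫ z, N v z ∂(Pr.map ζ) = 0) {w : Ω → W} (hw : Measurable[𝓖] w) {a : Ω → E}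
    (ha : Measurable[𝓖] a) :
    ∫ ω, inner ℝ (a ω) (N (w ω) (ζ ω)) ∂Pr = 0 := by
  have hp : Measurable[𝓖] fun ω => (a ω, w ω) := ha.prodMk hw
  have hmap := map_pair_eq_prod_of_indep h𝓖 hζ hind hp
  have hpm : Measurable fun ω => (a ω, w ω) := hp.mono h𝓖 le_rfl
  set ψ : (E × W) × Z → ℝ := fun q => inner ℝ q.1.1 (N q.1.2 q.2) with hψ
  have hψm : Measurable ψ := by
    have h1 : Measurable fun q : (E × W) × Z => N q.1.2 q.2 :=
      hN.comp (measurable_fst.snd.prodMk measurable_snd)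
    exact measurable_fst.fst.inner h1
  have e : ∫ ω, inner ℝ (a ω) (N (w ω) (ζ ω)) ∂Pr
      = ∫ q, ψ q ∂(Pr.map (fun ω => ((a ω, w ω), ζ ω))) := by
    rw [integral_map (hpm.prodMk hζ).aemeasurable hψm.aestronglyMeasurable]
  rw [e, hmap]
  have := Measure.isProbabilityMeasure_map (μ := Pr) hζ.aemeasurable
  have := Measure.isProbabilityMeasure_map (μ := Pr) hpm.aemeasurable
  -- If the product is not integrable, the Bochner integral is 0 by convention; hence no
  -- integrability of `a` is required.
  by_cases hi : Integrable ψ ((Pr.map (fun ω => (a ω, w ω))).prod (Pr.map ζ))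
  · rw [integral_prod _ hi]
    have : ∀ p : E × W, ∫ z, ψ (p, z) ∂(Pr.map ζ) = 0 := fun p => by
      simp only [hψ]
      rw [integral_inner (hint p.2), hzero, inner_zero_right]
    simp [this]
  · exact integral_undef hi

/-- Second moment of a weighted function of an independent variable. -/
theorem memLp_smul_of_indep (h𝓖 : 𝓖 ≤ mΩ) {ζ : Ω → Z}
    (hζ : Measurable ζ) (hind : Indep 𝓖 (MeasurableSpace.comap ζ mZ) Pr) {N : W → Z → E}
    (hN : Measurable (Function.uncurry N)) {τ : ℝ}
    (hint : ∀ v, Integrable (fun z => ‖N v z‖ ^ 2) (Pr.map ζ))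
    (hle : ∀ v, ∫ z, ‖N v z‖ ^ 2 ∂(Pr.map ζ) ≤ τ) {w : Ω → W} (hw : Measurable[𝓖] w) {c : Ω → ℝ}
    (hc : Measurable[𝓖] c) (hc2 : MemLp c 2 Pr) :
    MemLp (fun ω => c ω • N (w ω) (ζ ω)) 2 Pr
      ∧ ∫ ω, ‖c ω • N (w ω) (ζ ω)‖ ^ 2 ∂Pr ≤ τ * ∫ ω, c ω ^ 2 ∂Pr := by
  have hp : Measurable[𝓖] fun ω => (c ω, w ω) := hc.prodMk hw
  have hmap := map_pair_eq_prod_of_indep h𝓖 hζ hind hp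
  have hpm : Measurable fun ω => (c ω, w ω) := hp.mono h𝓖 le_rfl
  have hNm : Measurable fun q : (ℝ × W) × Z => N q.1.2 q.2 :=
    hN.comp (measurable_fst.snd.prodMk measurable_snd)
  set ψ : (ℝ × W) × Z → ℝ := fun q => q.1.1 ^ 2 * ‖N q.1.2 q.2‖ ^ 2 with hψ
  have hψm : Measurable ψ := (measurable_fst.fst.pow_const 2).mul (hNm.norm.pow_const 2)
  have hqm := hpm.prodMk hζ
  have e0 : ∀ ω, ‖c ω • N (w ω) (ζ ω)‖ ^ 2 = ψ ((c ω, w ω), ζ ω) := fun ω => by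
    simp only [hψ, norm_smul, mul_pow, Real.norm_eq_abs, sq_abs]
  have := Measure.isProbabilityMeasure_map (μ := Pr) hζ.aemeasurable
  have := Measure.isProbabilityMeasure_map (μ := Pr) hpm.aemeasurable
  have hsec : ∀ p : ℝ × W, ∫ z, ψ (p, z) ∂(Pr.map ζ)
      = p.1 ^ 2 * ∫ z, ‖N p.2 z‖ ^ 2 ∂(Pr.map ζ) := fun p => by
    simp only [hψ]; rw [integral_const_mul]
  have hsec0 : ∀ p : ℝ × W, 0 ≤ ∫ z, ψ (p, z) ∂(Pr.map ζ) := fun p =>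
    integral_nonneg fun z => by simp only [hψ]; positivity
  have hsecle : ∀ p : ℝ × W, ∫ z, ψ (p, z) ∂(Pr.map ζ) ≤ τ * p.1 ^ 2 := fun p => by
    rw [hsec, mul_comm τ]
    exact mul_le_mul_of_nonneg_left (hle p.2) (sq_nonneg _)
  have hdomΩ : Integrable (fun ω => τ * c ω ^ 2) Pr := hc2.integrable_sq.const_mul τ
  have hdom : Integrable (fun p : ℝ × W => τ * p.1 ^ 2) (Pr.map (fun ω => (c ω, w ω))) := by
    rw [integrable_map_measure (by fun_prop) hpm.aemeasurable]
    exact hdomΩ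
  have hsi : Integrable (fun p => ∫ z, ψ (p, z) ∂(Pr.map ζ)) (Pr.map (fun ω => (c ω, w ω))) := by
    refine hdom.mono' (hψm.stronglyMeasurable.integral_prod_right').aestronglyMeasurable ?_
    refine Filter.Eventually.of_forall fun p => ?_
    rw [Real.norm_of_nonneg (hsec0 p)]
    exact hsecle p
  -- Tonelli: each section is integrable, and the integrals of the sections are dominated by τ c²,
  -- integrable by assumption.
  have hi : Integrable ψ ((Pr.map (fun ω => (c ω, w ω))).prod (Pr.map ζ)) := by
    rw [integrable_prod_iff hψm.aestronglyMeasurable]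
    refine ⟨Filter.Eventually.of_forall fun p => (hint p.2).const_mul (p.1 ^ 2), ?_⟩
    refine hsi.congr (Filter.Eventually.of_forall fun p => ?_)
    refine integral_congr_ae (Filter.Eventually.of_forall fun z => ?_)
    simp only [hψ]
    rw [Real.norm_of_nonneg (by positivity)]
  constructor
  · rw [memLp_two_iff_integrable_sq_norm]
    · simp_rw [e0]
      rw [← hmap, integrable_map_measure hψm.aestronglyMeasurable hqm.aemeasurable] at hi
      exact hi
    · have h1 : Measurable fun ω => N (w ω) (ζ ω) :=
        hNm.comp hqm
      exact ((hc.mono h𝓖 le_rfl).smul h1).aestronglyMeasurable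
  · simp_rw [e0]
    have e : ∫ ω, ψ ((c ω, w ω), ζ ω) ∂Pr = ∫ q, ψ q ∂(Pr.map (fun ω => ((c ω, w ω), ζ ω))) := by
      rw [integral_map hqm.aemeasurable hψm.aestronglyMeasurable]
    rw [e, hmap, integral_prod _ hi]
    refine (integral_mono hsi hdom hsecle).trans ?_
    rw [integral_map hpm.aemeasurable hdom.aestronglyMeasurable, integral_const_mul]

end Independence

theorem integrable_inner_of_memLp {Ω E : Type*} {mΩ : MeasurableSpace Ω} {Pr : Measure Ω}
    [NormedAddCommGroup E] [InnerProductSpace ℝ E] {u v : Ω → E} (hu : MemLp u 2 Pr)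
    (hv : MemLp v 2 Pr) : Integrable (fun ω => (inner ℝ (u ω) (v ω) : ℝ)) Pr :=
  ((hu.integrable_norm_pow (p := 2) two_ne_zero).add
    (hv.integrable_norm_pow (p := 2) two_ne_zero)).mono'
    (hu.aestronglyMeasurable.inner hv.aestronglyMeasurable)
    (Filter.Eventually.of_forall fun ω => by
      have := abs_real_inner_le_norm (u ω) (v ω)
      rw [Real.norm_eq_abs]
      simp only [Pi.add_apply]
      nlinarith [sq_nonneg (‖u ω‖ - ‖v ω‖), sq_nonneg ‖u ω‖, sq_nonneg ‖v ω‖])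

/-- Pairwise orthogonal square-integrable variables. -/
theorem integral_norm_sum_sq {Ω ι E : Type*} {mΩ : MeasurableSpace Ω} {Pr : Measure Ω}
    [NormedAddCommGroup E] [InnerProductSpace ℝ E] (s : Finset ι) {ν : ι → Ω → E}
    (hL : ∀ q ∈ s, MemLp (ν q) 2 Pr)
    (horth : ∀ q ∈ s, ∀ r ∈ s, q ≠ r → ∫ ω, inner ℝ (ν q ω) (ν r ω) ∂Pr = 0) :
    ∫ ω, ‖∑ q ∈ s, ν q ω‖ ^ 2 ∂Pr = ∑ q ∈ s, ∫ ω, ‖ν q ω‖ ^ 2 ∂Pr := by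
  classical
  have hii : ∀ q ∈ s, ∀ r ∈ s, Integrable (fun ω => inner ℝ (ν q ω) (ν r ω)) Pr := fun q hq r hr =>
    integrable_inner_of_memLp (hL q hq) (hL r hr)
  have e : ∀ ω, ‖∑ q ∈ s, ν q ω‖ ^ 2 = ∑ q ∈ s, ∑ r ∈ s, inner ℝ (ν q ω) (ν r ω) := fun ω => by
    rw [← real_inner_self_eq_norm_sq, sum_inner]
    exact Finset.sum_congr rfl fun q _ => inner_sum _ _ _
  simp_rw [e]
  rw [integral_finsetSum _ fun q hq => integrable_finsetSum _ fun r hr => hii q hq r hr]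
  refine Finset.sum_congr rfl fun q hq => ?_
  rw [integral_finsetSum _ fun r hr => hii q hq r hr, Finset.sum_eq_single q]
  · simp_rw [real_inner_self_eq_norm_sq]
  · exact fun r hr hrq => horth q hq r hr hrq.symm
  · exact fun h => absurd hq h

/-! ### The sampling σ-algebras -/

section Sampling

variable {M d₁ d₂ m : ℕ} {Ξ : Type u} [MeasurableSpace Ξ] {Ω : Type v} {mΩ : MeasurableSpace Ω}
  {Pr : Measure Ω} {P : FedProblem M d₁ d₂ Ξ} {S : ℕ → Ω → Finset (Fin M)}
  {ξ : ℕ → Fin M → ℕ → Ω → Ξ}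

/-- The σ-algebras of the individual random choices. -/
abbrev sampleSigma (S : ℕ → Ω → Finset (Fin M)) (ξ : ℕ → Fin M → ℕ → Ω → Ξ) :
    ℕ ⊕ ℕ × Fin M × ℕ → MeasurableSpace Ω :=
  Sum.elim (fun t : ℕ => MeasurableSpace.comap (S t) ⊤)
    (fun q : ℕ × Fin M × ℕ => MeasurableSpace.comap (ξ q.1 q.2.1 q.2.2) inferInstance)

/-- The σ-algebra of a set of random choices. -/
abbrev genSigma (S : ℕ → Ω → Finset (Fin M)) (ξ : ℕ → Fin M → ℕ → Ω → Ξ)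
    (J : Set (ℕ ⊕ ℕ × Fin M × ℕ)) : MeasurableSpace Ω :=
  ⨆ j ∈ J, sampleSigma S ξ j

/-- The round in which a random choice is made. -/
def sampleRound : ℕ ⊕ ℕ × Fin M × ℕ → ℕ := Sum.elim id fun q => q.1

theorem genSigma_mono {J J' : Set (ℕ ⊕ ℕ × Fin M × ℕ)} (h : J ⊆ J') :
    genSigma S ξ J ≤ genSigma S ξ J' :=
  biSup_mono fun _ hj => h hj

theorem measurableSet_mem_genSigma {J : Set (ℕ ⊕ ℕ × Fin M × ℕ)} {t : ℕ} (h : Sum.inl t ∈ J)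
    (i : Fin M) : MeasurableSet[genSigma S ξ J] {ω | i ∈ S t ω} := by
  have h1 : sampleSigma S ξ (Sum.inl t) ≤ genSigma S ξ J := le_biSup (sampleSigma S ξ) h
  exact h1 _ ⟨{A | i ∈ A}, trivial, rfl⟩

theorem measurable_sample_genSigma {J : Set (ℕ ⊕ ℕ × Fin M × ℕ)} {t : ℕ} {i : Fin M} {k : ℕ}
    (h : Sum.inr (t, i, k) ∈ J) : Measurable[genSigma S ξ J] (ξ t i k) := by
  have h1 : sampleSigma S ξ (Sum.inr (t, i, k)) ≤ genSigma S ξ J := le_biSup (sampleSigma S ξ) h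
  rw [measurable_iff_comap_le]
  exact h1

namespace IsSampling

theorem sampleSigma_le (hS : IsSampling Pr P m S ξ) (j : ℕ ⊕ ℕ × Fin M × ℕ) :
    sampleSigma S ξ j ≤ mΩ := by
  rcases j with t | ⟨t, i, k⟩
  · exact measurable_iff_comap_le.1 (hS.measurable_S t)
  · exact (hS.measurable_sample t i k).comap_le

theorem genSigma_le (hS : IsSampling Pr P m S ξ) (J : Set (ℕ ⊕ ℕ × Fin M × ℕ)) :
    genSigma S ξ J ≤ mΩ :=
  iSup₂_le fun j _ => hS.sampleSigma_le j

/-- The only form in which independence enters: one random choice against all the others together.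
It replaces conditional expectations throughout. -/
theorem indep_compl (hS : IsSampling Pr P m S ξ) (q : ℕ ⊕ ℕ × Fin M × ℕ) :
    Indep (genSigma S ξ {q}ᶜ) (sampleSigma S ξ q) Pr := by
  have h := indep_iSup_of_disjoint (m := sampleSigma S ξ) hS.sampleSigma_le hS.indep
    (S := {q}ᶜ) (T := {q}) (Set.disjoint_left.2 fun _ h1 h2 => h1 h2)
  simpa [genSigma] using h

variable [IsProbabilityMeasure Pr]

theorem integral_S (hS : IsSampling Pr P m S ξ) (hmM : m ≤ M) (t : ℕ) {E : Type*}
    [NormedAddCommGroup E] [NormedSpace ℝ E] [CompleteSpace E] (ψ : Finset (Fin M) → E) :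
    ∫ A, ψ A ∂(@Measure.map _ _ _ ⊤ (S t) Pr)
      = (1 / (M.choose m : ℝ)) • ∑ A ∈ (Finset.univ : Finset (Fin M)).powersetCard m, ψ A := by
  let : MeasurableSpace (Finset (Fin M)) := ⊤
  have hm : Measurable (S t) := hS.measurable_S t
  have hp := Measure.isProbabilityMeasure_map (μ := Pr) hm.aemeasurable
  have hreal : ∀ A, (Pr.map (S t)).real {A} = Pr.real {ω | S t ω = A} := fun A => by
    rw [map_measureReal_apply hm trivial]; rfl
  have hC : (0 : ℝ) < M.choose m := by exact_mod_cast Nat.choose_pos hmM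
  have hsum : ∑ A : Finset (Fin M), (Pr.map (S t)).real {A} = 1 := by
    simp
  have hone : ∑ A ∈ (Finset.univ : Finset (Fin M)).powersetCard m, (Pr.map (S t)).real {A} = 1 := by
    rw [Finset.sum_congr rfl fun A hA => by
      rw [hreal, hS.uniform_S t A (Finset.mem_powersetCard.1 hA).2]]
    rw [Finset.sum_const, Finset.card_powersetCard, Finset.card_univ, Fintype.card_fin,
      nsmul_eq_mul]
    field_simp
  -- Uniformity is prescribed only on sets of m clients; their masses already add up to 1, so all
  -- other sets have mass zero.
  have hzero : ∀ A, A ∉ (Finset.univ : Finset (Fin M)).powersetCard m →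
      (Pr.map (S t)).real {A} = 0 := by
    have h1 := Finset.sum_add_sum_compl ((Finset.univ : Finset (Fin M)).powersetCard m)
      fun A => (Pr.map (S t)).real {A}
    rw [hsum, hone] at h1
    have h2 : ∑ A ∈ ((Finset.univ : Finset (Fin M)).powersetCard m)ᶜ,
      (Pr.map (S t)).real {A} = 0 := by linarith
    rw [Finset.sum_eq_zero_iff_of_nonneg fun _ _ => measureReal_nonneg] at h2
    exact fun A hA => h2 A (Finset.mem_compl.2 hA)
  rw [integral_fintype .of_finite, Finset.smul_sum,
    ← Finset.sum_subset (Finset.subset_univ ((Finset.univ : Finset (Fin M)).powersetCard m))]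
  · refine Finset.sum_congr rfl fun A hA => ?_
    rw [hreal, hS.uniform_S t A (Finset.mem_powersetCard.1 hA).2]
  · intro A _ hA
    rw [hzero A hA, zero_smul]

theorem ae_card (hS : IsSampling Pr P m S ξ) (hmM : m ≤ M) (t : ℕ) :
    ∀ᵐ ω ∂Pr, (S t ω).card = m := by
  let : MeasurableSpace (Finset (Fin M)) := ⊤
  have hm : Measurable (S t) := hS.measurable_S t
  have hp := Measure.isProbabilityMeasure_map (μ := Pr) hm.aemeasurable
  have h := hS.integral_S hmM t (fun A => if A.card = m then (0 : ℝ) else 1)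
  rw [Finset.sum_eq_zero fun A hA => if_pos (Finset.mem_powersetCard.1 hA).2, smul_zero,
    integral_eq_zero_iff_of_nonneg (fun A => by dsimp only; split_ifs <;> simp) .of_finite] at h
  filter_upwards [ae_of_ae_map hm.aemeasurable h] with ω hω
  by_contra hne
  simp [hne] at hω

theorem integral_mem (hS : IsSampling Pr P m S ξ) (hm1 : 1 ≤ m) (hmM : m ≤ M) (t : ℕ) (i : Fin M) :
    ∫ ω, (if i ∈ S t ω then (1 : ℝ) else 0) ^ 2 ∂Pr = m / M := by
  let : MeasurableSpace (Finset (Fin M)) := ⊤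
  have hm : Measurable (S t) := hS.measurable_S t
  have h := hS.integral_S hmM t (fun A => (if i ∈ A then (1 : ℝ) else 0) ^ 2)
  rw [integral_map hm.aemeasurable (measurable_of_finite _).aestronglyMeasurable] at h
  rw [h]
  have hC : (0 : ℝ) < M.choose m := by exact_mod_cast Nat.choose_pos hmM
  have hM : (0 : ℝ) < M := by exact_mod_cast (by omega : 0 < M)
  have h1 := mul_card_filter_mem_powersetCard hm1 i
  have h2 : (M : ℝ) * (Finset.filter (fun A => i ∈ A)
      ((Finset.univ : Finset (Fin M)).powersetCard m)).card = m * M.choose m := by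
    exact_mod_cast h1
  simp only [ite_pow, one_pow, ne_eq, OfNat.ofNat_ne_zero, not_false_eq_true, zero_pow,
    Finset.sum_boole, smul_eq_mul]
  field_simp
  linarith

end IsSampling

end Sampling

/-! ### Local stochastic gradient steps -/

section LocalSGD

variable {Ξ : Type u} [MeasurableSpace Ξ] {E : Type*} [NormedAddCommGroup E] [InnerProductSpace ℝ E]
  [MeasurableSpace E] [BorelSpace E] [SecondCountableTopology E] {M : ℕ}

/-- Local steps `w ← w + γ D (w, ξ_k)`. -/
def localSGD {Ξ E : Type*} [AddCommGroup E] [Module ℝ E] (D : E → Ξ → E) (γ : ℝ) (ξs : ℕ → Ξ)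
    (w : E) : ℕ → E
  | 0 => w
  | k + 1 => localSGD D γ ξs w k + γ • D (localSGD D γ ξs w k) (ξs k)

/-- Server iterates of local SGD with partial participation. -/
def serverSGD {Ξ E : Type*} [AddCommGroup E] [Module ℝ E] (D : Fin M → E → Ξ → E) (γ γg : ℝ)
    (m K : ℕ) (S : ℕ → Finset (Fin M)) (ξ : ℕ → Fin M → ℕ → Ξ) (w₀ : E) : ℕ → E
  | 0 => w₀
  | t + 1 => serverSGD D γ γg m K S ξ w₀ t
      + γg • ((1 / (m : ℝ)) • ∑ i ∈ S t, localSGD (D i) γ (ξ t i) (serverSGD D γ γg m K S ξ w₀ t) K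
        - serverSGD D γ γg m K S ξ w₀ t)

/-- The average of the client fields. -/
def meanField (F : Fin M → E → E) (w : E) : E := (1 / (M : ℝ)) • ∑ i, F i w

/-- Stochastic fields `D i` with Lipschitz means `F i`, variance at most `s` and heterogeneity at
most `G`. -/
structure LocalOracle (law : Fin M → Measure Ξ) (D : Fin M → E → Ξ → E) (F : Fin M → E → E)
    (L s G : ℝ) : Prop where
  measurable : ∀ i, Measurable (Function.uncurry (D i))
  integrable : ∀ i w, Integrable (D i w) (law i)
  integral_eq : ∀ i w, ∫ z, D i w z ∂(law i) = F i w
  integrable_sq : ∀ i w, Integrable (fun z => ‖D i w z - F i w‖ ^ 2) (law i)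
  variance_le : ∀ i w, ∫ z, ‖D i w z - F i w‖ ^ 2 ∂(law i) ≤ s
  lipschitz : ∀ i w w', ‖F i w - F i w'‖ ≤ L * ‖w - w'‖
  heterogeneity : ∀ i w, ‖F i w - meanField F w‖ ^ 2 ≤ G

theorem localSGD_sub {Ξ E : Type*} [AddCommGroup E] [Module ℝ E] (D : E → Ξ → E) (γ : ℝ)
    (ξs : ℕ → Ξ) (w : E) (K : ℕ) :
    localSGD D γ ξs w K - w = γ • ∑ k ∈ Finset.range K, D (localSGD D γ ξs w k) (ξs k) := by
  induction K with
  | zero => simp [localSGD]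
  | succ K ih =>
    rw [Finset.sum_range_succ, smul_add, ← ih, localSGD]
    abel

section Measurability

variable {Ω : Type v} {mΩ : MeasurableSpace Ω}

/-- Stated for an arbitrary σ-algebra and only for the samples drawn before step k, so that it
applies with the σ-algebra of all choices except one. -/
theorem measurable_localSGD {D : E → Ξ → E} (hD : Measurable (Function.uncurry D)) (γ : ℝ)
    {w : Ω → E} (hw : Measurable w) {ξs : ℕ → Ω → Ξ} {k : ℕ} (hξ : ∀ j < k, Measurable (ξs j)) :
    Measurable fun ω => localSGD D γ (fun j => ξs j ω) (w ω) k := by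
  induction k with
  | zero => exact hw
  | succ k ih =>
    have h1 := ih fun j hj => hξ j (hj.trans (Nat.lt_succ_self k))
    have h2 := hD.comp (h1.prodMk (hξ k (Nat.lt_succ_self k)))
    exact h1.add (h2.const_smul γ)

theorem measurable_sum_mem {E : Type*} [NormedAddCommGroup E] [MeasurableSpace E] [BorelSpace E]
    [SecondCountableTopology E] {A : Ω → Finset (Fin M)} (hA : ∀ i, MeasurableSet {ω | i ∈ A ω})
    {u : Fin M → Ω → E} (hu : ∀ i, Measurable (u i)) : Measurable fun ω => ∑ i ∈ A ω, u i ω := by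
  have : (fun ω => ∑ i ∈ A ω, u i ω) = fun ω => ∑ i, if i ∈ A ω then u i ω else 0 := by
    funext ω; rw [Finset.sum_ite_mem, Finset.univ_inter]
  rw [this]
  exact Finset.measurable_fun_sum _ fun i _ => Measurable.ite (hA i) (hu i) measurable_const

end Measurability

theorem measurable_serverSGD {Ω : Type v} {D : Fin M → E → Ξ → E}
    (hD : ∀ i, Measurable (Function.uncurry (D i))) (γ γg : ℝ) (m K : ℕ)
    (S : ℕ → Ω → Finset (Fin M)) (ξ : ℕ → Fin M → ℕ → Ω → Ξ) (w₀ : E) (t : ℕ) :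
    Measurable[genSigma S ξ {j | sampleRound j < t}]
      fun ω => serverSGD D γ γg m K (fun t => S t ω) (fun t i k => ξ t i k ω) w₀ t := by
  induction t with
  | zero => exact measurable_const
  | succ t ih =>
    have h1 := ih.mono (genSigma_mono (S := S) (ξ := ξ)
      (J' := {j | sampleRound j < t + 1}) fun j hj => lt_trans hj (Nat.lt_succ_self t)) le_rfl
    have hS : ∀ i, MeasurableSet[genSigma S ξ {j | sampleRound j < t + 1}] {ω | i ∈ S t ω} :=
      fun i => measurableSet_mem_genSigma (Nat.lt_succ_self t) i
    have h2 : ∀ i, Measurable[genSigma S ξ {j | sampleRound j < t + 1}] fun ω =>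
        localSGD (D i) γ (fun k => ξ t i k ω)
          (serverSGD D γ γg m K (fun t => S t ω) (fun t i k => ξ t i k ω) w₀ t) K := fun i =>
      measurable_localSGD (mΩ := genSigma S ξ {j | sampleRound j < t + 1}) (hD i) γ h1
        fun k _ => measurable_sample_genSigma (Nat.lt_succ_self t)
    have h3 := measurable_sum_mem (mΩ := genSigma S ξ {j | sampleRound j < t + 1}) hS h2
    let := genSigma S ξ {j | sampleRound j < t + 1}
    exact h1.add (((h3.const_smul (1 / (m : ℝ))).sub h1).const_smul γg)

end LocalSGD

/-! ### Noise and drift of the local models within one round -/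

section Round

variable {M d₁ d₂ m : ℕ} {Ξ : Type u} [MeasurableSpace Ξ] {Ω : Type v} {mΩ : MeasurableSpace Ω}
  {Pr : Measure Ω} {P : FedProblem M d₁ d₂ Ξ} {S : ℕ → Ω → Finset (Fin M)}
  {ξ : ℕ → Fin M → ℕ → Ω → Ξ}
  {E : Type*} [NormedAddCommGroup E] [InnerProductSpace ℝ E]
  [MeasurableSpace E] [BorelSpace E] [SecondCountableTopology E]

theorem continuous_of_norm_sub_le {E E' : Type*} [NormedAddCommGroup E] [NormedAddCommGroup E']
    {F : E → E'} {L : ℝ} (hF : ∀ w w', ‖F w - F w'‖ ≤ L * ‖w - w'‖) : Continuous F := by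
  refine (LipschitzWith.of_dist_le_mul (K := L.toNNReal) fun w w' => ?_).continuous
  rw [dist_eq_norm, dist_eq_norm]
  refine (hF w w').trans ?_
  have := Real.le_coe_toNNReal L
  gcongr

theorem memLp_comp_of_norm_sub_le [IsFiniteMeasure Pr] {E E' : Type*} [NormedAddCommGroup E]
    [NormedAddCommGroup E'] {F : E → E'} {L : ℝ} (hF : ∀ w w', ‖F w - F w'‖ ≤ L * ‖w - w'‖)
    {w : Ω → E} (hw : MemLp w 2 Pr) : MemLp (fun ω => F (w ω)) 2 Pr := by
  have h1 : MemLp (fun ω => ‖F 0‖ + |L| * ‖w ω‖) 2 Pr :=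
    (memLp_const ‖F 0‖).add (hw.norm.const_mul |L|)
  refine h1.mono ((continuous_of_norm_sub_le hF).comp_aestronglyMeasurable hw.aestronglyMeasurable)
    (Filter.Eventually.of_forall fun ω => ?_)
  have h2 := hF (w ω) 0
  rw [sub_zero] at h2
  have h3 : ‖F (w ω)‖ ≤ ‖F (w ω) - F 0‖ + ‖F 0‖ := by
    simpa using norm_add_le (F (w ω) - F 0) (F 0)
  have h4 : L * ‖w ω‖ ≤ |L| * ‖w ω‖ := by gcongr; exact le_abs_self L
  refine le_trans ?_ (le_abs_self _)
  linarith

variable {D : Fin M → E → Ξ → E} {F : Fin M → E → E} {L s G γ : ℝ} {t : ℕ} {w : Ω → E}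

theorem measurable_localSGD_genSigma (hD : ∀ i, Measurable (Function.uncurry (D i)))
    (hw : Measurable[genSigma S ξ {j | sampleRound j < t}] w) {i : Fin M} {k : ℕ}
    {J : Set (ℕ ⊕ ℕ × Fin M × ℕ)} (hJ : ∀ j, sampleRound j < t → j ∈ J)
    (hJ' : ∀ k' < k, Sum.inr (t, i, k') ∈ J) :
    Measurable[genSigma S ξ J] fun ω => localSGD (D i) γ (fun k => ξ t i k ω) (w ω) k :=
  measurable_localSGD (mΩ := genSigma S ξ J) (hD i) γ
    (hw.mono (genSigma_mono hJ) le_rfl) fun k' hk' => measurable_sample_genSigma (hJ' k' hk')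

theorem mem_compl_of_sampleRound_lt {j : ℕ ⊕ ℕ × Fin M × ℕ} (h : sampleRound j < t)
    (i : Fin M) (k : ℕ) :
    j ∈ ({Sum.inr (t, i, k)}ᶜ : Set (ℕ ⊕ ℕ × Fin M × ℕ)) := by
  rintro rfl
  exact lt_irrefl _ h

namespace LocalOracle

theorem continuous (ho : LocalOracle P.D D F L s G) (i : Fin M) : Continuous (F i) :=
  continuous_of_norm_sub_le (ho.lipschitz i)

theorem measurable_noise (ho : LocalOracle P.D D F L s G) (i : Fin M) :
    Measurable (Function.uncurry fun v z => D i v z - F i v) :=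
  (ho.measurable i).sub ((ho.continuous i).measurable.comp measurable_fst)

variable [IsProbabilityMeasure Pr]

theorem memLp_smul_noise (ho : LocalOracle P.D D F L s G) (hS : IsSampling Pr P m S ξ)
    {i : Fin M} {k : ℕ} {v : Ω → E} (hv : Measurable[genSigma S ξ {Sum.inr (t, i, k)}ᶜ] v)
    {c : Ω → ℝ} (hc : Measurable[genSigma S ξ {Sum.inr (t, i, k)}ᶜ] c) (hc2 : MemLp c 2 Pr) :
    MemLp (fun ω => c ω • (D i (v ω) (ξ t i k ω) - F i (v ω))) 2 Pr
      ∧ ∫ ω, ‖c ω • (D i (v ω) (ξ t i k ω) - F i (v ω))‖ ^ 2 ∂Pr ≤ s * ∫ ω, c ω ^ 2 ∂Pr :=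
  memLp_smul_of_indep (hS.genSigma_le _) (hS.measurable_sample t i k)
    (hS.indep_compl (Sum.inr (t, i, k))) (ho.measurable_noise i)
    (by rw [hS.law_sample]; exact ho.integrable_sq i)
    (by rw [hS.law_sample]; exact ho.variance_le i) hv hc hc2

theorem integral_inner_noise [CompleteSpace E] (ho : LocalOracle P.D D F L s G)
    (hS : IsSampling Pr P m S ξ)
    {i : Fin M} {k : ℕ} {v : Ω → E} (hv : Measurable[genSigma S ξ {Sum.inr (t, i, k)}ᶜ] v)
    {a : Ω → E} (ha : Measurable[genSigma S ξ {Sum.inr (t, i, k)}ᶜ] a) :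
    ∫ ω, inner ℝ (a ω) (D i (v ω) (ξ t i k ω) - F i (v ω)) ∂Pr = 0 := by
  have := P.prob i
  refine integral_inner_eq_zero_of_indep (hS.genSigma_le _) (hS.measurable_sample t i k)
    (hS.indep_compl (Sum.inr (t, i, k))) (ho.measurable_noise i) ?_ ?_ hv ha
  · rw [hS.law_sample]
    exact fun v => (ho.integrable i v).sub (integrable_const _)
  · rw [hS.law_sample]
    intro v
    rw [integral_sub (ho.integrable i v) (integrable_const _), ho.integral_eq]
    simp

theorem measurable_local (ho : LocalOracle P.D D F L s G)
    (hw : Measurable[genSigma S ξ {j | sampleRound j < t}] w) (i : Fin M) (k : ℕ) :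
    Measurable[genSigma S ξ {Sum.inr (t, i, k)}ᶜ]
      fun ω => localSGD (D i) γ (fun k => ξ t i k ω) (w ω) k := by
  refine measurable_localSGD_genSigma ho.measurable hw
    (fun j hj => mem_compl_of_sampleRound_lt hj i k) fun k' hk' h => ?_
  simp at h
  omega

theorem memLp_noise (ho : LocalOracle P.D D F L s G) (hS : IsSampling Pr P m S ξ)
    (hw : Measurable[genSigma S ξ {j | sampleRound j < t}] w) (i : Fin M) (k : ℕ) :
    MemLp (fun ω => D i (localSGD (D i) γ (fun k => ξ t i k ω) (w ω) k) (ξ t i k ω)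
        - F i (localSGD (D i) γ (fun k => ξ t i k ω) (w ω) k)) 2 Pr
      ∧ ∫ ω, ‖D i (localSGD (D i) γ (fun k => ξ t i k ω) (w ω) k) (ξ t i k ω)
        - F i (localSGD (D i) γ (fun k => ξ t i k ω) (w ω) k)‖ ^ 2 ∂Pr ≤ s := by
  have := ho.memLp_smul_noise (c := fun _ => 1) hS (ho.measurable_local (γ := γ) hw i k)
    measurable_const (memLp_const 1)
  simpa using this

theorem localSGD_succ_eq (i : Fin M) (ξs : ℕ → Ξ) (w : E) (k : ℕ) :
    localSGD (D i) γ ξs w (k + 1) = localSGD (D i) γ ξs w k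
      + γ • ((D i (localSGD (D i) γ ξs w k) (ξs k) - F i (localSGD (D i) γ ξs w k))
        + F i (localSGD (D i) γ ξs w k)) := by
  rw [sub_add_cancel, localSGD]

theorem memLp_local (ho : LocalOracle P.D D F L s G) (hS : IsSampling Pr P m S ξ)
    (hw : Measurable[genSigma S ξ {j | sampleRound j < t}] w) (hw2 : MemLp w 2 Pr)
    (i : Fin M) (k : ℕ) :
    MemLp (fun ω => localSGD (D i) γ (fun k => ξ t i k ω) (w ω) k) 2 Pr := by
  induction k with
  | zero => exact hw2
  | succ k ih =>
    simp only [localSGD_succ_eq (F := F) i]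
    exact ih.add ((((ho.memLp_noise hS hw i k).1).add
      (memLp_comp_of_norm_sub_le (ho.lipschitz i) ih)).const_smul γ)

/-- The local models drift only little from the server model. -/
theorem integral_drift_le (ho : LocalOracle P.D D F L s G) (hS : IsSampling Pr P m S ξ)
    (hγ : 6 * γ ^ 2 * L ^ 2 ≤ 1)
    (hw : Measurable[genSigma S ξ {j | sampleRound j < t}] w) (hw2 : MemLp w 2 Pr)
    (i : Fin M) (k : ℕ) :
    ∫ ω, ‖localSGD (D i) γ (fun k => ξ t i k ω) (w ω) k - w ω‖ ^ 2 ∂Pr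
      ≤ (3 ^ k - 1) * (3 * γ ^ 2 * (∫ ω, ‖F i (w ω)‖ ^ 2 ∂Pr + s)) := by
  induction k with
  | zero => simp [localSGD]
  | succ k ih =>
    set ℓ : Ω → E := fun ω => localSGD (D i) γ (fun k => ξ t i k ω) (w ω) k with hℓ
    set ν : Ω → E := fun ω => D i (ℓ ω) (ξ t i k ω) - F i (ℓ ω) with hν
    obtain ⟨hνL, hνs⟩ := ho.memLp_noise (γ := γ) hS hw i k
    have hℓL : MemLp ℓ 2 Pr := ho.memLp_local hS hw hw2 i k
    have hFL := memLp_comp_of_norm_sub_le (ho.lipschitz i) hw2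
    -- Recursion e ↦ 3e + 6γ²(…), solved by the factor 3^k - 1. The exponential growth in k is
    -- harmless because γ is later chosen depending on K.
    have hpt : ∀ ω, ‖localSGD (D i) γ (fun k => ξ t i k ω) (w ω) (k + 1) - w ω‖ ^ 2
        ≤ 3 * ‖ℓ ω - w ω‖ ^ 2 + 6 * γ ^ 2 * (‖F i (w ω)‖ ^ 2 + ‖ν ω‖ ^ 2) := by
      intro ω
      rw [localSGD_succ_eq (F := F) i]
      change ‖ℓ ω + γ • (ν ω + F i (ℓ ω)) - w ω‖ ^ 2 ≤ _
      have h1 : ‖ℓ ω + γ • (ν ω + F i (ℓ ω)) - w ω‖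
          ≤ ‖ℓ ω - w ω‖ + |γ| * (‖ν ω‖ + (‖F i (w ω)‖ + L * ‖ℓ ω - w ω‖)) := by
        have e : ℓ ω + γ • (ν ω + F i (ℓ ω)) - w ω
            = (ℓ ω - w ω) + γ • (ν ω + (F i (w ω) + (F i (ℓ ω) - F i (w ω)))) := by
          rw [add_sub_cancel]; abel
        rw [e]
        refine (norm_add_le _ _).trans ?_
        rw [norm_smul, Real.norm_eq_abs]
        gcongr
        refine (norm_add_le _ _).trans ?_
        gcongr
        refine (norm_add_le _ _).trans ?_
        gcongr
        exact ho.lipschitz i _ _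
      set p := ‖ℓ ω - w ω‖
      set q := ‖F i (w ω)‖
      set r := ‖ν ω‖
      have h2 := pow_le_pow_left₀ (norm_nonneg _) h1 2
      refine h2.trans ?_
      have h3 : (p + |γ| * (r + (q + L * p))) ^ 2
          ≤ 2 * p ^ 2 + 2 * (γ ^ 2 * (3 * r ^ 2 + 3 * q ^ 2 + 3 * (L * p) ^ 2)) := by
        have h4 : (p + |γ| * (r + (q + L * p))) ^ 2
            ≤ 2 * p ^ 2 + 2 * (|γ| * (r + (q + L * p))) ^ 2 := by
          nlinarith [sq_nonneg (p - |γ| * (r + (q + L * p)))]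
        have h5 : (r + (q + L * p)) ^ 2 ≤ 3 * r ^ 2 + 3 * q ^ 2 + 3 * (L * p) ^ 2 := by
          nlinarith [sq_nonneg (r - q), sq_nonneg (r - L * p), sq_nonneg (q - L * p)]
        rw [mul_pow |γ|, sq_abs] at h4
        have := mul_le_mul_of_nonneg_left h5 (sq_nonneg γ)
        linarith
      refine h3.trans ?_
      have h6 := mul_le_mul_of_nonneg_right hγ (sq_nonneg p)
      nlinarith
    have hi1 : Integrable (fun ω => ‖ℓ ω - w ω‖ ^ 2) Pr :=
      (hℓL.sub hw2).integrable_norm_pow (p := 2) two_ne_zero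
    have hi2 : Integrable (fun ω => ‖F i (w ω)‖ ^ 2) Pr :=
      hFL.integrable_norm_pow (p := 2) two_ne_zero
    have hi3 : Integrable (fun ω => ‖ν ω‖ ^ 2) Pr :=
      hνL.integrable_norm_pow (p := 2) two_ne_zero
    have hi4 : Integrable (fun ω =>
        ‖localSGD (D i) γ (fun k => ξ t i k ω) (w ω) (k + 1) - w ω‖ ^ 2) Pr :=
      ((ho.memLp_local hS hw hw2 i (k + 1)).sub hw2).integrable_norm_pow (p := 2) two_ne_zero
    have h7 := integral_mono hi4 ((hi1.const_mul 3).add ((hi2.add hi3).const_mul (6 * γ ^ 2))) hpt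
    refine h7.trans ?_
    rw [integral_add' (hi1.const_mul 3) ((hi2.add hi3).const_mul (6 * γ ^ 2)), integral_const_mul,
      integral_const_mul, integral_add' hi2 hi3]
    have h8 : ∫ ω, ‖ν ω‖ ^ 2 ∂Pr ≤ s := hνs
    have h9 := mul_le_mul_of_nonneg_left h8 (show 0 ≤ 6 * γ ^ 2 by positivity)
    rw [pow_succ (3 : ℝ) k]
    linarith

end LocalOracle

end Round

/-! ### Decomposition of a round into mean step, noise, client sampling error and drift -/

section Decomposition

variable {M d₁ d₂ m K : ℕ} {Ξ : Type u} [MeasurableSpace Ξ] {Ω : Type v} {mΩ : MeasurableSpace Ω}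
  {Pr : Measure Ω} {P : FedProblem M d₁ d₂ Ξ} {S : ℕ → Ω → Finset (Fin M)}
  {ξ : ℕ → Fin M → ℕ → Ω → Ξ}
  {E : Type*} [NormedAddCommGroup E] [InnerProductSpace ℝ E]
  [MeasurableSpace E] [BorelSpace E] [SecondCountableTopology E]
  {D : Fin M → E → Ξ → E} {F : Fin M → E → E} {L s G γ : ℝ} {t : ℕ} {w : Ω → E}

theorem norm_meanField_sub_le (hM : 1 ≤ M) (hF : ∀ i w w', ‖F i w - F i w'‖ ≤ L * ‖w - w'‖)
    (w w' : E) : ‖meanField F w - meanField F w'‖ ≤ L * ‖w - w'‖ := by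
  have hM0 : (0 : ℝ) < M := by exact_mod_cast hM
  rw [meanField, meanField, ← smul_sub, ← Finset.sum_sub_distrib, norm_smul,
    Real.norm_of_nonneg (by positivity)]
  have h1 : ‖∑ i, (F i w - F i w')‖ ≤ M * (L * ‖w - w'‖) := by
    refine (norm_sum_le _ _).trans ((Finset.sum_le_sum fun i _ => hF i w w').trans ?_)
    simp
  calc 1 / (M : ℝ) * ‖∑ i, (F i w - F i w')‖ ≤ 1 / (M : ℝ) * (M * (L * ‖w - w'‖)) := by gcongr
    _ = L * ‖w - w'‖ := by field_simp

theorem sum_sub_meanField (hM : 1 ≤ M) (w : E) : ∑ i, (F i w - meanField F w) = 0 := by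
  have hM0 : (M : ℝ) ≠ 0 := by exact_mod_cast (by omega : M ≠ 0)
  rw [Finset.sum_sub_distrib, Finset.sum_const, Finset.card_univ, Fintype.card_fin,
    ← Nat.cast_smul_eq_nsmul ℝ, meanField, smul_smul, mul_one_div_cancel hM0, one_smul, sub_self]

/-- The weight of client `i` in round `t`. -/
def participation (S : ℕ → Ω → Finset (Fin M)) (t : ℕ) (i : Fin M) (ω : Ω) : ℝ :=
  if i ∈ S t ω then 1 else 0

theorem sum_mem_eq_sum_participation (u : Fin M → E) (ω : Ω) :
    ∑ i ∈ S t ω, u i = ∑ i, participation S t i ω • u i := by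
  simp only [participation, ite_smul, one_smul, zero_smul]
  rw [Finset.sum_ite_mem, Finset.univ_inter]

theorem measurable_participation {J : Set (ℕ ⊕ ℕ × Fin M × ℕ)} (h : Sum.inl t ∈ J) (i : Fin M) :
    Measurable[genSigma S ξ J] (participation S t i) :=
  Measurable.ite (measurableSet_mem_genSigma h i) measurable_const measurable_const

theorem memLp_participation [IsProbabilityMeasure Pr] (hS : IsSampling Pr P m S ξ) (t : ℕ)
    (i : Fin M) : MemLp (participation S t i) 2 Pr := by
  have h : Measurable (participation S t i) :=
    (measurable_participation (ξ := ξ) (Set.mem_univ _) i).mono (hS.genSigma_le Set.univ) le_rfl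
  refine MemLp.of_bound h.aestronglyMeasurable 1 (Filter.Eventually.of_forall fun ω => ?_)
  simp only [participation]
  split_ifs <;> simp

/-- The sampling error of the participating clients. -/
def clientError (F : Fin M → E → E) (m : ℕ) (S : ℕ → Ω → Finset (Fin M)) (t : ℕ) (w : Ω → E)
    (ω : Ω) : E :=
  (1 / (m : ℝ)) • ∑ i ∈ S t ω, (F i (w ω) - meanField F (w ω))

/-- The noise of the `k`-th local step of client `i`. -/
def localNoise (D : Fin M → E → Ξ → E) (F : Fin M → E → E) (γ : ℝ) (ξ : ℕ → Fin M → ℕ → Ω → Ξ)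
    (t : ℕ) (w : Ω → E) (q : Fin M × ℕ) (ω : Ω) : E :=
  D q.1 (localSGD (D q.1) γ (fun k => ξ t q.1 k ω) (w ω) q.2) (ξ t q.1 q.2 ω)
    - F q.1 (localSGD (D q.1) γ (fun k => ξ t q.1 k ω) (w ω) q.2)

/-- The drift of the `k`-th local step of client `i`. -/
def localDrift (D : Fin M → E → Ξ → E) (F : Fin M → E → E) (γ : ℝ) (ξ : ℕ → Fin M → ℕ → Ω → Ξ)
    (t : ℕ) (w : Ω → E) (q : Fin M × ℕ) (ω : Ω) : E :=
  F q.1 (localSGD (D q.1) γ (fun k => ξ t q.1 k ω) (w ω) q.2) - F q.1 (w ω)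

/-- The average over the participating clients and the local steps. -/
def roundAverage (m K : ℕ) (S : ℕ → Ω → Finset (Fin M)) (t : ℕ) (u : Fin M × ℕ → Ω → E) (ω : Ω) :
    E :=
  (1 / ((m : ℝ) * K)) • ∑ q ∈ Finset.univ ×ˢ Finset.range K, participation S t q.1 ω • u q ω

/-- Each sampled gradient is noise plus drift plus F i at the server model, and averaging the last
over the sampled clients gives mean field plus sampling error. The exact cardinality m makes the
average of a constant equal to that constant. -/
theorem server_step_eq (hm : 1 ≤ m) (hK : 1 ≤ K) (γg : ℝ) {ω : Ω} (hcard : (S t ω).card = m) :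
    w ω + γg • ((1 / (m : ℝ)) • ∑ i ∈ S t ω, localSGD (D i) γ (fun k => ξ t i k ω) (w ω) K - w ω)
      = w ω + (γ * γg * K) • (meanField F (w ω)
        + (roundAverage m K S t (localNoise D F γ ξ t w) ω + clientError F m S t w ω)
        + roundAverage m K S t (localDrift D F γ ξ t w) ω) := by
  have hm0 : (m : ℝ) ≠ 0 := by exact_mod_cast (by omega : m ≠ 0)
  have hK0 : (K : ℝ) ≠ 0 := by exact_mod_cast (by omega : K ≠ 0)
  have hconst : ∀ v : E, (1 / (m : ℝ)) • ∑ _i ∈ S t ω, v = v := fun v => by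
    rw [Finset.sum_const, hcard, ← Nat.cast_smul_eq_nsmul ℝ, smul_smul, one_div_mul_cancel hm0,
      one_smul]
  have h1 : (1 / (m : ℝ)) • ∑ i ∈ S t ω, localSGD (D i) γ (fun k => ξ t i k ω) (w ω) K - w ω
      = (1 / (m : ℝ)) • ∑ i ∈ S t ω, γ • ∑ k ∈ Finset.range K,
        D i (localSGD (D i) γ (fun k => ξ t i k ω) (w ω) k) (ξ t i k ω) := by
    conv_lhs => rw [← hconst (w ω)]
    rw [← smul_sub, ← Finset.sum_sub_distrib, hconst]
    simp_rw [localSGD_sub]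
  have havg : ∀ u : Fin M × ℕ → Ω → E, roundAverage m K S t u ω
      = (1 / ((m : ℝ) * K)) • ∑ i ∈ S t ω, ∑ k ∈ Finset.range K, u (i, k) ω := fun u => by
    rw [roundAverage, Finset.sum_product, sum_mem_eq_sum_participation]
    simp_rw [Finset.smul_sum]
  have h2 : ∀ i : Fin M, ∑ k ∈ Finset.range K,
        D i (localSGD (D i) γ (fun k => ξ t i k ω) (w ω) k) (ξ t i k ω)
      = ∑ k ∈ Finset.range K, localNoise D F γ ξ t w (i, k) ω
        + ∑ k ∈ Finset.range K, localDrift D F γ ξ t w (i, k) ω + (K : ℝ) • F i (w ω) := fun i => by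
    have e : (K : ℝ) • F i (w ω) = ∑ k ∈ Finset.range K, F i (w ω) := by
      rw [Finset.sum_const, Finset.card_range, Nat.cast_smul_eq_nsmul]
    rw [e, ← Finset.sum_add_distrib, ← Finset.sum_add_distrib]
    refine Finset.sum_congr rfl fun k _ => ?_
    simp only [localNoise, localDrift]
    abel
  have h3 : meanField F (w ω) + clientError F m S t w ω
      = (1 / (m : ℝ)) • ∑ i ∈ S t ω, F i (w ω) := by
    rw [clientError, Finset.sum_sub_distrib, smul_sub, hconst]
    abel
  have h4 : meanField F (w ω)
        + (roundAverage m K S t (localNoise D F γ ξ t w) ω + clientError F m S t w ω)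
        + roundAverage m K S t (localDrift D F γ ξ t w) ω
      = (1 / ((m : ℝ) * K)) • ∑ i ∈ S t ω, ∑ k ∈ Finset.range K,
        D i (localSGD (D i) γ (fun k => ξ t i k ω) (w ω) k) (ξ t i k ω) := by
    have e : meanField F (w ω)
        + (roundAverage m K S t (localNoise D F γ ξ t w) ω + clientError F m S t w ω)
        + roundAverage m K S t (localDrift D F γ ξ t w) ω
      = roundAverage m K S t (localNoise D F γ ξ t w) ω
        + roundAverage m K S t (localDrift D F γ ξ t w) ω
        + (meanField F (w ω) + clientError F m S t w ω) := by abel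
    rw [e, h3, havg, havg]
    simp_rw [h2]
    rw [Finset.sum_add_distrib, Finset.sum_add_distrib, smul_add, smul_add, ← Finset.smul_sum,
      smul_smul]
    congr 2
    field_simp
  rw [h4, h1, ← Finset.smul_sum, smul_smul, smul_smul, smul_smul]
  congr 2
  field_simp

namespace LocalOracle

variable [IsProbabilityMeasure Pr]

/-- The noise at (i, k) uses only the samples of client i up to step k and the past rounds. Ordering
pairs by step index therefore leaves the later sample of any two distinct pairs untouched, across
clients as well. -/
theorem measurable_smul_localNoise (ho : LocalOracle P.D D F L s G)
    (hw : Measurable[genSigma S ξ {j | sampleRound j < t}] w) {q r : Fin M × ℕ} (hqr : q ≠ r)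
    (hle : q.2 ≤ r.2) :
    Measurable[genSigma S ξ {Sum.inr (t, r.1, r.2)}ᶜ] (localNoise D F γ ξ t w q) := by
  have h1 : Measurable[genSigma S ξ {Sum.inr (t, r.1, r.2)}ᶜ]
      fun ω => localSGD (D q.1) γ (fun k => ξ t q.1 k ω) (w ω) q.2 := by
    refine measurable_localSGD_genSigma ho.measurable hw
      (fun j hj => mem_compl_of_sampleRound_lt hj _ _) fun k' hk' h => ?_
    simp only [Set.mem_singleton_iff, Sum.inr.injEq, Prod.mk.injEq] at h
    omega
  have h2 : Measurable[genSigma S ξ {Sum.inr (t, r.1, r.2)}ᶜ] (ξ t q.1 q.2) := by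
    refine measurable_sample_genSigma fun h => hqr ?_
    simp only [Set.mem_singleton_iff, Sum.inr.injEq, Prod.mk.injEq] at h
    exact Prod.ext h.2.1 h.2.2
  exact (ho.measurable_noise q.1).comp (h1.prodMk h2)

theorem memLp_participation_noise (ho : LocalOracle P.D D F L s G) (hS : IsSampling Pr P m S ξ)
    (hm : 1 ≤ m) (hmM : m ≤ M) (hw : Measurable[genSigma S ξ {j | sampleRound j < t}] w)
    (q : Fin M × ℕ) :
    MemLp (fun ω => participation S t q.1 ω • localNoise D F γ ξ t w q ω) 2 Pr
      ∧ ∫ ω, ‖participation S t q.1 ω • localNoise D F γ ξ t w q ω‖ ^ 2 ∂Pr ≤ s * (m / M) := by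
  have h := ho.memLp_smul_noise (c := participation S t q.1) hS
    (ho.measurable_local (γ := γ) hw q.1 q.2)
    (measurable_participation (by simp) q.1) (memLp_participation hS t q.1)
  rw [show ∫ ω, participation S t q.1 ω ^ 2 ∂Pr = m / M from hS.integral_mem hm hmM t q.1] at h
  exact h

theorem memLp_roundAverage_noise (ho : LocalOracle P.D D F L s G) (hS : IsSampling Pr P m S ξ)
    (hm : 1 ≤ m) (hmM : m ≤ M) (hw : Measurable[genSigma S ξ {j | sampleRound j < t}] w) :
    MemLp (roundAverage m K S t (localNoise D F γ ξ t w)) 2 Pr :=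
  (memLp_finsetSum _ fun q _ => (ho.memLp_participation_noise hS hm hmM hw q).1).const_smul _

theorem integral_roundAverage_noise_sq_le [CompleteSpace E] (ho : LocalOracle P.D D F L s G)
    (hS : IsSampling Pr P m S ξ) (hm : 1 ≤ m) (hmM : m ≤ M) (hK : 1 ≤ K)
    (hw : Measurable[genSigma S ξ {j | sampleRound j < t}] w) :
    ∫ ω, ‖roundAverage m K S t (localNoise D F γ ξ t w) ω‖ ^ 2 ∂Pr ≤ s / (m * K) := by
  have hm0 : (0 : ℝ) < m := by exact_mod_cast hm
  have hM0 : (0 : ℝ) < M := by exact_mod_cast hm.trans hmM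
  have hK0 : (0 : ℝ) < K := by exact_mod_cast hK
  -- The noise of the later step is centred given everything else, including the participation
  -- weights; so all noises of the round are orthogonal and M K terms of size s m/M remain.
  have horth : ∀ q r : Fin M × ℕ, q ≠ r → q.2 ≤ r.2 →
      ∫ ω, inner ℝ (participation S t q.1 ω • localNoise D F γ ξ t w q ω)
        (participation S t r.1 ω • localNoise D F γ ξ t w r ω) ∂Pr = 0 := by
    intro q r hqr hle
    have hp : ∀ i, Measurable[genSigma S ξ {Sum.inr (t, r.1, r.2)}ᶜ] (participation S t i) :=
      measurable_participation (by simp)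
    have h := ho.integral_inner_noise (a := fun ω => participation S t r.1 ω •
        participation S t q.1 ω • localNoise D F γ ξ t w q ω) hS
      (ho.measurable_local (γ := γ) hw r.1 r.2)
      ((hp r.1).smul ((hp q.1).smul (ho.measurable_smul_localNoise hw hqr hle)))
    rw [← h]
    refine integral_congr_ae (Filter.Eventually.of_forall fun ω => ?_)
    simp only [real_inner_smul_left, inner_smul_right, localNoise]
  simp only [roundAverage, norm_smul, mul_pow]
  rw [integral_const_mul, integral_norm_sum_sq _
    fun q _ => (ho.memLp_participation_noise hS hm hmM hw q).1]
  · have h1 := Finset.sum_le_sum fun q (_ : q ∈ (Finset.univ : Finset (Fin M)) ×ˢ Finset.range K) =>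
      (ho.memLp_participation_noise (γ := γ) hS hm hmM hw q).2
    rw [Finset.sum_const, Finset.card_product, Finset.card_univ, Fintype.card_fin,
      Finset.card_range, nsmul_eq_mul] at h1
    rw [Real.norm_of_nonneg (by positivity)]
    calc _ ≤ (1 / ((m : ℝ) * K)) ^ 2 * (((M * K : ℕ) : ℝ) * (s * (m / M))) := by gcongr
      _ = s / (m * K) := by push_cast; field_simp
  · intro q _ r _ hqr
    rcases le_total q.2 r.2 with hle | hle
    · exact horth q r hqr hle
    · rw [← horth r q hqr.symm hle]
      exact integral_congr_ae (Filter.Eventually.of_forall fun ω => real_inner_comm _ _)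

theorem integral_inner_roundAverage_noise [CompleteSpace E] (ho : LocalOracle P.D D F L s G)
    (hS : IsSampling Pr P m S ξ) (hm : 1 ≤ m) (hmM : m ≤ M)
    (hw : Measurable[genSigma S ξ {j | sampleRound j < t}] w) {A : E → E} (hA : Measurable A)
    (hA2 : MemLp (fun ω => A (w ω)) 2 Pr) :
    ∫ ω, inner ℝ (A (w ω)) (roundAverage m K S t (localNoise D F γ ξ t w) ω) ∂Pr = 0 := by
  simp only [roundAverage, inner_smul_right, inner_sum]
  rw [integral_const_mul, integral_finsetSum]
  · rw [Finset.sum_eq_zero, mul_zero]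
    intro q _
    have hwq : Measurable[genSigma S ξ {Sum.inr (t, q.1, q.2)}ᶜ] w :=
      hw.mono (genSigma_mono fun j hj => mem_compl_of_sampleRound_lt hj _ _) le_rfl
    have h := ho.integral_inner_noise (a := fun ω => participation S t q.1 ω • A (w ω)) hS
      (ho.measurable_local (γ := γ) hw q.1 q.2)
      ((measurable_participation (by simp) q.1).smul (hA.comp hwq))
    rw [← h]
    refine integral_congr_ae (Filter.Eventually.of_forall fun ω => ?_)
    simp only [real_inner_smul_left, localNoise]
  · intro q _
    have := integrable_inner_of_memLp hA2 (ho.memLp_participation_noise (γ := γ) hS hm hmM hw q).1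
    simpa only [inner_smul_right] using this

/-- The sampling error as a function of the model and the sampled set. -/
theorem measurable_setError (ho : LocalOracle P.D D F L s G) (hM : 1 ≤ M) (m : ℕ) :
    Measurable[Prod.instMeasurableSpace (m₂ := ⊤)] (Function.uncurry fun (v : E)
      (A : Finset (Fin M)) => (1 / (m : ℝ)) • ∑ i ∈ A, (F i v - meanField F v)) := by
  let _ : MeasurableSpace (Finset (Fin M)) := ⊤
  have hmean : Measurable (meanField F) :=
    (continuous_of_norm_sub_le (norm_meanField_sub_le hM ho.lipschitz)).measurable
  have h := measurable_sum_mem (Ω := E × Finset (Fin M)) (A := fun p => p.2)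
    (u := fun i p => F i p.1 - meanField F p.1)
    (fun i => measurable_snd (show MeasurableSet {A : Finset (Fin M) | i ∈ A} from trivial))
    (fun i => ((ho.continuous i).measurable.comp measurable_fst).sub (hmean.comp measurable_fst))
  exact h.const_smul (1 / (m : ℝ))

theorem measurable_genSigma_compl_inl
    (hw : Measurable[genSigma S ξ {j | sampleRound j < t}] w) :
    Measurable[genSigma S ξ {Sum.inl t}ᶜ] w :=
  hw.mono (genSigma_mono fun j hj h => by
    rw [Set.mem_singleton_iff] at h
    subst h
    exact lt_irrefl t hj) le_rfl

/-- The deviations from the mean field sum to zero over all clients, hence over all m-sets; the set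
drawn in round t is independent of the current model. -/
theorem integral_inner_clientError [CompleteSpace E] (ho : LocalOracle P.D D F L s G)
    (hS : IsSampling Pr P m S ξ)
    (hm : 1 ≤ m) (hmM : m ≤ M) (hw : Measurable[genSigma S ξ {j | sampleRound j < t}] w)
    {A : E → E} (hA : Measurable A) :
    ∫ ω, inner ℝ (A (w ω)) (clientError F m S t w ω) ∂Pr = 0 := by
  let _ : MeasurableSpace (Finset (Fin M)) := ⊤
  have hw' := measurable_genSigma_compl_inl hw
  have := Measure.isProbabilityMeasure_map (μ := Pr) (hS.measurable_S t).aemeasurable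
  refine integral_inner_eq_zero_of_indep (hS.genSigma_le _) (hS.measurable_S t)
    (hS.indep_compl (Sum.inl t)) (ho.measurable_setError (hm.trans hmM) m)
    (fun v => .of_finite) (fun v => ?_) hw' (hA.comp hw')
  rw [hS.integral_S hmM t, ← Finset.smul_sum,
    sum_powersetCard_eq_zero hm (sum_sub_meanField (hm.trans hmM) v), smul_zero, smul_zero]

/-- The second moment of the sampling error; it vanishes for full participation. -/
theorem memLp_clientError [CompleteSpace E] (ho : LocalOracle P.D D F L s G)
    (hS : IsSampling Pr P m S ξ)
    (hm : 1 ≤ m) (hmM : m ≤ M) (hw : Measurable[genSigma S ξ {j | sampleRound j < t}] w) :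
    MemLp (clientError F m S t w) 2 Pr
      ∧ ∫ ω, ‖clientError F m S t w ω‖ ^ 2 ∂Pr ≤ if m = M then 0 else G / m := by
  let _ : MeasurableSpace (Finset (Fin M)) := ⊤
  have hw' := measurable_genSigma_compl_inl hw
  have := Measure.isProbabilityMeasure_map (μ := Pr) (hS.measurable_S t).aemeasurable
  have hm0 : (0 : ℝ) < m := by exact_mod_cast hm
  have hC : (0 : ℝ) < M.choose m := by exact_mod_cast Nat.choose_pos hmM
  have h := memLp_smul_of_indep (c := fun _ => (1 : ℝ)) (τ := if m = M then 0 else G / m)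
    (hS.genSigma_le _) (hS.measurable_S t)
    (hS.indep_compl (Sum.inl t)) (ho.measurable_setError (hm.trans hmM) m)
    (fun v => .of_finite) (fun v => ?_) hw' measurable_const (memLp_const 1)
  · simp only [one_smul, one_pow, integral_const, probReal_univ, mul_one] at h
    exact h
  · rw [hS.integral_S hmM t]
    have hz := sum_sub_meanField (F := F) (hm.trans hmM) v
    -- Under full participation the only possible set is the whole set of clients, where the
    -- deviations cancel exactly.
    split_ifs with hmM'
    · subst hmM'
      have e : (Finset.univ : Finset (Fin m)).powersetCard m = {Finset.univ} := by
        ext A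
        rw [Finset.mem_powersetCard_univ, Finset.mem_singleton, ← Finset.card_eq_iff_eq_univ,
          Fintype.card_fin]
      rw [e, Finset.sum_singleton, hz]
      simp
    · have h1 := sum_powersetCard_norm_sq_le hm hz fun i => ho.heterogeneity i v
      simp only [norm_smul, mul_pow]
      rw [← Finset.mul_sum, Real.norm_of_nonneg (by positivity), smul_eq_mul]
      calc _ ≤ 1 / (M.choose m : ℝ) * ((1 / (m : ℝ)) ^ 2 * (m * M.choose m * G)) := by gcongr
        _ = G / m := by field_simp

theorem memLp_localDrift (ho : LocalOracle P.D D F L s G) (hS : IsSampling Pr P m S ξ)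
    (hw : Measurable[genSigma S ξ {j | sampleRound j < t}] w) (hw2 : MemLp w 2 Pr)
    (q : Fin M × ℕ) : MemLp (localDrift D F γ ξ t w q) 2 Pr :=
  (memLp_comp_of_norm_sub_le (ho.lipschitz q.1) (ho.memLp_local hS hw hw2 q.1 q.2)).sub
    (memLp_comp_of_norm_sub_le (ho.lipschitz q.1) hw2)

/-- Plain Cauchy–Schwarz over all clients. The loss of powers of M is acceptable for the drift,
where no orthogonality is available but γ is free. -/
theorem norm_roundAverage_sq_le (u : Fin M × ℕ → Ω → E) (ω : Ω) :
    ‖roundAverage m K S t u ω‖ ^ 2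
      ≤ (1 / ((m : ℝ) * K)) ^ 2 * (M * K
        * ∑ q ∈ (Finset.univ : Finset (Fin M)) ×ˢ Finset.range K, ‖u q ω‖ ^ 2) := by
  rw [roundAverage, norm_smul, mul_pow, Real.norm_of_nonneg (by positivity)]
  gcongr
  have h1 : ‖∑ q ∈ (Finset.univ : Finset (Fin M)) ×ˢ Finset.range K,
      participation S t q.1 ω • u q ω‖
      ≤ ∑ q ∈ (Finset.univ : Finset (Fin M)) ×ˢ Finset.range K, ‖u q ω‖ := by
    refine (norm_sum_le _ _).trans (Finset.sum_le_sum fun q _ => ?_)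
    rw [norm_smul]
    refine mul_le_of_le_one_left (norm_nonneg _) ?_
    simp only [participation]
    split_ifs <;> simp
  refine (pow_le_pow_left₀ (norm_nonneg _) h1 2).trans ?_
  have := sq_sum_le_card_mul_sum_sq (s := (Finset.univ : Finset (Fin M)) ×ˢ Finset.range K)
    (f := fun q => ‖u q ω‖)
  rw [Finset.card_product, Finset.card_univ, Fintype.card_fin, Finset.card_range] at this
  exact_mod_cast this

theorem memLp_roundAverage_drift (ho : LocalOracle P.D D F L s G) (hS : IsSampling Pr P m S ξ)
    (hw : Measurable[genSigma S ξ {j | sampleRound j < t}] w) (hw2 : MemLp w 2 Pr) :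
    MemLp (roundAverage m K S t (localDrift D F γ ξ t w)) 2 Pr := by
  have h : ∀ q : Fin M × ℕ,
      MemLp (fun ω => participation S t q.1 ω • localDrift D F γ ξ t w q ω) 2 Pr := fun q => ?_
  · exact (memLp_finsetSum _ fun q _ => h q).const_smul _
  refine (ho.memLp_localDrift (γ := γ) hS hw hw2 q).mono ?_ (Filter.Eventually.of_forall fun ω => ?_)
  · exact (memLp_participation hS t q.1).aestronglyMeasurable.smul
      (ho.memLp_localDrift hS hw hw2 q).aestronglyMeasurable
  · rw [norm_smul]
    refine mul_le_of_le_one_left (norm_nonneg _) ?_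
    simp only [participation]
    split_ifs <;> simp

/-- The bound is relative to the squared mean field, which the decrease of the Lyapunov function can
absorb; G and s remain as an additive error with a factor θ that a small γ makes arbitrarily small.
-/
theorem integral_roundAverage_drift_sq_le (ho : LocalOracle P.D D F L s G)
    (hS : IsSampling Pr P m S ξ) (hm : 1 ≤ m) (hmM : m ≤ M) (hK : 1 ≤ K) (hs : 0 ≤ s)
    {θ : ℝ} (hθ : θ ≤ 1) (hγ : 2 * (M : ℝ) ^ 2 * L ^ 2 * 3 ^ (K + 1) * γ ^ 2 ≤ θ)
    (hw : Measurable[genSigma S ξ {j | sampleRound j < t}] w) (hw2 : MemLp w 2 Pr) :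
    ∫ ω, ‖roundAverage m K S t (localDrift D F γ ξ t w) ω‖ ^ 2 ∂Pr
      ≤ θ * (∫ ω, ‖meanField F (w ω)‖ ^ 2 ∂Pr + G + s) := by
  have hM := hm.trans hmM
  have hm1 : (1 : ℝ) ≤ m := by exact_mod_cast hm
  have hM1 : (1 : ℝ) ≤ M := by exact_mod_cast hM
  have hK1 : (1 : ℝ) ≤ K := by exact_mod_cast hK
  have hG : 0 ≤ G := (sq_nonneg _).trans (ho.heterogeneity ⟨0, hM⟩ 0)
  have h3 : ∀ k ≤ K, (3 : ℝ) ^ k * 3 ≤ 3 ^ (K + 1) := fun k hk => by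
    rw [pow_succ]; gcongr; norm_num
  have hγ6 : 6 * γ ^ 2 * L ^ 2 ≤ 1 := by
    refine le_trans ?_ (hγ.trans hθ)
    have e1 := h3 0 (Nat.zero_le K)
    have e2 : (1 : ℝ) ≤ (M : ℝ) ^ 2 := one_le_pow₀ hM1
    have e3 : 2 * (1 : ℝ) * L ^ 2 * 3 * γ ^ 2 ≤ 2 * (M : ℝ) ^ 2 * L ^ 2 * 3 ^ (K + 1) * γ ^ 2 := by
      gcongr
      simpa using e1
    linarith
  set B := ∫ ω, ‖meanField F (w ω)‖ ^ 2 ∂Pr with hB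
  have hmeanL := memLp_comp_of_norm_sub_le (norm_meanField_sub_le hM ho.lipschitz) hw2
  have hB0 : 0 ≤ B := integral_nonneg fun _ => sq_nonneg _
  have hF : ∀ i, ∫ ω, ‖F i (w ω)‖ ^ 2 ∂Pr ≤ 2 * B + 2 * G := by
    intro i
    have hi1 : Integrable (fun ω => ‖meanField F (w ω)‖ ^ 2) Pr :=
      hmeanL.integrable_norm_pow (p := 2) two_ne_zero
    have hi2 : Integrable (fun ω => ‖F i (w ω)‖ ^ 2) Pr :=
      (memLp_comp_of_norm_sub_le (ho.lipschitz i) hw2).integrable_norm_pow (p := 2) two_ne_zero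
    have h := integral_mono hi2 ((hi1.const_mul 2).add (integrable_const (2 * G))) fun ω => ?_
    · rw [integral_add' (hi1.const_mul 2) (integrable_const _), integral_const_mul] at h
      simpa using h
    · have h1 := ho.heterogeneity i (w ω)
      have h2 : ‖F i (w ω)‖ ≤ ‖F i (w ω) - meanField F (w ω)‖ + ‖meanField F (w ω)‖ := by
        simpa using norm_add_le (F i (w ω) - meanField F (w ω)) (meanField F (w ω))
      simp only [Pi.add_apply]
      have h4 := pow_le_pow_left₀ (norm_nonneg _) h2 2
      nlinarith [sq_nonneg (‖F i (w ω) - meanField F (w ω)‖ - ‖meanField F (w ω)‖)]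
  have hd : ∀ q ∈ (Finset.univ : Finset (Fin M)) ×ˢ Finset.range K,
      ∫ ω, ‖localDrift D F γ ξ t w q ω‖ ^ 2 ∂Pr
        ≤ L ^ 2 * (3 ^ (K + 1) * γ ^ 2 * (2 * B + 2 * G + s)) := by
    intro q hq
    have hqK : q.2 ≤ K := (Finset.mem_range.1 (Finset.mem_product.1 hq).2).le
    have hi1 : Integrable (fun ω =>
        ‖localSGD (D q.1) γ (fun k => ξ t q.1 k ω) (w ω) q.2 - w ω‖ ^ 2) Pr :=
      ((ho.memLp_local hS hw hw2 q.1 q.2).sub hw2).integrable_norm_pow (p := 2) two_ne_zero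
    have h1 := integral_mono
      ((ho.memLp_localDrift (γ := γ) hS hw hw2 q).integrable_norm_pow (p := 2) two_ne_zero)
      (hi1.const_mul (L ^ 2)) fun ω => by
        have := pow_le_pow_left₀ (norm_nonneg _) (ho.lipschitz q.1
          (localSGD (D q.1) γ (fun k => ξ t q.1 k ω) (w ω) q.2) (w ω)) 2
        rwa [mul_pow] at this
    refine h1.trans ?_
    rw [integral_const_mul]
    refine mul_le_mul_of_nonneg_left ?_ (sq_nonneg L)
    refine (ho.integral_drift_le hS hγ6 hw hw2 q.1 q.2).trans ?_
    have h4 := hF q.1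
    have h5 : 0 ≤ ∫ ω, ‖F q.1 (w ω)‖ ^ 2 ∂Pr := integral_nonneg fun _ => sq_nonneg _
    calc ((3 : ℝ) ^ q.2 - 1) * (3 * γ ^ 2 * (∫ ω, ‖F q.1 (w ω)‖ ^ 2 ∂Pr + s))
        ≤ (3 : ℝ) ^ q.2 * (3 * γ ^ 2 * (2 * B + 2 * G + s)) := by
          gcongr
          linarith
      _ = (3 : ℝ) ^ q.2 * 3 * γ ^ 2 * (2 * B + 2 * G + s) := by ring
      _ ≤ 3 ^ (K + 1) * γ ^ 2 * (2 * B + 2 * G + s) := by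
          gcongr
          exact h3 q.2 hqK
  have hint : ∀ q ∈ (Finset.univ : Finset (Fin M)) ×ˢ Finset.range K,
      Integrable (fun ω => ‖localDrift D F γ ξ t w q ω‖ ^ 2) Pr := fun q _ =>
    (ho.memLp_localDrift hS hw hw2 q).integrable_norm_pow (p := 2) two_ne_zero
  have h6 := integral_mono
    ((ho.memLp_roundAverage_drift (γ := γ) (m := m) (K := K) hS hw hw2).integrable_norm_pow
      (p := 2) two_ne_zero)
    (((integrable_finsetSum _ hint).const_mul ((M : ℝ) * K)).const_mul ((1 / ((m : ℝ) * K)) ^ 2))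
    (fun ω => norm_roundAverage_sq_le _ ω)
  refine h6.trans ?_
  rw [integral_const_mul, integral_const_mul, integral_finsetSum _ hint]
  have h7 := Finset.sum_le_sum hd
  rw [Finset.sum_const, Finset.card_product, Finset.card_univ, Fintype.card_fin,
    Finset.card_range, nsmul_eq_mul] at h7
  set R := L ^ 2 * (3 ^ (K + 1) * γ ^ 2 * (2 * B + 2 * G + s)) with hR
  have hR0 : 0 ≤ R := by positivity
  calc _ ≤ (1 / ((m : ℝ) * K)) ^ 2 * (M * K * (((M * K : ℕ) : ℝ) * R)) := by gcongr
    _ = (1 / (m : ℝ)) ^ 2 * ((M : ℝ) ^ 2 * R) := by push_cast; field_simp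
    _ ≤ 1 * ((M : ℝ) ^ 2 * R) := by
        gcongr
        exact pow_le_one₀ (by positivity) ((div_le_one (by positivity)).2 hm1)
    _ ≤ (2 * (M : ℝ) ^ 2 * L ^ 2 * 3 ^ (K + 1) * γ ^ 2) * (B + G + s) := by
        rw [hR]
        have : 0 ≤ (M : ℝ) ^ 2 * L ^ 2 * 3 ^ (K + 1) * γ ^ 2 * s := by positivity
        nlinarith
    _ ≤ θ * (B + G + s) := by gcongr

end LocalOracle

end Decomposition

/-! ### Convergence of perturbed steps measured by a Lyapunov function -/

section Lyapunov

variable {M d₁ d₂ m K : ℕ} {Ξ : Type u} [MeasurableSpace Ξ] {Ω : Type v} {mΩ : MeasurableSpace Ω}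
  {Pr : Measure Ω} {P : FedProblem M d₁ d₂ Ξ} {S : ℕ → Ω → Finset (Fin M)}
  {ξ : ℕ → Fin M → ℕ → Ω → Ξ}
  {E : Type*} [NormedAddCommGroup E] [InnerProductSpace ℝ E]
  {D : Fin M → E → Ξ → E} {F : Fin M → E → E} {L s G γ γg : ℝ}

/-- A nonnegative function that decreases quadratically along the field `B`. -/
structure IsLyapunov (V : E → ℝ) (A B : E → E) (q : E → ℝ) (l μ : ℝ) : Prop where
  l_pos : 0 < l
  nonneg : ∀ w, 0 ≤ V w
  descent : ∀ w d, V (w + d) ≤ V w + inner ℝ (A w) d + 3 * l * ‖d‖ ^ 2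
  inner_le : ∀ w, inner ℝ (A w) (B w) ≤ -q w
  norm_grad_sq_le : ∀ w, ‖A w‖ ^ 2 ≤ 3 * q w
  norm_field_sq_le : ∀ w, ‖B w‖ ^ 2 ≤ 6 * q w
  mul_le : ∀ w, 2 * μ * V w ≤ q w

namespace IsLyapunov

variable {V : E → ℝ} {A B : E → E} {q : E → ℝ} {l μ : ℝ}

/-- One gradient step of length 1/(6l) keeps V nonnegative. This makes A along the iterates square
integrable once V is integrable. -/
theorem norm_grad_sq_le_mul (h : IsLyapunov V A B q l μ) (w : E) : ‖A w‖ ^ 2 ≤ 12 * l * V w := by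
  have hl := h.l_pos
  have h1 := h.descent w (-(1 / (6 * l)) • A w)
  have h2 := h.nonneg (w + -(1 / (6 * l)) • A w)
  rw [inner_smul_right, real_inner_self_eq_norm_sq, norm_smul, mul_pow, Real.norm_eq_abs,
    sq_abs] at h1
  have e : -(1 / (6 * l)) * ‖A w‖ ^ 2 + 3 * l * ((-(1 / (6 * l))) ^ 2 * ‖A w‖ ^ 2)
      = -(‖A w‖ ^ 2 / (12 * l)) := by field_simp; ring
  have h3 : ‖A w‖ ^ 2 / (12 * l) ≤ V w := by linarith
  rw [div_le_iff₀ (by positivity)] at h3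
  linarith

/-- One perturbed step along the field `B`. -/
theorem step_le (h : IsLyapunov V A B q l μ) {η : ℝ} (hη : 0 ≤ η) (hηl : 432 * l * η ≤ 1)
    (w n b : E) :
    V (w + η • (B w + n + b)) ≤ (1 - η * μ) * V w - η / 48 * ‖B w‖ ^ 2 + η * inner ℝ (A w) n
      + 9 * l * η ^ 2 * ‖n‖ ^ 2 + 4 * η * ‖b‖ ^ 2 := by
  have hl := h.l_pos
  have h1 := h.descent w (η • (B w + n + b))
  rw [inner_smul_right, inner_add_right, inner_add_right, norm_smul, mul_pow,
    Real.norm_eq_abs, sq_abs] at h1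
  have h2 : ‖B w + n + b‖ ^ 2 ≤ 3 * (‖B w‖ ^ 2 + ‖n‖ ^ 2 + ‖b‖ ^ 2) := by
    have e1 : ‖B w + n + b‖ ≤ ‖B w‖ + ‖n‖ + ‖b‖ := norm_add₃_le
    have e2 := pow_le_pow_left₀ (norm_nonneg _) e1 2
    nlinarith [sq_nonneg (‖B w‖ - ‖n‖), sq_nonneg (‖B w‖ - ‖b‖), sq_nonneg (‖n‖ - ‖b‖)]
  -- Young's inequality with weight chosen so that ‖A‖² ≤ 3q costs exactly q/4.
  have h3 : inner ℝ (A w) b ≤ q w / 4 + 3 * ‖b‖ ^ 2 := by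
    have e1 := real_inner_le_norm (A w) b
    have e2 := h.norm_grad_sq_le w
    nlinarith [sq_nonneg (‖A w‖ - 6 * ‖b‖)]
  have h4 := h.inner_le w
  have h5 := h.norm_field_sq_le w
  have h6 := h.mul_le w
  have h7 := mul_le_mul_of_nonneg_left h2 (show 0 ≤ 3 * l * η ^ 2 by positivity)
  -- The origin of 432 = 9 · 48. Of the decrease ηq, a quarter pays for the bias and a quarter for
  -- two multiples η/48 of ‖B‖², one for the second order term and one kept to absorb the drift; the
  -- remaining half gives the rate ημ.
  have h8 : 9 * l * η ^ 2 ≤ η / 48 := by nlinarith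
  have h9 := mul_le_mul_of_nonneg_right h8 (sq_nonneg ‖B w‖)
  have h10 := mul_le_mul_of_nonneg_right h8 (sq_nonneg ‖b‖)
  have h11 := mul_le_mul_of_nonneg_left h3 hη
  have h12 := mul_le_mul_of_nonneg_left h4 hη
  have h13 := mul_le_mul_of_nonneg_left h5 hη
  have h14 := mul_le_mul_of_nonneg_left h6 hη
  have h15 : 0 ≤ η * ‖b‖ ^ 2 := by positivity
  linarith

end IsLyapunov

variable [MeasurableSpace E] [BorelSpace E] [SecondCountableTopology E]

theorem IsLyapunov.integrable [IsProbabilityMeasure Pr] {V : E → ℝ} {A B : E → E} {q : E → ℝ}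
    {l μ : ℝ} (h : IsLyapunov V A B q l μ) (hV : Continuous V) {w : Ω → E} (hw : MemLp w 2 Pr) :
    Integrable (fun ω => V (w ω)) Pr := by
  have h1 : Integrable (fun ω => V 0 + inner ℝ (A 0) (w ω) + 3 * l * ‖w ω‖ ^ 2) Pr :=
    ((integrable_const _).add ((hw.const_inner (A 0)).integrable one_le_two)).add
      ((hw.integrable_norm_pow (p := 2) two_ne_zero).const_mul _)
  refine h1.mono' (hV.comp_aestronglyMeasurable hw.aestronglyMeasurable)
    (Filter.Eventually.of_forall fun ω => ?_)
  rw [Real.norm_of_nonneg (h.nonneg _)]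
  simpa using h.descent 0 (w ω)

variable [CompleteSpace E] [IsProbabilityMeasure Pr]

/-- Convergence of local SGD with partial participation, measured by a Lyapunov function. -/
theorem LocalOracle.integral_lyapunov_le (ho : LocalOracle P.D D F L s G)
    (hS : IsSampling Pr P m S ξ) (hm : 1 ≤ m) (hmM : m ≤ M) (hK : 1 ≤ K) (hs : 0 ≤ s)
    {V : E → ℝ} {A : E → E} {q : E → ℝ} {l μ : ℝ} (hV : IsLyapunov V A (meanField F) q l μ)
    (hVc : Continuous V) (hA : Measurable A) (hμ : 0 < μ) (hμl : μ ≤ l) {η θ τ : ℝ}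
    (hη : η = γ * γg * K) (hη0 : 0 < η)
    (hηl : 432 * l * η ≤ 1) (hθ : θ ≤ 1 / 192)
    (hγ : 2 * (M : ℝ) ^ 2 * L ^ 2 * 3 ^ (K + 1) * γ ^ 2 ≤ θ)
    (hτ : (if m = M then 0 else G / m) ≤ τ) (w₀ : E) (T : ℕ) :
    MemLp (fun ω => serverSGD D γ γg m K (fun t => S t ω) (fun t i k => ξ t i k ω) w₀ T) 2 Pr ∧
    ∫ ω, V (serverSGD D γ γg m K (fun t => S t ω) (fun t i k => ξ t i k ω) w₀ T) ∂Pr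
      ≤ (1 - η * μ) ^ T * V w₀ + (18 * l * η * (s / (m * K) + τ) + 4 * θ * (G + s)) / μ := by
  have hl := hV.l_pos
  have hG : 0 ≤ G := (sq_nonneg _).trans (ho.heterogeneity ⟨0, hm.trans hmM⟩ 0)
  have hθ0 : 0 ≤ θ := le_trans (by positivity) hγ
  have hτ0 : 0 ≤ τ := le_trans (by split_ifs <;> positivity) hτ
  have hημ : 0 ≤ 1 - η * μ := by nlinarith
  set R := 18 * l * η * (s / (m * K) + τ) + 4 * θ * (G + s) with hR
  have hR0 : 0 ≤ R := by positivity
  -- Square integrability of the iterates is carried along, since the drift bound and the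
  -- integrability of V in the next round need it.
  induction T with
  | zero =>
    refine ⟨memLp_const w₀, ?_⟩
    simp only [serverSGD, integral_const, probReal_univ, smul_eq_mul, one_mul, pow_zero]
    have : 0 ≤ R / μ := by positivity
    linarith
  | succ t ih =>
    set w : Ω → E :=
      fun ω => serverSGD D γ γg m K (fun t => S t ω) (fun t i k => ξ t i k ω) w₀ t with hwdef
    obtain ⟨hw2, hVt⟩ := ih
    have hw : Measurable[genSigma S ξ {j | sampleRound j < t}] w :=
      measurable_serverSGD ho.measurable γ γg m K S ξ w₀ t
    set n₁ := roundAverage m K S t (localNoise D F γ ξ t w) with hn₁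
    set n₂ := clientError F m S t w with hn₂
    set b := roundAverage m K S t (localDrift D F γ ξ t w) with hb
    have hn₁L : MemLp n₁ 2 Pr := ho.memLp_roundAverage_noise hS hm hmM hw
    obtain ⟨hn₂L, hn₂s⟩ := ho.memLp_clientError hS hm hmM hw
    have hbL : MemLp b 2 Pr := ho.memLp_roundAverage_drift hS hw hw2
    have hBL : MemLp (fun ω => meanField F (w ω)) 2 Pr :=
      memLp_comp_of_norm_sub_le (norm_meanField_sub_le (hm.trans hmM) ho.lipschitz) hw2
    have hVL := hV.integrable hVc hw2
    have hwm : AEMeasurable w Pr := hw2.aestronglyMeasurable.aemeasurable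
    have hAL : MemLp (fun ω => A (w ω)) 2 Pr := by
      have hm1 : AEStronglyMeasurable (fun ω => A (w ω)) Pr :=
        (hA.comp_aemeasurable hwm).aestronglyMeasurable
      rw [memLp_two_iff_integrable_sq_norm hm1]
      refine (hVL.const_mul (12 * l)).mono' (hm1.norm.pow 2)
        (Filter.Eventually.of_forall fun ω => ?_)
      rw [Real.norm_of_nonneg (by positivity)]
      exact hV.norm_grad_sq_le_mul (w ω)
    have hstep : (fun ω => serverSGD D γ γg m K (fun t => S t ω) (fun t i k => ξ t i k ω) w₀ (t + 1))
        =ᵐ[Pr] fun ω => w ω + η • (meanField F (w ω) + (n₁ ω + n₂ ω) + b ω) := by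
      filter_upwards [hS.ae_card hmM t] with ω hω
      rw [hη]
      have := server_step_eq (D := D) (F := F) (γ := γ) (ξ := ξ) (w := w) hm hK γg hω
      rw [← this]
      rfl
    have hnL : MemLp (fun ω => n₁ ω + n₂ ω) 2 Pr := hn₁L.add hn₂L
    have hnewL : MemLp (fun ω => w ω + η • (meanField F (w ω) + (n₁ ω + n₂ ω) + b ω)) 2 Pr :=
      hw2.add (((hBL.add hnL).add hbL).const_smul η)
    refine ⟨hnewL.ae_eq hstep.symm, ?_⟩
    have hint : ∀ ω, V (w ω + η • (meanField F (w ω) + (n₁ ω + n₂ ω) + b ω))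
        ≤ (1 - η * μ) * V (w ω) - η / 48 * ‖meanField F (w ω)‖ ^ 2
          + η * (inner ℝ (A (w ω)) (n₁ ω) + inner ℝ (A (w ω)) (n₂ ω))
          + 18 * l * η ^ 2 * (‖n₁ ω‖ ^ 2 + ‖n₂ ω‖ ^ 2) + 4 * η * ‖b ω‖ ^ 2 := fun ω => by
      have h1 := hV.step_le hη0.le hηl (w ω) (n₁ ω + n₂ ω) (b ω)
      rw [inner_add_right] at h1
      have h2 : ‖n₁ ω + n₂ ω‖ ^ 2 ≤ 2 * (‖n₁ ω‖ ^ 2 + ‖n₂ ω‖ ^ 2) := by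
        have e := pow_le_pow_left₀ (norm_nonneg _) (norm_add_le (n₁ ω) (n₂ ω)) 2
        nlinarith [sq_nonneg (‖n₁ ω‖ - ‖n₂ ω‖)]
      have h3 := mul_le_mul_of_nonneg_left h2 (show 0 ≤ 9 * l * η ^ 2 by positivity)
      linarith
    have i1 : Integrable (fun ω => (1 - η * μ) * V (w ω)) Pr := hVL.const_mul _
    have i2 : Integrable (fun ω => η / 48 * ‖meanField F (w ω)‖ ^ 2) Pr :=
      (hBL.integrable_norm_pow (p := 2) two_ne_zero).const_mul _
    have i3a := integrable_inner_of_memLp hAL hn₁L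
    have i3b := integrable_inner_of_memLp hAL hn₂L
    have i3 : Integrable (fun ω => η * (inner ℝ (A (w ω)) (n₁ ω) + inner ℝ (A (w ω)) (n₂ ω))) Pr :=
      (i3a.add i3b).const_mul _
    have i4a : Integrable (fun ω => ‖n₁ ω‖ ^ 2) Pr :=
      hn₁L.integrable_norm_pow (p := 2) two_ne_zero
    have i4b : Integrable (fun ω => ‖n₂ ω‖ ^ 2) Pr :=
      hn₂L.integrable_norm_pow (p := 2) two_ne_zero
    have i4 : Integrable (fun ω => 18 * l * η ^ 2 * (‖n₁ ω‖ ^ 2 + ‖n₂ ω‖ ^ 2)) Pr :=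
      (i4a.add i4b).const_mul _
    have i5 : Integrable (fun ω => 4 * η * ‖b ω‖ ^ 2) Pr :=
      (hbL.integrable_norm_pow (p := 2) two_ne_zero).const_mul _
    have hle := integral_mono (hV.integrable hVc hnewL) ((((i1.sub i2).add i3).add i4).add i5) hint
    refine (integral_congr_ae (hstep.fun_comp V)).trans_le (hle.trans ?_)
    rw [integral_add' (((i1.sub i2).add i3).add i4) i5, integral_add' ((i1.sub i2).add i3) i4,
      integral_add' (i1.sub i2) i3, integral_sub' i1 i2]
    simp only [integral_const_mul]
    rw [integral_add i3a i3b, integral_add i4a i4b,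
      show ∫ ω, inner ℝ (A (w ω)) (n₁ ω) ∂Pr = 0 from
        ho.integral_inner_roundAverage_noise hS hm hmM hw hA hAL,
      show ∫ ω, inner ℝ (A (w ω)) (n₂ ω) ∂Pr = 0 from
        ho.integral_inner_clientError hS hm hmM hw hA]
    have b1 : ∫ ω, ‖n₁ ω‖ ^ 2 ∂Pr ≤ s / (m * K) :=
      ho.integral_roundAverage_noise_sq_le hS hm hmM hK hw
    have b2 : ∫ ω, ‖n₂ ω‖ ^ 2 ∂Pr ≤ τ := hn₂s.trans hτ
    have b3 : ∫ ω, ‖b ω‖ ^ 2 ∂Pr ≤ θ * (∫ ω, ‖meanField F (w ω)‖ ^ 2 ∂Pr + G + s) :=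
      ho.integral_roundAverage_drift_sq_le hS hm hmM hK hs (hθ.trans (by norm_num)) hγ hw hw2
    have b4 : 0 ≤ ∫ ω, ‖meanField F (w ω)‖ ^ 2 ∂Pr := integral_nonneg fun _ => sq_nonneg _
    set IB := ∫ ω, ‖meanField F (w ω)‖ ^ 2 ∂Pr
    have c1 := mul_le_mul_of_nonneg_left (add_le_add b1 b2)
      (show 0 ≤ 18 * l * η ^ 2 by positivity)
    have c2 := mul_le_mul_of_nonneg_left b3 (show 0 ≤ 4 * η by positivity)
    have c3 : (1 - η * μ) * ∫ ω, V (w ω) ∂Pr ≤ (1 - η * μ) * ((1 - η * μ) ^ t * V w₀ + R / μ) :=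
      mul_le_mul_of_nonneg_left hVt hημ
    -- With θ ≤ 1/192 the drift contribution 4ηθ‖B‖² is covered by the reserve (η/48)‖B‖² of
    -- `step_le`.
    have c4 := mul_le_mul_of_nonneg_right hθ (show 0 ≤ η * IB by positivity)
    -- R/μ is the fixed point of a ↦ (1 - ημ)a + ηR, so the noise floor reproduces itself.
    have c5 : (1 - η * μ) * (R / μ) + η * R = R / μ := by field_simp; ring
    have c6 : η * R = 18 * l * η ^ 2 * (s / (m * K) + τ) + 4 * η * θ * (G + s) := by
      rw [hR]; ring
    rw [pow_succ' (1 - η * μ) t]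
    generalize R / μ = Q at c3 c5 ⊢
    generalize (1 - η * μ) = ρ at c3 c5 ⊢
    linarith

end Lyapunov

/-! ### Partial gradients -/

section Gradients

variable {d₁ d₂ : ℕ} {g : Vec d₁ → Vec d₂ → ℝ}

theorem hasGradientAt_gradX (hg : Differentiable ℝ fun w : Vec d₁ × Vec d₂ => g w.1 w.2)
    (x : Vec d₁) (y : Vec d₂) : HasGradientAt (fun x' => g x' y) (gradX g x y) x := by
  have h : DifferentiableAt ℝ (fun x' => g x' y) x :=
    (hg (x, y)).comp (f := fun x' : Vec d₁ => (x', y)) x (by fun_prop)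
  exact h.hasGradientAt

theorem hasGradientAt_gradY (hg : Differentiable ℝ fun w : Vec d₁ × Vec d₂ => g w.1 w.2)
    (x : Vec d₁) (y : Vec d₂) : HasGradientAt (fun y' => g x y') (gradY g x y) y := by
  have h : DifferentiableAt ℝ (fun y' => g x y') y :=
    (hg (x, y)).comp (f := fun y' : Vec d₂ => (x, y')) y (by fun_prop)
  exact h.hasGradientAt

theorem hasFDerivAt_uncurry (hg : Differentiable ℝ fun w : Vec d₁ × Vec d₂ => g w.1 w.2)
    (x : Vec d₁) (y : Vec d₂) : HasFDerivAt (fun w : Vec d₁ × Vec d₂ => g w.1 w.2)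
      ((innerSL ℝ (gradX g x y)).comp (ContinuousLinearMap.fst ℝ (Vec d₁) (Vec d₂))
        + (innerSL ℝ (gradY g x y)).comp (ContinuousLinearMap.snd ℝ (Vec d₁) (Vec d₂))) (x, y) := by
  have h := (hg (x, y)).hasFDerivAt
  set G := fderiv ℝ (fun w : Vec d₁ × Vec d₂ => g w.1 w.2) (x, y)
  have hx : HasFDerivAt (fun x' => g x' y) (G.comp (ContinuousLinearMap.inl ℝ (Vec d₁) (Vec d₂))) x :=
    h.comp (f := fun x' : Vec d₁ => (x', y)) x (hasFDerivAt_prodMk_left x y)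
  have hy : HasFDerivAt (fun y' => g x y') (G.comp (ContinuousLinearMap.inr ℝ (Vec d₁) (Vec d₂))) y :=
    h.comp (f := fun y' : Vec d₂ => (x, y')) y (hasFDerivAt_prodMk_right x y)
  have ex := hx.unique (hasGradientAt_gradX hg x y).hasFDerivAt
  have ey := hy.unique (hasGradientAt_gradY hg x y).hasFDerivAt
  convert h using 1
  ext v
  · have := congrArg (fun T => T v) ex
    simpa [InnerProductSpace.toDual_apply_apply] using this.symm
  · have := congrArg (fun T => T v) ey
    simpa [InnerProductSpace.toDual_apply_apply] using this.symm

/-- Each component of the gradient is a pointwise limit of difference quotients with increments 1/n,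
which are measurable in the parameter and the base point jointly. -/
theorem measurable_of_hasGradientAt {α : Type*} [MeasurableSpace α] {d : ℕ} {φ : α → Vec d → ℝ}
    {G : α → Vec d} {p : α → Vec d} (hG : ∀ a, HasGradientAt (φ a) (G a) (p a))
    (hφ : ∀ (c : ℝ) (v : Vec d), Measurable fun a => φ a (p a + c • v)) : Measurable G := by
  have hin : ∀ v : Vec d, Measurable fun a => (inner ℝ v (G a) : ℝ) := by
    intro v
    refine measurable_of_tendsto_metrizable (f := fun (n : ℕ) a =>
      (n : ℝ) * (φ a (p a + (n : ℝ)⁻¹ • v) - φ a (p a))) (fun n => ?_) ?_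
    · have h0 := hφ 0 v
      simp only [zero_smul, add_zero] at h0
      exact ((hφ _ v).sub h0).const_mul _
    · rw [tendsto_pi_nhds]
      intro a
      have h := ((hG a).hasFDerivAt.lim_real v).comp tendsto_natCast_atTop_atTop
      rw [InnerProductSpace.toDual_apply_apply, real_inner_comm] at h
      exact h
  have e : G = fun a => ∑ i, (inner ℝ (stdOrthonormalBasis ℝ (Vec d) i) (G a) : ℝ)
      • stdOrthonormalBasis ℝ (Vec d) i := by
    funext a
    exact ((stdOrthonormalBasis ℝ (Vec d)).sum_repr' (G a)).symm
  rw [e]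
  exact Finset.measurable_fun_sum _ fun i _ => (hin _).smul_const _

section Joint

variable {Ξ : Type u} [MeasurableSpace Ξ] {ℓ : Vec d₁ → Vec d₂ → Ξ → ℝ}

/-- Carathéodory functions: continuous in the model, measurable in the data point. -/
theorem measurable_loss_joint (hm : ∀ x y, Measurable (ℓ x y))
    (hd : ∀ z, Differentiable ℝ fun w : Vec d₁ × Vec d₂ => ℓ w.1 w.2 z) :
    Measurable fun p : (Vec d₁ × Vec d₂) × Ξ => ℓ p.1.1 p.1.2 p.2 :=
  measurable_uncurry_of_continuous_of_measurable (u := fun (w : Vec d₁ × Vec d₂) z => ℓ w.1 w.2 z)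
    (fun z => (hd z).continuous) fun w => hm w.1 w.2

theorem measurable_gradX_joint (hm : ∀ x y, Measurable (ℓ x y))
    (hd : ∀ z, Differentiable ℝ fun w : Vec d₁ × Vec d₂ => ℓ w.1 w.2 z) :
    Measurable fun p : (Vec d₁ × Vec d₂) × Ξ =>
      gradX (fun x' y' => ℓ x' y' p.2) p.1.1 p.1.2 := by
  refine measurable_of_hasGradientAt (p := fun p => p.1.1)
    (φ := fun p x' => ℓ x' p.1.2 p.2) (fun p => hasGradientAt_gradX (g := fun x' y' => ℓ x' y' p.2) (hd p.2) p.1.1 p.1.2) ?_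
  intro c v
  exact (measurable_loss_joint hm hd).comp
    (((measurable_fst.fst.add_const (c • v)).prodMk measurable_fst.snd).prodMk measurable_snd)

theorem measurable_gradY_joint (hm : ∀ x y, Measurable (ℓ x y))
    (hd : ∀ z, Differentiable ℝ fun w : Vec d₁ × Vec d₂ => ℓ w.1 w.2 z) :
    Measurable fun p : (Vec d₁ × Vec d₂) × Ξ =>
      gradY (fun x' y' => ℓ x' y' p.2) p.1.1 p.1.2 := by
  refine measurable_of_hasGradientAt (p := fun p => p.1.2)
    (φ := fun p y' => ℓ p.1.1 y' p.2) (fun p => hasGradientAt_gradY (g := fun x' y' => ℓ x' y' p.2) (hd p.2) p.1.1 p.1.2) ?_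
  intro c v
  exact (measurable_loss_joint hm hd).comp
    ((measurable_fst.fst.prodMk (measurable_fst.snd.add_const (c • v))).prodMk measurable_snd)

end Joint

theorem gradX_add_sq (hg : Differentiable ℝ fun w : Vec d₁ × Vec d₂ => g w.1 w.2) (l : ℝ)
    (xt x : Vec d₁) (y : Vec d₂) :
    gradX (fun x' y' => g x' y' + l * ‖x' - xt‖ ^ 2) x y = gradX g x y + (2 * l) • (x - xt) := by
  refine HasGradientAt.gradient ?_
  rw [hasGradientAt_iff_hasFDerivAt]
  have h1 := (hasGradientAt_gradX hg x y).hasFDerivAt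
  have h2 := (((hasFDerivAt_id (𝕜 := ℝ) x).sub_const xt).norm_sq).const_mul l
  refine (h1.add h2).congr_fderiv ?_
  ext v
  simp
  ring

theorem gradY_add_sq (l : ℝ) (xt x : Vec d₁) (y : Vec d₂) :
    gradY (fun x' y' => g x' y' + l * ‖x' - xt‖ ^ 2) x y = gradY g x y := by
  simp only [gradY, gradient]
  rw [fderiv_add_const]

end Gradients

/-! ### The global function of a federated problem -/

namespace FedProblem

variable {M d₁ d₂ : ℕ} {Ξ : Type u} [MeasurableSpace Ξ] {P : FedProblem M d₁ d₂ Ξ} {l μ : ℝ}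

theorem Smooth.gradX_globalFun (h : P.Smooth l) (x : Vec d₁) (y : Vec d₂) :
    gradX P.globalFun x y = (1 / (M : ℝ)) • ∑ i, gradX (P.localFun i) x y := by
  refine HasGradientAt.gradient ?_
  rw [hasGradientAt_iff_hasFDerivAt]
  have h1 := (HasFDerivAt.fun_sum (u := Finset.univ) fun i _ =>
    (hasGradientAt_gradX (h.differentiable i) x y).hasFDerivAt).const_mul (1 / (M : ℝ))
  refine h1.congr_fderiv ?_
  ext v
  simp

theorem Smooth.gradY_globalFun (h : P.Smooth l) (x : Vec d₁) (y : Vec d₂) :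
    gradY P.globalFun x y = (1 / (M : ℝ)) • ∑ i, gradY (P.localFun i) x y := by
  refine HasGradientAt.gradient ?_
  rw [hasGradientAt_iff_hasFDerivAt]
  have h1 := (HasFDerivAt.fun_sum (u := Finset.univ) fun i _ =>
    (hasGradientAt_gradY (h.differentiable i) x y).hasFDerivAt).const_mul (1 / (M : ℝ))
  refine h1.congr_fderiv ?_
  ext v
  simp

theorem Smooth.smoothPair_localFun (h : P.Smooth l) (i : Fin M) :
    SmoothPair (P.localFun i) (gradX (P.localFun i)) (gradY (P.localFun i)) l where
  hasFDerivAt := hasFDerivAt_uncurry (h.differentiable i)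
  lipschitz := h.lipschitz i

theorem norm_toLp_eq {E₁ E₂ : Type*} [NormedAddCommGroup E₁] [NormedAddCommGroup E₂]
    (a : E₁) (b : E₂) : ‖WithLp.toLp 2 (a, b)‖ = Real.sqrt (‖a‖ ^ 2 + ‖b‖ ^ 2) := by
  rw [← Real.sqrt_sq (norm_nonneg (WithLp.toLp 2 (a, b))), WithLp.prod_norm_sq_eq_of_L2]
  rfl

/-- The quantity bounded is a norm on the Euclidean product, so the triangle inequality there
averages the client bounds with the same l; treating the two gradients separately would lose a
constant. -/
theorem Smooth.smoothPair_globalFun (h : P.Smooth l) (hM : 1 ≤ M) :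
    SmoothPair P.globalFun (gradX P.globalFun) (gradY P.globalFun) l where
  hasFDerivAt := by
    refine hasFDerivAt_uncurry ?_
    have : Differentiable ℝ fun w : Vec d₁ × Vec d₂ => ∑ i, P.localFun i w.1 w.2 :=
      Differentiable.fun_sum fun i _ => h.differentiable i
    exact this.const_mul _
  lipschitz := by
    intro x₁ x₂ y₁ y₂
    have hM0 : (0 : ℝ) < M := by exact_mod_cast hM
    rw [h.gradX_globalFun, h.gradX_globalFun, h.gradY_globalFun, h.gradY_globalFun, ← smul_sub,
      ← smul_sub, ← Finset.sum_sub_distrib, ← Finset.sum_sub_distrib, ← norm_toLp_eq]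
    set a := fun i => gradX (P.localFun i) x₁ y₁ - gradX (P.localFun i) x₂ y₂
    set b := fun i => gradY (P.localFun i) x₁ y₁ - gradY (P.localFun i) x₂ y₂
    have e : WithLp.toLp 2 ((1 / (M : ℝ)) • ∑ i, a i, (1 / (M : ℝ)) • ∑ i, b i)
        = (1 / (M : ℝ)) • ∑ i, WithLp.toLp 2 (a i, b i) := by
      rw [← WithLp.toLp_sum, ← WithLp.toLp_smul]
      congr 1
      ext1 <;> simp [Prod.fst_sum, Prod.snd_sum, a, b]
    rw [e, norm_smul, Real.norm_of_nonneg (by positivity)]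
    have h1 : ‖∑ i, WithLp.toLp 2 (a i, b i)‖ ≤ M * (l * (‖x₁ - x₂‖ + ‖y₁ - y₂‖)) := by
      refine (norm_sum_le _ _).trans ((Finset.sum_le_sum fun i _ => ?_).trans_eq
        (b := ∑ _i : Fin M, l * (‖x₁ - x₂‖ + ‖y₁ - y₂‖)) (by simp))
      rw [norm_toLp_eq]
      exact h.lipschitz i x₁ x₂ y₁ y₂
    calc 1 / (M : ℝ) * ‖∑ i, WithLp.toLp 2 (a i, b i)‖
        ≤ 1 / (M : ℝ) * (M * (l * (‖x₁ - x₂‖ + ‖y₁ - y₂‖))) := by gcongr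
      _ = l * (‖x₁ - x₂‖ + ‖y₁ - y₂‖) := by field_simp

theorem PLInY.le_Phi (h : P.PLInY μ) (x : Vec d₁) (y : Vec d₂) :
    P.globalFun x y ≤ Phi P.globalFun x := by
  obtain ⟨y₀, hy₀⟩ := h.exists_max x
  exact le_ciSup (f := fun y => P.globalFun x y) ⟨P.globalFun x y₀, by rintro _ ⟨y', rfl⟩; exact hy₀ y'⟩ y

theorem PLInY.exists_eq_Phi (h : P.PLInY μ) (x : Vec d₁) :
    ∃ y, P.globalFun x y = Phi P.globalFun x := by
  obtain ⟨y₀, hy₀⟩ := h.exists_max x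
  exact ⟨y₀, le_antisymm (h.le_Phi x y₀) (ciSup_le hy₀)⟩

theorem differentiable_Phi (hM : 1 ≤ M) (hs : P.Smooth l) (hpl : P.PLInY μ) (hμ : 0 < μ)
    (hμl : μ ≤ l) : Differentiable ℝ (Phi P.globalFun) := fun x => by
  obtain ⟨y, hy⟩ := hpl.exists_eq_Phi x
  exact ((hs.smoothPair_globalFun hM).hasGradientAt_max (hμ.trans_le hμl) hμ hpl.le_Phi
    hpl.exists_eq_Phi hpl.pl hy).hasFDerivAt.differentiableAt

theorem exists_regSaddle (hM : 1 ≤ M) (hs : P.Smooth l) (hpl : P.PLInY μ)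
    (hb : P.PhiBoundedBelow) (hμ : 0 < μ) (hμl : μ ≤ l) (xt : Vec d₁) :
    ∃ (H : ℝ) (xs : Vec d₂ → Vec d₁), RegSaddle P.globalFun (gradX P.globalFun)
      (gradY P.globalFun) (Phi P.globalFun) l μ xt H xs := by
  have hl := hμ.trans_le hμl
  have hsp := hs.smoothPair_globalFun hM
  choose xs hxs using hsp.exists_regFun_min hl xt
  obtain ⟨Φs, hΦs⟩ := hb
  -- Boundedness of Φ from below makes H a finite infimum; it need not be attained.
  refine ⟨_, xs, hsp, hμ, hμl, hpl.le_Phi, hpl.exists_eq_Phi, hpl.pl,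
    isGLB_csInf (Set.range_nonempty _) ⟨Φs, ?_⟩, fun x y => hxs y x⟩
  rintro _ ⟨x, rfl⟩
  have := hΦs x
  have h2 : 0 ≤ l * ‖x - xt‖ ^ 2 := by positivity
  change Φs ≤ Phi P.globalFun x + l * ‖x - xt‖ ^ 2
  linarith

end FedProblem

/-! ### FESS-GDA on the regularized problem as local SGD -/

section Link

variable {M d₁ d₂ : ℕ} {Ξ : Type u} [MeasurableSpace Ξ] {P : FedProblem M d₁ d₂ Ξ}
  {l μ σ σG : ℝ}

/-- The Euclidean product of the two variable spaces. -/
abbrev PairSpace (d₁ d₂ : ℕ) : Type := WithLp 2 (Vec d₁ × Vec d₂)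

/-- The stochastic descent-ascent direction of client `i` on the regularized problem. -/
def dirSample (P : FedProblem M d₁ d₂ Ξ) (l : ℝ) (xt : Vec d₁) (i : Fin M) (w : PairSpace d₁ d₂)
    (z : Ξ) : PairSpace d₁ d₂ :=
  WithLp.toLp 2
    (-(2 : ℝ) • (gradX (fun x' y' => P.loss i x' y' z) w.fst w.snd + (2 * l) • (w.fst - xt)),
      gradY (fun x' y' => P.loss i x' y' z) w.fst w.snd)

/-- The mean descent-ascent direction of client `i` on the regularized problem. -/
def dirMean (P : FedProblem M d₁ d₂ Ξ) (l : ℝ) (xt : Vec d₁) (i : Fin M) (w : PairSpace d₁ d₂) :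
    PairSpace d₁ d₂ :=
  WithLp.toLp 2
    (-(2 : ℝ) • (gradX (P.localFun i) w.fst w.snd + (2 * l) • (w.fst - xt)),
      gradY (P.localFun i) w.fst w.snd)

theorem norm_toLp_sq {E₁ E₂ : Type*} [NormedAddCommGroup E₁] [NormedAddCommGroup E₂]
    (a : E₁) (b : E₂) : ‖WithLp.toLp 2 (a, b)‖ ^ 2 = ‖a‖ ^ 2 + ‖b‖ ^ 2 := by
  rw [WithLp.prod_norm_sq_eq_of_L2]; rfl

theorem norm_fst_le_norm (w : PairSpace d₁ d₂) : ‖w.fst‖ ≤ ‖w‖ := by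
  refine le_of_sq_le_sq ?_ (norm_nonneg _)
  rw [WithLp.prod_norm_sq_eq_of_L2]
  nlinarith [sq_nonneg ‖w.snd‖]

theorem norm_snd_le_norm (w : PairSpace d₁ d₂) : ‖w.snd‖ ≤ ‖w‖ := by
  refine le_of_sq_le_sq ?_ (norm_nonneg _)
  rw [WithLp.prod_norm_sq_eq_of_L2]
  nlinarith [sq_nonneg ‖w.fst‖]

theorem meanField_dirMean (hM : 1 ≤ M) (hs : P.Smooth l) (xt : Vec d₁) (w : PairSpace d₁ d₂) :
    meanField (dirMean P l xt) w = WithLp.toLp 2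
      (-(2 : ℝ) • regGx (gradX P.globalFun) l xt w.fst w.snd, gradY P.globalFun w.fst w.snd) := by
  have hM0 : (M : ℝ) ≠ 0 := by exact_mod_cast (by omega : M ≠ 0)
  rw [meanField, regGx, hs.gradX_globalFun, hs.gradY_globalFun]
  simp only [dirMean]
  rw [← WithLp.toLp_sum, ← WithLp.toLp_smul]
  congr 1
  refine Prod.ext ?_ ?_
  · simp only [Prod.smul_fst, Prod.fst_sum]
    rw [← Finset.smul_sum, Finset.sum_add_distrib, Finset.sum_const, Finset.card_univ,
      Fintype.card_fin, ← Nat.cast_smul_eq_nsmul ℝ, smul_comm, smul_add, smul_smul,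
      one_div_mul_cancel hM0, one_smul]
  · simp only [Prod.smul_snd, Prod.snd_sum]

theorem dirSample_sub_dirMean (xt : Vec d₁) (i : Fin M) (w : PairSpace d₁ d₂) (z : Ξ) :
    dirSample P l xt i w z - dirMean P l xt i w = WithLp.toLp 2
      (-(2 : ℝ) • (gradX (fun x' y' => P.loss i x' y' z) w.fst w.snd
          - gradX (P.localFun i) w.fst w.snd),
        gradY (fun x' y' => P.loss i x' y' z) w.fst w.snd - gradY (P.localFun i) w.fst w.snd) := by
  rw [dirSample, dirMean, ← WithLp.toLp_sub]
  congr 1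
  refine Prod.ext ?_ rfl
  simp only [Prod.fst_sub]
  rw [← smul_sub, add_sub_add_right_eq_sub]

theorem norm_neg_two_smul_sq {E : Type*} [NormedAddCommGroup E] [NormedSpace ℝ E] (v : E) :
    ‖-(2 : ℝ) • v‖ ^ 2 = 4 * ‖v‖ ^ 2 := by
  rw [norm_smul, mul_pow]; norm_num

/-- The factor 2 in the x-direction multiplies variances by at most 4. For the Lipschitz constant,
the x-part contributes 2 · 4l and the y-part 2l, and √(8² + 2²) ≤ 10. -/
theorem localOracle_dir (hM : 1 ≤ M) (hl : 0 ≤ l) (hr : P.Regular) (hs : P.Smooth l)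
    (hv : P.BoundedVariance σ) (hh : P.BoundedHeterogeneity σG) (xt : Vec d₁) :
    LocalOracle P.D (dirSample P l xt) (dirMean P l xt) (10 * l) (4 * σ ^ 2) (4 * σG ^ 2) where
  measurable i := by
    have hproj : Measurable fun p : PairSpace d₁ d₂ × Ξ => ((p.1.fst, p.1.snd), p.2) := by
      have h1 : Measurable fun w : PairSpace d₁ d₂ => (w.fst, w.snd) := WithLp.measurable_ofLp 2 _
      exact (h1.comp measurable_fst).prodMk measurable_snd
    have hx := (measurable_gradX_joint (ℓ := P.loss i) (hr.measurable_loss i)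
      (hr.differentiable_loss i)).comp hproj
    have hy := (measurable_gradY_joint (ℓ := P.loss i) (hr.measurable_loss i)
      (hr.differentiable_loss i)).comp hproj
    exact (WithLp.measurable_toLp 2 _).comp
      (((hx.add ((hproj.fst.fst.sub_const xt).const_smul (2 * l))).const_smul (-(2 : ℝ))).prodMk hy)
  integrable i w := by
    have := P.prob i
    have h1 := (((hv.integrable_gradX i w.fst w.snd).add
      (integrable_const ((2 * l) • (w.fst - xt)))).smul (-(2 : ℝ))).prodMk
        (hv.integrable_gradY i w.fst w.snd)
    exact (WithLp.prodContinuousLinearEquiv 2 ℝ (Vec d₁) (Vec d₂)).symm.toContinuousLinearMap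
      |>.integrable_comp h1
  integral_eq i w := by
    have := P.prob i
    have h1 : Integrable (fun z => -(2 : ℝ) • (gradX (fun x' y' => P.loss i x' y' z) w.fst w.snd
        + (2 * l) • (w.fst - xt))) (P.D i) :=
      ((hv.integrable_gradX i w.fst w.snd).add
        (integrable_const ((2 * l) • (w.fst - xt)))).smul (-(2 : ℝ))
    have h2 := hv.integrable_gradY i w.fst w.snd
    have h3 := (WithLp.prodContinuousLinearEquiv 2 ℝ (Vec d₁) (Vec d₂)).symm.integral_comp_comm
      (μ := P.D i) fun z => (-(2 : ℝ) • (gradX (fun x' y' => P.loss i x' y' z) w.fst w.snd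
        + (2 * l) • (w.fst - xt)), gradY (fun x' y' => P.loss i x' y' z) w.fst w.snd)
    refine h3.trans ?_
    rw [integral_pair h1 h2, integral_smul, integral_add (hv.integrable_gradX i w.fst w.snd)
      (integrable_const _), hv.unbiased_gradX, hv.unbiased_gradY]
    simp [dirMean]
  integrable_sq i w := by
    simp_rw [dirSample_sub_dirMean, norm_toLp_sq, norm_neg_two_smul_sq]
    have hmx : AEStronglyMeasurable (fun z => gradX (fun x' y' => P.loss i x' y' z) w.fst w.snd
        - gradX (P.localFun i) w.fst w.snd) (P.D i) :=
      (hv.integrable_gradX i w.fst w.snd).aestronglyMeasurable.sub aestronglyMeasurable_const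
    have hmy : AEStronglyMeasurable (fun z => gradY (fun x' y' => P.loss i x' y' z) w.fst w.snd
        - gradY (P.localFun i) w.fst w.snd) (P.D i) :=
      (hv.integrable_gradY i w.fst w.snd).aestronglyMeasurable.sub aestronglyMeasurable_const
    refine ((hv.integrable_sq i w.fst w.snd).const_mul 4).mono'
      (((hmx.norm.pow 2).const_mul 4).add (hmy.norm.pow 2)) (Filter.Eventually.of_forall fun z => ?_)
    rw [Real.norm_of_nonneg (by positivity)]
    nlinarith [sq_nonneg ‖gradY (fun x' y' => P.loss i x' y' z) w.fst w.snd
      - gradY (P.localFun i) w.fst w.snd‖]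
  variance_le i w := by
    simp_rw [dirSample_sub_dirMean, norm_toLp_sq, norm_neg_two_smul_sq]
    have h1 := hv.variance_le i w.fst w.snd
    refine le_trans (integral_mono_of_nonneg (g := fun z => 4 *
      (‖gradX (fun x' y' => P.loss i x' y' z) w.fst w.snd - gradX (P.localFun i) w.fst w.snd‖ ^ 2
      + ‖gradY (fun x' y' => P.loss i x' y' z) w.fst w.snd - gradY (P.localFun i) w.fst w.snd‖ ^ 2))
      (Filter.Eventually.of_forall fun z => ?_) ((hv.integrable_sq i w.fst w.snd).const_mul 4)
      (Filter.Eventually.of_forall fun z => ?_)) ?_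
    · simp only [Pi.zero_apply]
      positivity
    · nlinarith [sq_nonneg ‖gradY (fun x' y' => P.loss i x' y' z) w.fst w.snd
        - gradY (P.localFun i) w.fst w.snd‖]
    · rw [integral_const_mul]
      linarith
  lipschitz i w w' := by
    have hsp := hs.smoothPair_localFun i
    have h1 := hsp.norm_gx_sub_le w.fst w'.fst w.snd w'.snd
    have h2 := hsp.norm_gy_sub_le w.fst w'.fst w.snd w'.snd
    have e1 : ‖w.fst - w'.fst‖ ≤ ‖w - w'‖ := norm_fst_le_norm (w - w')
    have e2 : ‖w.snd - w'.snd‖ ≤ ‖w - w'‖ := norm_snd_le_norm (w - w')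
    have e : dirMean P l xt i w - dirMean P l xt i w' = WithLp.toLp 2
        (-(2 : ℝ) • ((gradX (P.localFun i) w.fst w.snd - gradX (P.localFun i) w'.fst w'.snd)
          + (2 * l) • (w.fst - w'.fst)),
        gradY (P.localFun i) w.fst w.snd - gradY (P.localFun i) w'.fst w'.snd) := by
      rw [dirMean, dirMean, ← WithLp.toLp_sub]
      congr 1
      refine Prod.ext ?_ rfl
      simp only [Prod.fst_sub]
      rw [← smul_sub, add_sub_add_comm, ← smul_sub (2 * l), sub_sub_sub_cancel_right]
    have h3 : ‖(gradX (P.localFun i) w.fst w.snd - gradX (P.localFun i) w'.fst w'.snd)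
          + (2 * l) • (w.fst - w'.fst)‖ ≤ 4 * l * ‖w - w'‖ := by
      refine (norm_add_le _ _).trans ?_
      rw [norm_smul, Real.norm_of_nonneg (by positivity)]
      nlinarith
    have h4 : ‖gradY (P.localFun i) w.fst w.snd - gradY (P.localFun i) w'.fst w'.snd‖
        ≤ 2 * l * ‖w - w'‖ := by nlinarith
    refine le_of_sq_le_sq ?_ (by positivity)
    rw [e, norm_toLp_sq, norm_neg_two_smul_sq]
    have h5 := pow_le_pow_left₀ (norm_nonneg _) h3 2
    have h6 := pow_le_pow_left₀ (norm_nonneg _) h4 2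
    nlinarith [sq_nonneg (l * ‖w - w'‖)]
  heterogeneity i w := by
    rw [meanField_dirMean hM hs, dirMean, ← WithLp.toLp_sub]
    have h1 := hh i w.fst w.snd
    have e : ((-(2 : ℝ) • (gradX (P.localFun i) w.fst w.snd + (2 * l) • (w.fst - xt)),
          gradY (P.localFun i) w.fst w.snd) : Vec d₁ × Vec d₂)
        - (-(2 : ℝ) • regGx (gradX P.globalFun) l xt w.fst w.snd, gradY P.globalFun w.fst w.snd)
        = (-(2 : ℝ) • (gradX (P.localFun i) w.fst w.snd - gradX P.globalFun w.fst w.snd),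
          gradY (P.localFun i) w.fst w.snd - gradY P.globalFun w.fst w.snd) := by
      refine Prod.ext ?_ rfl
      simp only [Prod.fst_sub, regGx]
      rw [← smul_sub, add_sub_add_right_eq_sub]
    rw [e, norm_toLp_sq, norm_neg_two_smul_sq]
    nlinarith [sq_nonneg ‖gradY (P.localFun i) w.fst w.snd - gradY P.globalFun w.fst w.snd‖]

/-- The local rates 2γ for x and γ for y realize the doubled x-direction with a single step size γ.
-/
theorem localIter_eq_localSGD (hr : P.Regular) (xt : Vec d₁) {c : Params} {γ : ℝ}
    (hx : c.ηxl = 2 * γ) (hy : c.ηyl = γ) (i : Fin M) (ξs : ℕ → Ξ) (w : Vec d₁ × Vec d₂) (k : ℕ) :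
    WithLp.toLp 2 (localIter (P.regularize l xt) Set.univ c i ξs w k)
      = localSGD (dirSample P l xt i) γ ξs (WithLp.toLp 2 w) k := by
  induction k with
  | zero => rfl
  | succ k ih =>
    rw [localSGD, ← ih, localIter, projOnto_univ]
    set v := localIter (P.regularize l xt) Set.univ c i ξs w k
    have e1 : gradX (fun x' y' => (P.regularize l xt).loss i x' y' (ξs k)) v.1 v.2
        = gradX (fun x' y' => P.loss i x' y' (ξs k)) v.1 v.2 + (2 * l) • (v.1 - xt) :=
      gradX_add_sq (hr.differentiable_loss i (ξs k)) l xt v.1 v.2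
    have e2 : gradY (fun x' y' => (P.regularize l xt).loss i x' y' (ξs k)) v.1 v.2
        = gradY (fun x' y' => P.loss i x' y' (ξs k)) v.1 v.2 := gradY_add_sq l xt v.1 v.2
    rw [e1, e2, hx, hy, dirSample]
    refine WithLp.ofLp_injective 2 (Prod.ext ?_ rfl)
    simp only [WithLp.ofLp_add, WithLp.ofLp_smul, Prod.fst_add, Prod.smul_fst]
    rw [smul_smul, sub_eq_add_neg, ← neg_smul, mul_neg, mul_comm γ]
    rfl

/-- With p = 0 the smoothing variable z does not influence x and y, so the pair alone is an
iteration. -/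
theorem fessGDA_eq_serverSGD (hr : P.Regular) (xt : Vec d₁) {c : Params} {γ γg : ℝ}
    (hxl : c.ηxl = 2 * γ) (hyl : c.ηyl = γ) (hxg : c.ηxg = γg) (hyg : c.ηyg = γg) (hp : c.p = 0)
    (m : ℕ) (S : ℕ → Finset (Fin M)) (ξ : ℕ → Fin M → ℕ → Ξ) (s₀ : State d₁ d₂) (t : ℕ) :
    WithLp.toLp 2 ((fessGDA (P.regularize l xt) Set.univ c m S ξ s₀ t).x,
        (fessGDA (P.regularize l xt) Set.univ c m S ξ s₀ t).y)
      = serverSGD (dirSample P l xt) γ γg m c.K S ξ (WithLp.toLp 2 (s₀.x, s₀.y)) t := by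
  induction t with
  | zero => rfl
  | succ t ih =>
    rw [serverSGD, ← ih, fessGDA, fessRound, projOnto_univ]
    set r := fessGDA (P.regularize l xt) Set.univ c m S ξ s₀ t
    dsimp only
    simp_rw [← localIter_eq_localSGD hr xt hxl hyl]
    rw [hxg, hyg, hp, mul_zero, zero_smul, sub_zero]
    refine WithLp.ofLp_injective 2 (Prod.ext ?_ ?_)
    · simp only [WithLp.ofLp_add, WithLp.ofLp_smul, WithLp.ofLp_sub, WithLp.ofLp_sum, Prod.fst_add,
        Prod.smul_fst, Prod.fst_sub, Prod.fst_sum]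
    · simp only [WithLp.ofLp_add, WithLp.ofLp_smul, WithLp.ofLp_sub, WithLp.ofLp_sum, Prod.snd_add,
        Prod.smul_snd, Prod.snd_sub, Prod.snd_sum]

/-- The Lyapunov function of the regularized saddle problem decreases along the mean direction. -/
theorem RegSaddle.isLyapunov (hM : 1 ≤ M) (hs : P.Smooth l) {xt : Vec d₁} {H : ℝ}
    {xs : Vec d₂ → Vec d₁} (h : RegSaddle P.globalFun (gradX P.globalFun) (gradY P.globalFun)
      (Phi P.globalFun) l μ xt H xs) :
    IsLyapunov (fun w : PairSpace d₁ d₂ => saddleLyap P.globalFun l xt H xs w.fst w.snd)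
      (fun w => WithLp.toLp 2 (regGx (gradX P.globalFun) l xt w.fst w.snd,
        gradY P.globalFun w.fst w.snd - (2 : ℝ) • gradY P.globalFun (xs w.snd) w.snd))
      (meanField (dirMean P l xt))
      (fun w => ‖regGx (gradX P.globalFun) l xt w.fst w.snd‖ ^ 2
        + ‖gradY P.globalFun (xs w.snd) w.snd‖ ^ 2) l μ where
  l_pos := h.l_pos
  nonneg w := h.saddleLyap_nonneg _ _
  descent w d := by
    rw [WithLp.prod_inner_apply, WithLp.prod_norm_sq_eq_of_L2]
    exact h.saddleLyap_descent w.fst d.fst w.snd d.snd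
  inner_le w := by
    rw [WithLp.prod_inner_apply, meanField_dirMean hM hs]
    exact h.inner_field_le w.fst w.snd
  norm_grad_sq_le w := by
    rw [norm_toLp_sq]
    exact h.norm_lyapGrad_sq_le w.fst w.snd
  norm_field_sq_le w := by
    rw [meanField_dirMean hM hs, norm_toLp_sq, norm_neg_two_smul_sq]
    have := h.norm_gy_sq_le w.fst w.snd
    nlinarith [sq_nonneg ‖gradY P.globalFun (xs w.snd) w.snd‖]
  mul_le w := h.two_mul_saddleLyap_le _ _

theorem RegSaddle.continuous_regGx {H : ℝ} {xt : Vec d₁} {xs : Vec d₂ → Vec d₁}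
    (h : RegSaddle P.globalFun (gradX P.globalFun) (gradY P.globalFun)
      (Phi P.globalFun) l μ xt H xs) :
    Continuous fun w : PairSpace d₁ d₂ => regGx (gradX P.globalFun) l xt w.fst w.snd := by
  have h1 := (h.smooth.continuous_gx h.l_pos.le).comp (WithLp.prod_continuous_ofLp 2 _ _)
  have h2 : Continuous fun w : PairSpace d₁ d₂ => w.fst := WithLp.continuous_fst _ _ _
  exact h1.add ((h2.sub continuous_const).const_smul (2 * l))

theorem RegSaddle.continuous_lyapGrad {H : ℝ} {xt : Vec d₁} {xs : Vec d₂ → Vec d₁}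
    (h : RegSaddle P.globalFun (gradX P.globalFun) (gradY P.globalFun)
      (Phi P.globalFun) l μ xt H xs) :
    Continuous fun w : PairSpace d₁ d₂ => (WithLp.toLp 2
      (regGx (gradX P.globalFun) l xt w.fst w.snd,
        gradY P.globalFun w.fst w.snd - (2 : ℝ) • gradY P.globalFun (xs w.snd) w.snd) :
        PairSpace d₁ d₂) := by
  have h1 := (h.smooth.continuous_gy h.l_pos.le).comp (WithLp.prod_continuous_ofLp 2 _ _)
  have h2 : Continuous fun w : PairSpace d₁ d₂ => w.snd := WithLp.continuous_snd _ _ _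
  have h3 := (h.smooth.continuous_gy h.l_pos.le).comp ((h.continuous_xs.comp h2).prodMk h2)
  exact (WithLp.prod_continuous_toLp 2 _ _).comp
    (h.continuous_regGx.prodMk (h1.sub (h3.const_smul (2 : ℝ))))

theorem RegSaddle.continuous_saddleLyap {H : ℝ} {xt : Vec d₁} {xs : Vec d₂ → Vec d₁}
    (h : RegSaddle P.globalFun (gradX P.globalFun) (gradY P.globalFun)
      (Phi P.globalFun) l μ xt H xs) :
    Continuous fun w : PairSpace d₁ d₂ => saddleLyap P.globalFun l xt H xs w.fst w.snd := by
  have h1 : Continuous fun w : PairSpace d₁ d₂ => w.fst := WithLp.continuous_fst _ _ _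
  have h2 : Continuous fun w : PairSpace d₁ d₂ => w.snd := WithLp.continuous_snd _ _ _
  have hg : Continuous fun w : Vec d₁ × Vec d₂ => regFun P.globalFun l xt w.1 w.2 :=
    h.smooth.continuous_uncurry.add (by fun_prop)
  exact (continuous_const.add (hg.comp (h1.prodMk h2))).sub
    ((hg.comp ((h.continuous_xs.comp h2).prodMk h2)).const_mul 2)

end Link

/-! ### Expected gradient of the primal function and choice of parameters -/

section Final

theorem measurable_gradient {d : ℕ} (φ : Vec d → ℝ) : Measurable (gradient φ) :=
  ((InnerProductSpace.toDual ℝ (Vec d)).symm.continuous.measurable).comp (measurable_fderiv ℝ φ)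

variable {M d₁ d₂ m : ℕ} {Ξ : Type u} [MeasurableSpace Ξ] {P : FedProblem M d₁ d₂ Ξ}
  {l μ σ σG ε : ℝ} {Ω : Type v} [MeasurableSpace Ω] {Pr : Measure Ω} [IsProbabilityMeasure Pr]

/-- A small expected Lyapunov function gives a small expected gradient of the primal function. -/
theorem RegSaddle.integral_gradient_le (hM : 1 ≤ M) (hs : P.Smooth l) {xt : Vec d₁} {H : ℝ}
    {xs : Vec d₂ → Vec d₁} (h : RegSaddle P.globalFun (gradX P.globalFun) (gradY P.globalFun)
      (Phi P.globalFun) l μ xt H xs) (hε : 0 < ε) {yt : Vec d₂}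
    (h1 : ‖gradX P.globalFun xt yt‖ ≤ ε) (h2 : ‖gradY P.globalFun xt yt‖ ≤ ε / Real.sqrt (l / μ))
    {w : Ω → PairSpace d₁ d₂} (hw : MemLp w 2 Pr)
    (hV : ∫ ω, saddleLyap P.globalFun l xt H xs (w ω).fst (w ω).snd ∂Pr
      ≤ 6 * ε ^ 2 / ((l / μ) ^ 2 * l)) :
    Integrable (fun ω => ‖gradient (Phi P.globalFun) (w ω).fst‖) Pr ∧
      ∫ ω, ‖gradient (Phi P.globalFun) (w ω).fst‖ ∂Pr ≤ 658 * ε := by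
  have hl := h.l_pos
  have hμ := h.μ_pos
  have hVi : Integrable (fun ω => saddleLyap P.globalFun l xt H xs (w ω).fst (w ω).snd) Pr :=
    (h.isLyapunov hM hs).integrable h.continuous_saddleLyap hw
  have hdom : Integrable (fun ω => 10 * ε + 108 * ((l / μ) ^ 2 * l / ε)
      * saddleLyap P.globalFun l xt H xs (w ω).fst (w ω).snd) Pr :=
    (integrable_const _).add (hVi.const_mul _)
  have hle := fun ω => h.norm_gradient_max_le hε h1 h2 (w ω).fst (w ω).snd
  have hfst : AEMeasurable (fun ω => (w ω).fst) Pr :=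
    (WithLp.continuous_fst 2 (Vec d₁) (Vec d₂)).measurable.comp_aemeasurable
      hw.aestronglyMeasurable.aemeasurable
  have hint : Integrable (fun ω => ‖gradient (Phi P.globalFun) (w ω).fst‖) Pr := by
    refine hdom.mono' ?_ (Filter.Eventually.of_forall fun ω => ?_)
    · exact ((measurable_gradient _).comp_aemeasurable hfst).norm.aestronglyMeasurable
    · rw [norm_norm]; exact hle ω
  refine ⟨hint, (integral_mono hint hdom hle).trans ?_⟩
  have hsum : ∫ ω, (10 * ε + 108 * ((l / μ) ^ 2 * l / ε)
      * saddleLyap P.globalFun l xt H xs (w ω).fst (w ω).snd) ∂Pr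
      = 10 * ε + 108 * ((l / μ) ^ 2 * l / ε)
        * ∫ ω, saddleLyap P.globalFun l xt H xs (w ω).fst (w ω).snd ∂Pr := by
    rw [integral_add (integrable_const _) (hVi.const_mul _), integral_const, probReal_univ,
      one_smul]
    exact congrArg _ (integral_const_mul _ _)
  rw [hsum]
  have hc : 0 ≤ 108 * ((l / μ) ^ 2 * l / ε) := by positivity
  calc 10 * ε + 108 * ((l / μ) ^ 2 * l / ε)
        * ∫ ω, saddleLyap P.globalFun l xt H xs (w ω).fst (w ω).snd ∂Pr
      ≤ 10 * ε + 108 * ((l / μ) ^ 2 * l / ε) * (6 * ε ^ 2 / ((l / μ) ^ 2 * l)) := by gcongr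
    _ = 658 * ε := by field_simp; norm_num

/-- The choice of the step sizes and of the numbers of steps. -/
theorem exists_stepSizes {σ σG : ℝ} {M m : ℕ} (hm : 1 ≤ m) (hmM : m ≤ M) {l μ ε : ℝ}
    (hμ : 0 < μ) (hκ : 2 < l / μ) (hε : 0 < ε) :
    ∃ (γ γg η θ : ℝ) (K T : ℕ), 0 < γ ∧ 0 < γg ∧ 1 ≤ K ∧ η = γ * γg * K ∧ 0 < η ∧
      432 * l * η ≤ 1 ∧ θ ≤ 1 / 192 ∧
      2 * (M : ℝ) ^ 2 * (10 * l) ^ 2 * 3 ^ (K + 1) * γ ^ 2 ≤ θ ∧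
      (1 - η * μ) ^ T * (3 / 2 * (ε ^ 2 / l))
        + (18 * l * η * (4 * σ ^ 2 / (m * K) + if m = M then 0 else 4 * σG ^ 2 / m)
          + 4 * θ * (4 * σG ^ 2 + 4 * σ ^ 2)) / μ ≤ 6 * ε ^ 2 / ((l / μ) ^ 2 * l) ∧
      (K : ℝ) * T ≤ (1732 * (1 + (σ ^ 2 + σG ^ 2))) *
        max ((l / μ) ^ 5 / (m * ε ^ 2) * Real.log (l / μ)) ((l / μ) * Real.log (l / μ)) ∧
      ((m = M ∨ σG = 0) →
        (T : ℝ) ≤ (1732 * (1 + (σ ^ 2 + σG ^ 2))) * ((l / μ) * Real.log (l / μ))) ∧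
      ((m < M ∧ 0 < σG) → (T : ℝ) ≤ (1732 * (1 + (σ ^ 2 + σG ^ 2))) *
        max ((l / μ) ^ 5 / (m * ε ^ 2) * Real.log (l / μ)) ((l / μ) * Real.log (l / μ))) := by
  set κ := l / μ with hκdef
  have hl : l = κ * μ := by rw [hκdef]; field_simp
  clear_value κ
  have hκ0 : 0 < κ := by linarith
  have hl0 : 0 < l := by rw [hl]; positivity
  have hm0 : (0 : ℝ) < m := by exact_mod_cast hm
  have hM0 : (0 : ℝ) < M := by exact_mod_cast hm.trans hmM
  set s := σ ^ 2 + σG ^ 2 with hs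
  have hs0 : 0 ≤ s := by positivity
  -- Here κ > 2 is used: κ log κ ≥ 1, so that rounding T up to an integer costs only a constant
  -- factor.
  have hlog : 1 / 2 ≤ Real.log κ := by
    have h1 := Real.log_le_log (by norm_num) hκ.le
    have h2 := Real.log_two_gt_d9
    linarith
  set X := κ * Real.log κ with hX
  have hX1 : 1 ≤ X := by rw [hX]; nlinarith
  -- The factor by which the variance s/m has to be reduced to reach ε²/κ³, the level that keeps the
  -- noise floor of order ε²/(κ² l).
  set R := 1 + κ ^ 3 * s / (m * ε ^ 2) with hR
  have hR1 : 1 ≤ R := by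
    have : 0 ≤ κ ^ 3 * s / (m * ε ^ 2) := by positivity
    linarith
  set Y := max (κ ^ 5 / (m * ε ^ 2) * Real.log κ) X with hY
  have hY0 : 0 ≤ Y := le_trans (by linarith) (le_max_right _ _)
  have hRX : R * X ≤ (1 + s) * Y := by
    have e1 : R * X = X + s * (κ ^ 4 / (m * ε ^ 2) * Real.log κ) := by
      rw [hR, hX]; field_simp
    have e2 : κ ^ 4 / (m * ε ^ 2) * Real.log κ ≤ Y := by
      refine le_trans ?_ (le_max_left _ _)
      -- The argument yields κ⁴; the fifth power of the claimed bound is slack.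
      have : κ ^ 4 ≤ κ ^ 5 := pow_le_pow_right₀ (by linarith) (by norm_num)
      gcongr
    have e3 : X ≤ Y := le_max_right _ _
    rw [e1]
    linarith [mul_le_mul_of_nonneg_left e2 hs0]
  have hsR : s / (m * R) ≤ ε ^ 2 / κ ^ 3 := by
    rw [div_le_div_iff₀ (by positivity) (by positivity)]
    have : κ ^ 3 * s = (κ ^ 3 * s / (m * ε ^ 2)) * (m * ε ^ 2) := by field_simp
    have h2 : κ ^ 3 * s / (m * ε ^ 2) ≤ R := by rw [hR]; linarith
    have h3 := mul_le_mul_of_nonneg_right h2 (show 0 ≤ (m : ℝ) * ε ^ 2 by positivity)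
    linarith
  clear_value s R X Y
  set τ : ℝ := if m = M then 0 else 4 * σG ^ 2 / m with hτ
  -- the number of local steps and the effective step size
  obtain ⟨K, ρ, hK1, hρ1, hKρ, hρR, hv, hA⟩ : ∃ (K : ℕ) (ρ : ℝ), 1 ≤ K ∧ 1 ≤ ρ ∧ K * ρ ≤ 2 * R ∧
      ρ ≤ R ∧ (4 * σ ^ 2 / (m * K) + τ) / ρ ≤ 4 * (s / (m * R)) ∧ (m = M ∨ σG = 0 → ρ = 1) := by
    -- Without client sampling error, K = ⌈R⌉ local steps reduce the variance and the number of
    -- rounds stays small. Otherwise local steps cannot reduce the sampling error, so K = 1 and the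
    -- step size is divided by ρ = R.
    by_cases hc : m = M ∨ σG = 0
    · refine ⟨⌈R⌉₊, 1, Nat.one_le_ceil_iff.2 (by linarith), le_rfl, ?_, hR1, ?_, fun _ => rfl⟩
      · have := Nat.ceil_lt_add_one (show 0 ≤ R by linarith)
        linarith
      · have hτ0 : τ = 0 := by
          rw [hτ]
          rcases hc with hc | hc
          · rw [if_pos hc]
          · rw [hc]; simp
        have h1 : R ≤ (⌈R⌉₊ : ℝ) := Nat.le_ceil R
        have h2 : σ ^ 2 ≤ s := by rw [hs]; nlinarith [sq_nonneg σG]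
        rw [hτ0, add_zero, div_one, mul_div_assoc]
        gcongr
    · refine ⟨1, R, le_rfl, hR1, by push_cast; linarith, le_rfl, ?_, fun h => absurd h hc⟩
      have h1 : τ ≤ 4 * σG ^ 2 / m := by
        rw [hτ]; split_ifs <;> first | exact le_rfl | positivity
      have h2 : 4 * (s / (m * R)) = (4 * σ ^ 2 / (m * ((1 : ℕ) : ℝ)) + 4 * σG ^ 2 / m) / R := by
        rw [hs]; push_cast; field_simp
      rw [h2]
      gcongr
  clear_value τ
  have hK0 : (0 : ℝ) < K := by exact_mod_cast hK1
  have hρ0 : 0 < ρ := by linarith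
  set η := 1 / (432 * l * ρ) with hη
  have hη0 : 0 < η := by positivity
  clear_value η
  -- The second bound makes the additive drift error at most ε²/κ³; s + 1 instead of s avoids
  -- division by zero in the noiseless homogeneous case.
  set θ := min (1 / 192) (ε ^ 2 / (κ ^ 3 * (16 * (s + 1)))) with hθ
  have hθ0 : 0 < θ := by positivity
  set B := 2 * (M : ℝ) ^ 2 * (10 * l) ^ 2 * 3 ^ (K + 1) with hB
  have hB0 : 0 < B := by positivity
  clear_value B
  -- γ is small enough for the drift bound with tolerance θ; the global rate η/(γK) then restores
  -- the effective step η.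
  set γ := Real.sqrt (θ / B) with hγ
  have hγ0 : 0 < γ := Real.sqrt_pos.2 (by positivity)
  have hγ2 : B * γ ^ 2 = θ := by
    rw [hγ, Real.sq_sqrt (by positivity)]; field_simp
  have hημ : η * μ = 1 / (432 * κ * ρ) := by
    rw [hη, hl]; field_simp
  -- Makes (1 - ημ)^T ≤ exp(-2 log κ) = κ⁻².
  set T := ⌈2 * Real.log κ / (η * μ)⌉₊ with hT
  have hTlow : 2 * Real.log κ ≤ η * μ * T := by
    have := Nat.le_ceil (2 * Real.log κ / (η * μ))
    rw [div_le_iff₀ (by positivity)] at this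
    rw [mul_comm (η * μ)]
    exact this
  have hTup : (T : ℝ) ≤ 866 * (ρ * X) := by
    have h1 : (T : ℝ) < 2 * Real.log κ / (η * μ) + 1 := Nat.ceil_lt_add_one (by positivity)
    have h2 : 2 * Real.log κ / (η * μ) = 864 * (ρ * X) := by
      rw [hημ, hX]; field_simp; norm_num
    rw [h2] at h1
    have h3 : 1 ≤ ρ * X := one_le_mul_of_one_le_of_one_le hρ1 hX1
    linarith
  clear_value T
  have hTs : (T : ℝ) ≤ 866 * ((1 + s) * Y) := by
    have : ρ * X ≤ R * X := by gcongr
    linarith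
  have h1s : 0 ≤ (1 + s) * Y := by positivity
  have hγη : η = γ * (η / (γ * K)) * K := by
    clear_value γ
    field_simp
  have hθ1 : θ ≤ 1 / 192 := min_le_left _ _
  have hθ2 : θ ≤ ε ^ 2 / (κ ^ 3 * (16 * (s + 1))) := min_le_right _ _
  have hBγ : 2 * (M : ℝ) ^ 2 * (10 * l) ^ 2 * 3 ^ (K + 1) * γ ^ 2 ≤ θ := by
    rw [← hB]
    exact hγ2.le
  clear_value γ θ
  refine ⟨γ, η / (γ * K), η, θ, K, T, hγ0, div_pos hη0 (mul_pos hγ0 hK0), hK1, hγη, hη0, ?_,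
    hθ1, hBγ, ?_, ?_, ?_, ?_⟩
  · rw [hη, mul_one_div, div_le_one (by positivity)]
    exact le_mul_of_one_le_right (by positivity) hρ1
  -- In units of ε²/(κ² l): the contracted initial value gives 3/2, and noise and drift together at
  -- most 2, within the allowed 6.
  · have e0 : ε ^ 2 / (κ ^ 3 * μ) = ε ^ 2 / (κ ^ 2 * l) := by
      rw [hl]; field_simp
    have e1 : (1 - η * μ) ^ T ≤ 1 / κ ^ 2 := by
      have h0 : 0 ≤ 1 - η * μ := by
        rw [hημ, sub_nonneg, div_le_one (by positivity)]
        exact one_le_mul_of_one_le_of_one_le (by linarith) hρ1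
      have h1 : 1 - η * μ ≤ Real.exp (-(η * μ)) := by
        have := Real.add_one_le_exp (-(η * μ)); linarith
      calc (1 - η * μ) ^ T ≤ Real.exp (-(η * μ)) ^ T := pow_le_pow_left₀ h0 h1 T
        _ = Real.exp (-(η * μ * T)) := by rw [← Real.exp_nat_mul]; ring_nf
        _ ≤ Real.exp (-(2 * Real.log κ)) := by gcongr
        _ = 1 / κ ^ 2 := by
            rw [Real.exp_neg, mul_comm, Real.exp_mul, Real.exp_log hκ0]
            norm_num
    have e2 : (1 - η * μ) ^ T * (3 / 2 * (ε ^ 2 / l)) ≤ 3 / 2 * (ε ^ 2 / (κ ^ 2 * l)) := by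
      calc (1 - η * μ) ^ T * (3 / 2 * (ε ^ 2 / l)) ≤ 1 / κ ^ 2 * (3 / 2 * (ε ^ 2 / l)) := by gcongr
        _ = 3 / 2 * (ε ^ 2 / (κ ^ 2 * l)) := by field_simp
    have e3 : 18 * l * η * (4 * σ ^ 2 / (m * K) + τ) ≤ ε ^ 2 / κ ^ 3 := by
      have h1 : 18 * l * η * (4 * σ ^ 2 / (m * K) + τ)
          = (4 * σ ^ 2 / (m * K) + τ) / ρ / 24 := by
        rw [hη]
        generalize 4 * σ ^ 2 / (m * K) + τ = a
        field_simp
        ring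
      have h2 : 0 ≤ ε ^ 2 / κ ^ 3 := by positivity
      rw [h1]
      linarith
    have e4 : 4 * θ * (4 * σG ^ 2 + 4 * σ ^ 2) ≤ ε ^ 2 / κ ^ 3 := by
      calc 4 * θ * (4 * σG ^ 2 + 4 * σ ^ 2) = θ * (16 * s) := by rw [hs]; ring
        _ ≤ ε ^ 2 / (κ ^ 3 * (16 * (s + 1))) * (16 * (s + 1)) := by gcongr; linarith
        _ = ε ^ 2 / κ ^ 3 := by field_simp
    have e5 : (18 * l * η * (4 * σ ^ 2 / (m * K) + τ) + 4 * θ * (4 * σG ^ 2 + 4 * σ ^ 2)) / μ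
        ≤ 2 * (ε ^ 2 / (κ ^ 2 * l)) := by
      rw [← e0, div_le_iff₀ hμ]
      have : 2 * (ε ^ 2 / (κ ^ 3 * μ)) * μ = 2 * (ε ^ 2 / κ ^ 3) := by field_simp
      rw [this]
      linarith
    have e6 : 6 * ε ^ 2 / (κ ^ 2 * l) = 6 * (ε ^ 2 / (κ ^ 2 * l)) := by ring
    have e7 : 0 ≤ ε ^ 2 / (κ ^ 2 * l) := by positivity
    rw [e6]
    linarith
  · calc (K : ℝ) * T ≤ K * (866 * (ρ * X)) := by gcongr
      _ = 866 * (K * ρ * X) := by ring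
      _ ≤ 866 * (2 * R * X) := by gcongr
      _ = 1732 * (R * X) := by ring
      _ ≤ 1732 * ((1 + s) * Y) := by gcongr
      _ = 1732 * (1 + s) * Y := by ring
  · intro hc
    rw [hA hc, one_mul] at hTup
    have h1 : 0 ≤ s * X := mul_nonneg hs0 (by linarith)
    linarith
  · intro _
    linarith

end Final

end FedMinimax

end

/-! ### Proof of the theorem -/

theorem proposition1 :
    -- `A` is the constant in "`O(ε)`-stationary point", `C` the one in the complexity bounds
    ∃ A : ℝ, 0 < A ∧ ∀ σ σG : ℝ, 0 ≤ σ → 0 ≤ σG → ∃ C : ℝ, 0 < C ∧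
      ∀ (M m : ℕ), 1 ≤ m → m ≤ M → ∀ l μ ε : ℝ, 0 < μ → μ ≤ l → 0 < ε →
      -- parameters of the algorithm; they depend on `σ, σG, M, m, l, μ, ε` only
      ∃ (c : FedMinimax.Params) (T : ℕ),
        0 < c.ηxl ∧ 0 < c.ηyl ∧ 0 < c.ηxg ∧ 0 < c.ηyg ∧ 0 < c.β ∧ c.β < 1 ∧ c.p = 0 ∧ 1 ≤ c.K ∧
        -- per-client sample complexity `K T`
        ((c.K : ℝ) * T ≤
          C * max ((l / μ) ^ 5 / (m * ε ^ 2) * Real.log (l / μ)) ((l / μ) * Real.log (l / μ))) ∧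
        -- communication complexity `T`
        ((m = M ∨ σG = 0) → (T : ℝ) ≤ C * ((l / μ) * Real.log (l / μ))) ∧
        ((m < M ∧ 0 < σG) → (T : ℝ) ≤
          C * max ((l / μ) ^ 5 / (m * ε ^ 2) * Real.log (l / μ)) ((l / μ) * Real.log (l / μ))) ∧
        ∀ (d₁ d₂ : ℕ) (Ξ : Type*) [MeasurableSpace Ξ] (P : FedMinimax.FedProblem M d₁ d₂ Ξ),
          P.Regular → P.Smooth l → P.BoundedVariance σ → P.BoundedHeterogeneity σG →
          P.PhiBoundedBelow → P.PLInY μ →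
          Differentiable ℝ (FedMinimax.Phi P.globalFun) ∧
          ∀ (xt : FedMinimax.Vec d₁) (yt : FedMinimax.Vec d₂),
            FedMinimax.IsStationaryPoint Set.univ l P.globalFun ε (ε / Real.sqrt (l / μ)) xt yt →
            ∀ (z₀ : FedMinimax.Vec d₁) (Ω : Type*) [MeasurableSpace Ω] (Pr : MeasureTheory.Measure Ω)
              [MeasureTheory.IsProbabilityMeasure Pr]
              (S : ℕ → Ω → Finset (Fin M)) (ξ : ℕ → Fin M → ℕ → Ω → Ξ),
              FedMinimax.IsSampling Pr P m S ξ →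
              -- the output of the algorithm run on `f(x, y) + l ‖x - xt‖²` from `(xt, yt)`
              ∀ xhat : Ω → FedMinimax.Vec d₁,
                (∀ ω, xhat ω = (FedMinimax.fessGDA (P.regularize l xt) Set.univ c m
                  (fun t => S t ω) (fun t i k => ξ t i k ω) ⟨xt, yt, z₀⟩ T).x) →
                MeasureTheory.Integrable
                  (fun ω => ‖gradient (FedMinimax.Phi P.globalFun) (xhat ω)‖) Pr ∧
                ∫ ω, ‖gradient (FedMinimax.Phi P.globalFun) (xhat ω)‖ ∂Pr ≤ A * ε := by
  refine ⟨658, by norm_num, fun σ σG hσ hσG => ⟨1732 * (1 + (σ ^ 2 + σG ^ 2)), by positivity,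
    fun M m hm hmM l μ ε hμ hμl hε => ?_⟩⟩
  have hM := hm.trans hmM
  have hl := hμ.trans_le hμl
  have hκ1 : 1 ≤ l / μ := (one_le_div hμ).2 hμl
  have hlog := Real.log_nonneg hκ1
  -- Without constraint in y the projected gradient measure is just ‖∇_y f‖.
  have hstat : ∀ {d₁ d₂ : ℕ} {f : FedMinimax.Vec d₁ → FedMinimax.Vec d₂ → ℝ} {xt yt},
      FedMinimax.IsStationaryPoint Set.univ l f ε (ε / Real.sqrt (l / μ)) xt yt →
      ‖FedMinimax.gradY f xt yt‖ ≤ ε / Real.sqrt (l / μ) := by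
    intro d₁ d₂ f xt yt h
    have h2 := h.2
    rw [FedMinimax.projOnto_univ, add_sub_cancel_left, norm_smul,
      Real.norm_of_nonneg (by positivity), ← mul_assoc, mul_one_div_cancel hl.ne', one_mul] at h2
    exact h2
  -- For κ = 1 the bounds vanish and force T = 0, so small κ is treated apart: for κ ≤ 2 the
  -- starting value 3ε²/(2l) already meets the target 6ε²/(κ² l), and xt itself is returned.
  rcases le_or_gt (l / μ) 2 with hκ | hκ
  · refine ⟨⟨2, 1, 1, 1, 1 / 2, 0, 1⟩, 0, by norm_num, by norm_num, by norm_num, by norm_num,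
      by norm_num, by norm_num, rfl, le_rfl, by rw [Nat.cast_zero, mul_zero]; positivity,
      fun _ => by rw [Nat.cast_zero]; positivity, fun _ => by rw [Nat.cast_zero]; positivity,
      fun d₁ d₂ Ξ _ P hr hs hv hh hb hpl => ⟨FedMinimax.FedProblem.differentiable_Phi hM hs hpl hμ
        hμl, fun xt yt hst z₀ Ω _ Pr _ S ξ hS xhat hx => ?_⟩⟩
    obtain ⟨H, xs, h⟩ := FedMinimax.FedProblem.exists_regSaddle hM hs hpl hb hμ hμl xt
    have hx' : xhat = fun _ => xt := funext hx
    rw [hx']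
    refine h.integral_gradient_le hM hs hε hst.1 (hstat hst)
      (w := fun _ => WithLp.toLp 2 (xt, yt)) (MeasureTheory.memLp_const _) ?_
    have h0 := (h.saddleLyap_start_le hε hst.1 (hstat hst)).1
    rw [MeasureTheory.integral_const, MeasureTheory.probReal_univ, one_smul]
    refine h0.trans ?_
    have h5 : 6 * ε ^ 2 / ((l / μ) ^ 2 * l) = 6 * (ε ^ 2 / l) / (l / μ) ^ 2 := by field_simp
    rw [h5, le_div_iff₀ (by positivity)]
    have h3 : (l / μ) ^ 2 ≤ 4 := by nlinarith
    have h4 : 0 ≤ ε ^ 2 / l := by positivity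
    nlinarith
  · obtain ⟨γ, γg, η, θ, K, T, hγ, hγg, hK, hη, hη0, hηl, hθ, hγθ, hV, hKT, hTA, hTB⟩ :=
      FedMinimax.exists_stepSizes (σ := σ) (σG := σG) hm hmM hμ hκ hε
    -- The value 1/2 of β is arbitrary, since p = 0.
    refine ⟨⟨2 * γ, γ, γg, γg, 1 / 2, 0, K⟩, T, by positivity, hγ, hγg, hγg, by norm_num,
      by norm_num, rfl, hK, hKT, hTA, hTB,
      fun d₁ d₂ Ξ _ P hr hs hv hh hb hpl => ⟨FedMinimax.FedProblem.differentiable_Phi hM hs hpl hμ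
        hμl, fun xt yt hst z₀ Ω _ Pr _ S ξ hS xhat hx => ?_⟩⟩
    obtain ⟨H, xs, h⟩ := FedMinimax.FedProblem.exists_regSaddle hM hs hpl hb hμ hμl xt
    have ho := FedMinimax.localOracle_dir hM hl.le hr hs hv hh xt
    obtain ⟨hw, hVT⟩ := ho.integral_lyapunov_le hS hm hmM hK (by positivity)
      (h.isLyapunov hM hs) h.continuous_saddleLyap h.continuous_lyapGrad.measurable hμ hμl hη hη0
      hηl hθ hγθ le_rfl (WithLp.toLp 2 (xt, yt)) T
    have hx' : xhat = fun ω => (FedMinimax.serverSGD (FedMinimax.dirSample P l xt) γ γg m K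
        (fun t => S t ω) (fun t i k => ξ t i k ω) (WithLp.toLp 2 (xt, yt)) T).fst := by
      funext ω
      rw [hx ω]
      have := FedMinimax.fessGDA_eq_serverSGD (l := l) hr xt (c := ⟨2 * γ, γ, γg, γg, 1 / 2, 0, K⟩)
        (γ := γ) (γg := γg) rfl rfl rfl rfl rfl m (fun t => S t ω) (fun t i k => ξ t i k ω)
        ⟨xt, yt, z₀⟩ T
      rw [← this]
      rfl
    rw [hx']
    refine h.integral_gradient_le hM hs hε hst.1 (hstat hst) hw (hVT.trans (le_trans ?_ hV))
    have h0 := (h.saddleLyap_start_le hε hst.1 (hstat hst)).1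
    have h1 : 0 ≤ 1 - η * μ := by nlinarith
    gcongr
    exact h0
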